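/- For an oracle $O\subseteq\{0,1\}^*$, let polynomial-time computations be those of deterministic machines with oracle $O$ whose running time is bounded by a polynomial in the input length; $\mathsf{NP}^O$ consists of the sets $\{x:\exists y\,(|y|\le p(|x|)\wedge R(x,y))\}$ with $p$ a polynomial and $R$ a relation decidable in polynomial time relative to $O$, and $\mathsf{coNP}^O$ of their complements. Let $\mathsf{TAUT}^O$ and $\mathsf{SAT}^O$ be the sets of (binary codes of) tautologies and of satisfiable formulas among the propositional formulas with additional oracle gates $\alpha(\varphi_1,\dots,\varphi_k)$, where such a gate is true iff the string of the truth values of $\varphi_1,\dots,\varphi_k$ belongs to $O$. A proof system for a set $C$ (relative to $O$) is a function $P$ computable in polynomial time relative to $O$ with range $C$. It is p-optimal if for every proof system $Q$ for $C$ there is a function $f$, computable in polynomial time relative to $O$, with $P(f(\pi))=Q(\pi)$ for all $\pi$; it is non-uniformly p-optimal if for every proof system $Q$ for $C$ there is a polynomial $h$ such that for every $\pi$ there is $\pi'$ with $|\pi'|\le h(|\pi|)$ and $P(\pi')=Q(\pi)$. A $\mathsf{TFNP}^O$ problem is a pair $(p,R)$ of a polynomial $p$ and a relation $R$ decidable in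 polynomial time relative to $O$ such that every $x$ has a solution, that is, a $y$ with $|y|\le p(|x|)$ and $R(x,y)$. Such a problem $S$ is reducible to a $\mathsf{TFNP}^O$ problem $T$ if $S$ can be solved in polynomial time by a machine with access to $O$ and to an arbitrary function giving solutions of $T$. A disjoint $\mathsf{coNP}^O$ pair is a pair of disjoint sets in $\mathsf{coNP}^O$; $(U_0,U_1)$ is reducible to $(U_0',U_1')$ if some $f$ computable in polynomial time relative to $O$ satisfies $f(U_i)\subseteq U_i'$ for $i=0,1$. An element of either class is complete if every element of the class is reducible to it. Consider the following statements relative to an oracle: * $\mathsf{CON}$: there is no p-optimal proof system for $\mathsf{TAUT}$; * $\mathsf{CON^N}$: there is no non-uniformly p-optimal proof system for $\mathsf{TAUT}$; * $\mathsf{SAT}_c$: there is no p-optimal proof system for $\mathsf{SAT}$; * $\mathsf{TFNP}_c$: there is no complete $\mathsf{TFNP}$ problem; * $\mathsf{DisjCoNP}_c$: there is no complete disjoint $\mathsf{coNP}$ pair. Theorem. For every $Q\in\{\mathsf{CON},\mathsf{CON^N}\}$ and every $Q'\in\{\mathsf{SAT}_c,\mathsf{TFNP}_c,\mathsf{DisjCoNP}_c\}$,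 $Q$ and $Q'$ do not imply each other in relativized worlds: there is an oracle relative to which $Q$ holds and $Q'$ fails, and there is an oracle relative to which $Q'$ holds and $Q$ fails. In particular, there is an oracle relative to which a p-optimal proof system for $\mathsf{TAUT}$ exists but no complete $\mathsf{TFNP}$ problem exists, and there is an oracle relative to which a complete $\mathsf{TFNP}$ problem exists but no p-optimal proof system for $\mathsf{TAUT}$ exists. -/

import Mathlib

namespace RelWorlds

/-- Binary strings; the length `|x|` is `List.length x`. -/
abbrev Str := List Bool

/-- An oracle is a set of binary strings. -/
abbrev Oracle := Set Str

/-! ### Oracle machines with a step count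

A machine is a finite program acting on finitely many stacks of bits (the stacks mentioned in the
program). Stack `0` holds the input at the start and the output at the end, stack `1` is the query
stack, stack `2` is the answer stack; all stacks but the input stack are empty at the start. The
machine halts when the program counter leaves the program. Every instruction costs one step. -/

/-- Instructions.
* `push s b`: push the bit `b` on stack `s` and go to the next instruction.
* `pop s e f t`: if stack `s` is empty, go to instruction `e`; otherwise remove its top bit and go
  to instruction `f` if this bit was `false` and to instruction `t` if it was `true`.
* `query`: ask the oracle the string on the query stack, empty the query stack, replace the
  content of the answer stack by the answer, and go to the next instruction. -/
inductive Instr : Type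
  | push (s : ℕ) (b : Bool)
  | pop (s e f t : ℕ)
  | query

/-- A machine: a finite list of instructions, numbered from `0`. -/
abbrev Prog := List Instr

/-- A configuration: the program counter and the contents of the stacks (top of stack first). -/
structure Config : Type where
  pc : ℕ
  stk : ℕ → Str

/-- The initial configuration on input `x`. -/
def initConfig (x : Str) : Config :=
  { pc := 0, stk := Function.update (fun _ => []) 0 x }

/-- One step of the machine `P` whose queries are answered by the function `g`; a halted
configuration does not change any more. -/
def step (P : Prog) (g : Str → Str) (c : Config) : Config :=
  match P[c.pc]? with
  | none => c
  | some (Instr.push s b) =>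
      { pc := c.pc + 1, stk := Function.update c.stk s (b :: c.stk s) }
  | some (Instr.pop s e f t) =>
      match c.stk s with
      | [] => { pc := e, stk := c.stk }
      | b :: r => { pc := if b then t else f, stk := Function.update c.stk s r }
  | some Instr.query =>
      { pc := c.pc + 1
        stk := Function.update (Function.update c.stk 1 []) 2 (g (c.stk 1)) }

/-- With queries answered by `g`, the machine `P` halts on input `x` after at most `n` steps with
output `y`. -/
def HaltsWith (P : Prog) (g : Str → Str) (x : Str) (n : ℕ) (y : Str) : Prop :=
  P.length ≤ ((step P g)^[n] (initConfig x)).pc ∧ ((step P g)^[n] (initConfig x)).stk 0 = y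

open Classical in
/-- The truth value of `w ∈ O`. -/
noncomputable def memBit (O : Oracle) (w : Str) : Bool := decide (w ∈ O)

/-- The answers of the oracle `O`: one bit telling whether the query belongs to `O`. -/
noncomputable def answer (O : Oracle) (w : Str) : Str := [memBit O w]

/-- Joint access to the oracle `O` and to the function `g`: the first bit of the query selects
which of the two is asked. -/
noncomputable def joinAnswer (O : Oracle) (g : Str → Str) : Str → Str
  | [] => []
  | false :: w => answer O w
  | true :: w => g w

/-! ### Polynomial time relative to an oracle -/

/-- `f` is computable in polynomial time relative to `O`. -/
def PolyTimeFun (O : Oracle) (f : Str → Str) : Prop :=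
  ∃ (P : Prog) (p : Polynomial ℕ), ∀ x : Str, HaltsWith P (answer O) x (p.eval x.length) (f x)

/-- The string in which every bit is doubled and `01` is appended. -/
def star : Str → Str
  | [] => [false, true]
  | b :: x => b :: b :: star x

/-- The code of the pair `(x, y)`. -/
def pair (x y : Str) : Str := star x ++ y

/-- `R` is a binary relation decidable in polynomial time relative to `O`. -/
def PolyTimeRel (O : Oracle) (R : Str → Str → Prop) : Prop :=
  ∃ f : Str → Str, PolyTimeFun O f ∧ ∀ x y : Str, R x y ↔ f (pair x y) = [true]

/-- `L` is in `NP` relative to `O`. -/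
def InNP (O : Oracle) (L : Set Str) : Prop :=
  ∃ (p : Polynomial ℕ) (R : Str → Str → Prop), PolyTimeRel O R ∧
    ∀ x : Str, x ∈ L ↔ ∃ y : Str, y.length ≤ p.eval x.length ∧ R x y

/-- `L` is in `coNP` relative to `O`. -/
def InCoNP (O : Oracle) (L : Set Str) : Prop := InNP O Lᶜ

/-! ### Propositional formulas with oracle gates -/

/-- Propositional formulas with an additional connective `α` of every finite arity. -/
inductive Form : Type
  | tru
  | fls
  | var (i : ℕ)
  | neg (φ : Form)
  | and (φ ψ : Form)
  | or (φ ψ : Form)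
  | gate (φs : List Form)

mutual

/-- The truth value of a formula under the assignment `v`: the gate `α(φ₁, …, φₖ)` is true iff the
string of the values of `φ₁, …, φₖ` belongs to `O`. -/
noncomputable def Form.eval (O : Oracle) (v : ℕ → Bool) : Form → Bool
  | Form.tru => true
  | Form.fls => false
  | Form.var i => v i
  | Form.neg φ => !(Form.eval O v φ)
  | Form.and φ ψ => Form.eval O v φ && Form.eval O v ψ
  | Form.or φ ψ => Form.eval O v φ || Form.eval O v ψ
  | Form.gate φs => memBit O (Form.evalList O v φs)

/-- The string of the truth values of a list of formulas. -/
noncomputable def Form.evalList (O : Oracle) (v : ℕ → Bool) : List Form → Str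
  | [] => []
  | φ :: φs => Form.eval O v φ :: Form.evalList O v φs

end

mutual

/-- The binary code of a formula, in prefix notation with tags of three bits; the index of a
variable is written in binary. -/
def Form.code : Form → Str
  | Form.tru => [false, false, false]
  | Form.fls => [false, false, true]
  | Form.var i => [false, true, false] ++ star (Nat.bits i)
  | Form.neg φ => [false, true, true] ++ Form.code φ
  | Form.and φ ψ => [true, false, false] ++ (Form.code φ ++ Form.code ψ)
  | Form.or φ ψ => [true, false, true] ++ (Form.code φ ++ Form.code ψ)
  | Form.gate φs => [true, true, false] ++ Form.codeList φs

/-- The codes of the formulas of a list, one after the other, followed by an end mark. -/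
def Form.codeList : List Form → Str
  | [] => [true, true, true]
  | φ :: φs => Form.code φ ++ Form.codeList φs

end

/-- The codes of the tautologies relative to `O`. -/
def TAUT (O : Oracle) : Set Str :=
  {w | ∃ φ : Form, φ.code = w ∧ ∀ v : ℕ → Bool, φ.eval O v = true}

/-- The codes of the satisfiable formulas relative to `O`. -/
def SAT (O : Oracle) : Set Str :=
  {w | ∃ φ : Form, φ.code = w ∧ ∃ v : ℕ → Bool, φ.eval O v = true}

/-! ### Proof systems -/

/-- `P` is a proof system for `C` relative to `O`. -/
def IsProofSystem (O : Oracle) (C : Set Str) (P : Str → Str) : Prop :=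
  PolyTimeFun O P ∧ Set.range P = C

/-- `P` p-simulates `Q` relative to `O`. -/
def PSimulates (O : Oracle) (P Q : Str → Str) : Prop :=
  ∃ f : Str → Str, PolyTimeFun O f ∧ ∀ π : Str, P (f π) = Q π

/-- `P` non-uniformly p-simulates `Q`. -/
def NonuniformPSimulates (P Q : Str → Str) : Prop :=
  ∃ h : Polynomial ℕ, ∀ π : Str, ∃ π' : Str, π'.length ≤ h.eval π.length ∧ P π' = Q π

/-- Relative to `O` there is a p-optimal proof system for `C`. -/
def HasPOptimal (O : Oracle) (C : Set Str) : Prop :=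
  ∃ P : Str → Str, IsProofSystem O C P ∧
    ∀ Q : Str → Str, IsProofSystem O C Q → PSimulates O P Q

/-- Relative to `O` there is a non-uniform p-optimal proof system for `C`. -/
def HasNonuniformPOptimal (O : Oracle) (C : Set Str) : Prop :=
  ∃ P : Str → Str, IsProofSystem O C P ∧
    ∀ Q : Str → Str, IsProofSystem O C Q → NonuniformPSimulates P Q

/-! ### Total `NP` search problems -/

/-- A total `NP` search problem relative to `O`. -/
structure TFNPProblem (O : Oracle) : Type where
  bound : Polynomial ℕ
  rel : Str → Str → Prop
  polyTime : PolyTimeRel O rel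
  total : ∀ x : Str, ∃ y : Str, y.length ≤ bound.eval x.length ∧ rel x y

/-- `y` is a solution of the instance `x` of the search problem `S`. -/
def TFNPProblem.Sol {O : Oracle} (S : TFNPProblem O) (x y : Str) : Prop :=
  y.length ≤ S.bound.eval x.length ∧ S.rel x y

/-- `S` is polynomially reducible to `T` relative to `O`: a polynomial time machine with access to
`O` solves `S` when it may in addition ask for solutions of instances of `T`, whichever solutions
it is given. -/
def TFNPProblem.Reducible {O : Oracle} (S T : TFNPProblem O) : Prop :=
  ∃ (P : Prog) (p : Polynomial ℕ), ∀ g : Str → Str, (∀ w : Str, T.Sol w (g w)) →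
    ∀ x : Str, ∃ y : Str, S.Sol x y ∧ HaltsWith P (joinAnswer O g) x (p.eval x.length) y

/-- Relative to `O` there is a complete problem for `TFNP`. -/
def HasCompleteTFNP (O : Oracle) : Prop :=
  ∃ T : TFNPProblem O, ∀ S : TFNPProblem O, S.Reducible T

/-! ### Disjoint `coNP` pairs -/

/-- `(U, V)` is a disjoint `coNP` pair relative to `O`. -/
def IsDisjCoNPPair (O : Oracle) (U V : Set Str) : Prop :=
  InCoNP O U ∧ InCoNP O V ∧ U ∩ V = ∅

/-- `(U, V)` is polynomially reducible to `(U', V')` relative to `O`. -/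
def PairReducible (O : Oracle) (U V U' V' : Set Str) : Prop :=
  ∃ f : Str → Str, PolyTimeFun O f ∧ (∀ x ∈ U, f x ∈ U') ∧ (∀ x ∈ V, f x ∈ V')

/-- Relative to `O` there is a complete disjoint `coNP` pair. -/
def HasCompleteDisjCoNP (O : Oracle) : Prop :=
  ∃ U' V' : Set Str, IsDisjCoNPPair O U' V' ∧
    ∀ U V : Set Str, IsDisjCoNPPair O U V → PairReducible O U V U' V'

/-! ### The conjectures, as statements about an oracle -/

/-- The relativized versions of a statement, one for every oracle. -/
abbrev Conjecture := Oracle → Prop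

/-- There is no p-optimal proof system for `TAUT`. -/
def CON : Conjecture := fun O => ¬ HasPOptimal O (TAUT O)

/-- There is no non-uniform p-optimal proof system for `TAUT`. -/
def CONN : Conjecture := fun O => ¬ HasNonuniformPOptimal O (TAUT O)

/-- There is no p-optimal proof system for `SAT`. -/
def SATc : Conjecture := fun O => ¬ HasPOptimal O (SAT O)

/-- There is no complete problem for `TFNP`. -/
def TFNPc : Conjecture := fun O => ¬ HasCompleteTFNP O

/-- There is no complete disjoint `coNP` pair. -/
def DisjCoNPc : Conjecture := fun O => ¬ HasCompleteDisjCoNP O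

/-- `Q` implies `Q'` in all relativized worlds. -/
def ImpliesRel (Q Q' : Conjecture) : Prop := ∀ O : Oracle, Q O → Q' O

end RelWorlds

/-!
Both oracles are built over a set `G` of strings, their generic part. Since an oracle need not be
computable, it can hold the polynomial time functions that a world needs: for a function `f` whose
values have polynomially bounded length and are decided by oracle answers of polynomial total length
(a `Task`), the bits of `f x` are put into the oracle, as answers to questions longer than everything
they depend on (`Scheme.build`). A single program, `writer`, which
is told by its tag what to ask for, then computes all these functions. The
questions that a machine asks in `n` steps have total length at most `n`, and so, by recursion, the
membership of a string `w` in the oracle is decided by at most `w.length` bits of `G`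
(`Scheme.local_of_special`). An oracle also holds some special predicates, for which this is shown
separately.

The set `G` is found by finite conditions, which fix `G` up to some length and promise something
about finitely many families of strings `unary k y` (`exists_generic`). An open property of the
oracle is forced if some set that satisfies the condition has it, and otherwise it fails for all such
sets. With every property goes a fresh family `k`. If the property says, for instance, that a search
problem is not total, then the family `k` yields the object that refutes its completeness.

In the first world (`exists_easy_world`) total search problems are solved in polynomial time. The
elements of `G` have exponentially distant lengths, so a computation meets at most one element that
cannot be found by listing all short strings. Take a solution relative to the short elements alone;
either the evidence for it remains right, or it reveals the unknown element. Easy search gives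
complete problems, complete pairs and a p-optimal proof system for `SAT`. Given a proof system for
`TAUT`, the family `k` is promised to be empty, and a new proof system has short proofs of this. Short
proofs of it in the given system would remain proofs after an unnoticed element has been added to the
family, against the soundness of the given system.

In the second world (`exists_hard_world`) the special predicate tells whether a machine puts out a
string that is not a tautology on some input within a given budget. The simulation of all machines that
pass this test is a p-optimal proof system for `TAUT`. This predicate is existential and has only
polynomially many instances up to a given length. They are fixed by polynomially many bits of `G`
when as many of them as possible are made true, length by length (`exists_special_fixed`). So one of
the exponentially many rows of a family can be emptied and filled again without touching them
(`exists_row_switch`). The family `k` is promised to have no empty row, so that finding an element of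
the row of `x` is a total search problem. A reduction to a problem that was total even without this
promise can be run while the row is empty. Its result then remains the same when the row is filled
with strings that make it wrong. The same rows serve against proof systems for `SAT` and against
pairs.
-/

namespace RelWorlds

/-! ### A program that writes a string dictated by the oracle -/

/-- `c'` is reached from `c` in at most `n` steps. -/
def Reach (P : Prog) (g : Str → Str) (n : ℕ) (c c' : Config) : Prop :=
  ∃ k ≤ n, (step P g)^[k] c = c'

theorem Reach.refl (P : Prog) (g : Str → Str) (n : ℕ) (c : Config) : Reach P g n c c :=
  ⟨0, Nat.zero_le _, rfl⟩

theorem Reach.trans {P : Prog} {g : Str → Str} {n m : ℕ} {c c' c'' : Config}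
    (h : Reach P g n c c') (h' : Reach P g m c' c'') : Reach P g (n + m) c c'' := by
  obtain ⟨k, hk, rfl⟩ := h
  obtain ⟨l, hl, rfl⟩ := h'
  exact ⟨l + k, by omega, by rw [Function.iterate_add_apply]⟩

theorem Reach.mono {P : Prog} {g : Str → Str} {n m : ℕ} {c c' : Config}
    (h : Reach P g n c c') (hnm : n ≤ m) : Reach P g m c c' := by
  obtain ⟨k, hk, h⟩ := h
  exact ⟨k, hk.trans hnm, h⟩

theorem Reach.head {P : Prog} {g : Str → Str} {n : ℕ} {c c' c'' : Config}
    (h : step P g c = c') (h' : Reach P g n c' c'') : Reach P g (n + 1) c c'' := by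
  obtain ⟨k, hk, h'⟩ := h'
  exact ⟨k + 1, by omega, by rw [Function.iterate_succ_apply, h, h']⟩

theorem step_of_halted {P : Prog} {g : Str → Str} {c : Config} (h : P.length ≤ c.pc) :
    step P g c = c := by
  simp [step, List.getElem?_eq_none h]

theorem iterate_step_of_halted {P : Prog} {g : Str → Str} {c : Config} (h : P.length ≤ c.pc)
    (n : ℕ) : (step P g)^[n] c = c :=
  Function.iterate_fixed (step_of_halted h) n

theorem Reach.haltsWith {P : Prog} {g : Str → Str} {n : ℕ} {x y : Str} {c : Config}
    (h : Reach P g n (initConfig x) c) (hc : P.length ≤ c.pc) (hy : c.stk 0 = y) :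
    HaltsWith P g x n y := by
  obtain ⟨k, hk, rfl⟩ := h
  obtain ⟨l, rfl⟩ := Nat.exists_eq_add_of_le' hk
  unfold HaltsWith
  rw [Function.iterate_add_apply, iterate_step_of_halted hc]
  exact ⟨hc, hy⟩

theorem HaltsWith.mono {P : Prog} {g : Str → Str} {n m : ℕ} {x y : Str}
    (h : HaltsWith P g x n y) (hnm : n ≤ m) : HaltsWith P g x m y :=
  Reach.haltsWith ⟨n, hnm, rfl⟩ h.1 h.2

/-- The configuration with the given contents of the stacks `0` (output), `1` (query), `2` (answer),
`3` and `4`; all other stacks are empty. -/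
def cfg (pc : ℕ) (o q a s t : Str) : Config where
  pc := pc
  stk := fun i => match i with
    | 0 => o
    | 1 => q
    | 2 => a
    | 3 => s
    | 4 => t
    | _ => []

theorem initConfig_eq (x : Str) : initConfig x = cfg 0 x [] [] [] [] := by
  simp only [initConfig, cfg, Config.mk.injEq, true_and]
  funext i
  rcases i with _ | _ | _ | _ | _ | i <;> simp [Function.update]

section Steps

variable {P : Prog} {g : Str → Str} {pc : ℕ} {o q a s t : Str}

theorem step_push0 {b : Bool} (h : P[pc]? = some (Instr.push 0 b)) :
    step P g (cfg pc o q a s t) = cfg (pc + 1) (b :: o) q a s t := by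
  simp only [step, cfg, h, Config.mk.injEq, true_and]
  funext i
  rcases i with _ | _ | _ | _ | _ | i <;> simp [Function.update]

theorem step_push1 {b : Bool} (h : P[pc]? = some (Instr.push 1 b)) :
    step P g (cfg pc o q a s t) = cfg (pc + 1) o (b :: q) a s t := by
  simp only [step, cfg, h, Config.mk.injEq, true_and]
  funext i
  rcases i with _ | _ | _ | _ | _ | i <;> simp [Function.update]

theorem step_push3 {b : Bool} (h : P[pc]? = some (Instr.push 3 b)) :
    step P g (cfg pc o q a s t) = cfg (pc + 1) o q a (b :: s) t := by
  simp only [step, cfg, h, Config.mk.injEq, true_and]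
  funext i
  rcases i with _ | _ | _ | _ | _ | i <;> simp [Function.update]

theorem step_push4 {b : Bool} (h : P[pc]? = some (Instr.push 4 b)) :
    step P g (cfg pc o q a s t) = cfg (pc + 1) o q a s (b :: t) := by
  simp only [step, cfg, h, Config.mk.injEq, true_and]
  funext i
  rcases i with _ | _ | _ | _ | _ | i <;> simp [Function.update]

/-- An unconditional jump. -/
def jmp (l : ℕ) : Instr := Instr.pop 5 l l l

theorem step_jmp {l : ℕ} (h : P[pc]? = some (jmp l)) :
    step P g (cfg pc o q a s t) = cfg l o q a s t := by
  simp [step, cfg, h, jmp]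

theorem step_pop0_nil {e f u : ℕ} (h : P[pc]? = some (Instr.pop 0 e f u)) :
    step P g (cfg pc [] q a s t) = cfg e [] q a s t := by
  simp [step, cfg, h]

theorem step_pop0_cons {e f u : ℕ} {b : Bool} (h : P[pc]? = some (Instr.pop 0 e f u)) :
    step P g (cfg pc (b :: o) q a s t) = cfg (if b then u else f) o q a s t := by
  simp only [step, cfg, h, Config.mk.injEq, true_and]
  funext i
  rcases i with _ | _ | _ | _ | _ | i <;> simp [Function.update]

theorem step_pop2_cons {e f u : ℕ} {b : Bool} (h : P[pc]? = some (Instr.pop 2 e f u)) :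
    step P g (cfg pc o q (b :: a) s t) = cfg (if b then u else f) o q a s t := by
  simp only [step, cfg, h, Config.mk.injEq, true_and]
  funext i
  rcases i with _ | _ | _ | _ | _ | i <;> simp [Function.update]

theorem step_pop3_nil {e f u : ℕ} (h : P[pc]? = some (Instr.pop 3 e f u)) :
    step P g (cfg pc o q a [] t) = cfg e o q a [] t := by
  simp [step, cfg, h]

theorem step_pop3_cons {e f u : ℕ} {b : Bool} (h : P[pc]? = some (Instr.pop 3 e f u)) :
    step P g (cfg pc o q a (b :: s) t) = cfg (if b then u else f) o q a s t := by
  simp only [step, cfg, h, Config.mk.injEq, true_and]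
  funext i
  rcases i with _ | _ | _ | _ | _ | i <;> simp [Function.update]

theorem step_pop4_nil {e f u : ℕ} (h : P[pc]? = some (Instr.pop 4 e f u)) :
    step P g (cfg pc o q a s []) = cfg e o q a s [] := by
  simp [step, cfg, h]

theorem step_pop4_cons {e f u : ℕ} {b : Bool} (h : P[pc]? = some (Instr.pop 4 e f u)) :
    step P g (cfg pc o q a s (b :: t)) = cfg (if b then u else f) o q a s t := by
  simp only [step, cfg, h, Config.mk.injEq, true_and]
  funext i
  rcases i with _ | _ | _ | _ | _ | i <;> simp [Function.update]

theorem step_query (h : P[pc]? = some Instr.query) :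
    step P g (cfg pc o q a s t) = cfg (pc + 1) o [] (g q) s t := by
  simp only [step, cfg, h, Config.mk.injEq, true_and]
  funext i
  rcases i with _ | _ | _ | _ | _ | i <;> simp [Function.update]

end Steps

/-- Asks the oracle the string `true :: s`, or `false :: true :: s` if `join` holds, where `s` is
the content of stack `3`, and then pushes `true` on stack `3`. Stack `3` is moved to stack `4` and
then copied back to the stacks `3` and `1`. The block starts at address `β`. -/
def askBlock (join : Bool) (β : ℕ) : List Instr :=
  [Instr.pop 3 (β + 5) (β + 1) (β + 3), Instr.push 4 false, jmp β, Instr.push 4 true, jmp β,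
    Instr.pop 4 (β + 12) (β + 6) (β + 9), Instr.push 3 false, Instr.push 1 false, jmp (β + 5),
    Instr.push 3 true, Instr.push 1 true, jmp (β + 5),
    Instr.push 1 true, if join then Instr.push 1 false else jmp (β + 14), Instr.query,
    Instr.push 3 true]

/-- The first bit of a query to a joined oracle that addresses the set. -/
def askPrefix (join : Bool) : Str := if join then [false] else []

theorem ask_unstack {P : Prog} {g : Str → Str} {join : Bool} {β : ℕ}
    (h : ∀ j < 16, P[β + j]? = (askBlock join β)[j]?) (o q a s t : Str) :
    Reach P g (3 * s.length + 1) (cfg β o q a s t) (cfg (β + 5) o q a [] (s.reverse ++ t)) := by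
  have h0 := h 0 (by norm_num)
  induction s generalizing t with
  | nil => exact (Reach.refl P g 0 _).head (step_pop3_nil h0)
  | cons b s ih =>
    have := ih (b :: t)
    simp only [List.length_cons, List.reverse_cons, List.append_assoc, List.singleton_append,
      mul_add] at this ⊢
    refine Reach.mono (Reach.head (step_pop3_cons h0) ?_) le_rfl
    cases b
    · exact (this.head (step_jmp (h 2 (by norm_num)))).head (step_push4 (h 1 (by norm_num)))
    · exact (this.head (step_jmp (h 4 (by norm_num)))).head (step_push4 (h 3 (by norm_num)))

theorem ask_restack {P : Prog} {g : Str → Str} {join : Bool} {β : ℕ}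
    (h : ∀ j < 16, P[β + j]? = (askBlock join β)[j]?) (o q a s t : Str) :
    Reach P g (4 * t.length + 1) (cfg (β + 5) o q a s t)
      (cfg (β + 12) o (t.reverse ++ q) a (t.reverse ++ s) []) := by
  have h0 := h 5 (by norm_num)
  induction t generalizing q s with
  | nil => exact (Reach.refl P g 0 _).head (step_pop4_nil h0)
  | cons b t ih =>
    have := ih (b :: q) (b :: s)
    simp only [List.length_cons, List.reverse_cons, List.append_assoc, List.singleton_append,
      mul_add] at this ⊢
    refine Reach.mono (Reach.head (step_pop4_cons h0) ?_) le_rfl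
    cases b
    · exact ((this.head (step_jmp (h 8 (by norm_num)))).head
        (step_push1 (h 7 (by norm_num)))).head (step_push3 (h 6 (by norm_num)))
    · exact ((this.head (step_jmp (h 11 (by norm_num)))).head
        (step_push1 (h 10 (by norm_num)))).head (step_push3 (h 9 (by norm_num)))

theorem ask_reach {P : Prog} {g : Str → Str} {join : Bool} {β : ℕ}
    (h : ∀ j < 16, P[β + j]? = (askBlock join β)[j]?) (o a s : Str) :
    Reach P g (7 * s.length + 6) (cfg β o [] a s [])
      (cfg (β + 16) o [] (g (askPrefix join ++ true :: s)) (true :: s) []) := by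
  have h1 := ask_unstack (g := g) h o [] a s []
  have h2 := ask_restack (g := g) h o [] a [] s.reverse
  simp only [List.append_nil, List.reverse_reverse, List.length_reverse] at h1 h2
  refine ((h1.trans h2).trans (m := 4) ?_).mono (by omega)
  refine Reach.head (step_push1 (h 12 (by norm_num))) ?_
  have h13 : step P g (cfg (β + 12 + 1) o (true :: s) a s []) =
      cfg (β + 14) o (askPrefix join ++ true :: s) a s [] := by
    cases join
    · exact step_jmp (h 13 (by norm_num))
    · exact step_push1 (h 13 (by norm_num))
  refine Reach.head h13 (Reach.head (step_query (h 14 (by norm_num)))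
    (Reach.head (step_push3 (h 15 (by norm_num))) (Reach.refl _ _ _ _)))

/-- The answers that dictate the string `y` after `N` idle rounds. Round `r` consists of the
questions `2 r` and `2 r + 1`; the answers are `0 0` in an idle round, `1 b` if the bit `b` is to
be written, and `0 1` at the end. The string is written from its last bit to its first. -/
def dictate (y : Str) (N l : ℕ) : Bool :=
  if l / 2 < N then false
  else if l % 2 = 0 then decide (l / 2 - N < y.length)
  else (y.reverse[l / 2 - N]?).getD true

/-- The program that writes the string dictated by the oracle. Its input is moved to stack `3`, on
top of it come `tag`, a separating bit `false` and a counter in unary. -/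
def writer (join : Bool) (tag : Str) : Prog :=
  ([Instr.pop 0 5 1 3, Instr.push 4 false, jmp 0, Instr.push 4 true, jmp 0,
    Instr.pop 4 10 6 8, Instr.push 3 false, jmp 5, Instr.push 3 true, jmp 5,
    jmp 67, Instr.push 3 false] ++
    (askBlock join 12 ++ Instr.pop 2 29 29 46 :: (askBlock join 29 ++
      Instr.pop 2 12 12 (68 + tag.length) :: (askBlock join 46 ++
        [Instr.pop 2 63 63 65, Instr.push 0 false, jmp 12, Instr.push 0 true, jmp 12])))) ++
    (tag.reverse.map (Instr.push 3) ++ [jmp 11])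

section Writer

variable {g : Str → Str} {join : Bool} {tag : Str}

theorem length_writer : (writer join tag).length = 68 + tag.length := by
  simp [writer, askBlock]; omega

theorem writer_ask12 : ∀ j < 16, (writer join tag)[12 + j]? = (askBlock join 12)[j]? := by
  intro j hj
  interval_cases j <;> rfl

theorem writer_ask29 : ∀ j < 16, (writer join tag)[29 + j]? = (askBlock join 29)[j]? := by
  intro j hj
  interval_cases j <;> rfl

theorem writer_ask46 : ∀ j < 16, (writer join tag)[46 + j]? = (askBlock join 46)[j]? := by
  intro j hj
  interval_cases j <;> rfl

theorem writer_tag {j : ℕ} (hj : j < tag.length) :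
    (writer join tag)[67 + j]? = some (Instr.push 3 (tag.reverse[j]'(by simpa using hj))) := by
  unfold writer
  rw [List.getElem?_append_right (by simp [askBlock]),
    List.getElem?_append_left (by simp [askBlock]; omega)]
  simp [askBlock, hj]

theorem writer_last : (writer join tag)[67 + tag.length]? = some (jmp 11) := by
  unfold writer
  rw [List.getElem?_append_right (by simp [askBlock]),
    List.getElem?_append_right (by simp [askBlock])]
  simp [askBlock]

theorem writer_unload (o s t : Str) :
    Reach (writer join tag) g (3 * o.length + 1) (cfg 0 o [] [] s t)
      (cfg 5 [] [] [] s (o.reverse ++ t)) := by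
  induction o generalizing t with
  | nil => exact (Reach.refl _ g 0 _).head (step_pop0_nil rfl)
  | cons b o ih =>
    have := ih (b :: t)
    simp only [List.length_cons, List.reverse_cons, List.append_assoc, List.singleton_append,
      mul_add] at this ⊢
    refine Reach.mono (Reach.head (step_pop0_cons rfl) ?_) le_rfl
    cases b
    · exact (this.head (step_jmp rfl)).head (step_push4 rfl)
    · exact (this.head (step_jmp rfl)).head (step_push4 rfl)

theorem writer_load (o s t : Str) :
    Reach (writer join tag) g (3 * t.length + 1) (cfg 5 o [] [] s t)
      (cfg 10 o [] [] (t.reverse ++ s) []) := by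
  induction t generalizing s with
  | nil => exact (Reach.refl _ g 0 _).head (step_pop4_nil rfl)
  | cons b t ih =>
    have := ih (b :: s)
    simp only [List.length_cons, List.reverse_cons, List.append_assoc, List.singleton_append,
      mul_add] at this ⊢
    refine Reach.mono (Reach.head (step_pop4_cons rfl) ?_) le_rfl
    cases b
    · exact (this.head (step_jmp rfl)).head (step_push3 rfl)
    · exact (this.head (step_jmp rfl)).head (step_push3 rfl)

theorem writer_pushTag (s : Str) {j : ℕ} (hj : j ≤ tag.length) :
    Reach (writer join tag) g j (cfg 67 [] [] [] s [])
      (cfg (67 + j) [] [] [] ((tag.reverse.take j).reverse ++ s) []) := by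
  induction j with
  | zero => exact Reach.refl _ _ _ _
  | succ j ih =>
    refine (ih (by omega)).trans ((Reach.refl _ g 0 _).head ?_)
    rw [step_push3 (writer_tag (by omega))]
    congr 1
    rw [List.take_succ_eq_append_getElem (by simpa using hj)]
    simp

/-- The content of stack `3` when the counter is `l`. -/
def writerStack (tag x : Str) (l : ℕ) : Str :=
  List.replicate l true ++ false :: (tag ++ x)

theorem length_writerStack (tag x : Str) (l : ℕ) :
    (writerStack tag x l).length = l + 1 + tag.length + x.length := by
  simp [writerStack]; omega

theorem writer_prelude (x : Str) :
    Reach (writer join tag) g (6 * x.length + tag.length + 5) (initConfig x)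
      (cfg 12 [] [] [] (writerStack tag x 0) []) := by
  rw [initConfig_eq]
  have h1 := writer_unload (g := g) (join := join) (tag := tag) x [] []
  have h2 := writer_load (g := g) (join := join) (tag := tag) [] [] x.reverse
  have h3 := writer_pushTag (g := g) (join := join) (tag := tag) x le_rfl
  simp only [List.append_nil, List.reverse_reverse, List.length_reverse] at h1 h2
  rw [← List.length_reverse, List.take_length, List.reverse_reverse, List.length_reverse] at h3
  refine ((h1.trans h2).trans (((h3.trans (m := 2) ?_).head (step_jmp rfl)))).mono
    (m := 6 * x.length + tag.length + 5) (by omega)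
  exact ((Reach.refl _ g 0 _).head (step_push3 rfl)).head (step_jmp writer_last)

theorem writer_ask (x o : Str) {β l : ℕ} {b : Bool}
    (hβ : ∀ j < 16, (writer join tag)[β + j]? = (askBlock join β)[j]?)
    (hg : g (askPrefix join ++ true :: writerStack tag x l) = [b]) :
    Reach (writer join tag) g (7 * (l + 1 + tag.length + x.length) + 6)
      (cfg β o [] [] (writerStack tag x l) [])
      (cfg (β + 16) o [] [b] (writerStack tag x (l + 1)) []) := by
  have := ask_reach (g := g) hβ o [] (writerStack tag x l)
  rw [hg, length_writerStack] at this
  exact this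

/-- One round in which nothing is written. -/
theorem writer_idle (x o : Str) {l : ℕ}
    (h1 : g (askPrefix join ++ true :: writerStack tag x l) = [false])
    (h2 : g (askPrefix join ++ true :: writerStack tag x (l + 1)) = [false]) :
    Reach (writer join tag) g (14 * (l + 2 + tag.length + x.length) + 18)
      (cfg 12 o [] [] (writerStack tag x l) [])
      (cfg 12 o [] [] (writerStack tag x (l + 2)) []) := by
  refine ((writer_ask x o writer_ask12 h1).trans (Reach.head (step_pop2_cons rfl)
    ((writer_ask x o writer_ask29 h2).trans (Reach.head (step_pop2_cons rfl)
      (Reach.refl _ _ 0 _))))).mono (by omega)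

/-- The last round. -/
theorem writer_stop (x o : Str) {l : ℕ}
    (h1 : g (askPrefix join ++ true :: writerStack tag x l) = [false])
    (h2 : g (askPrefix join ++ true :: writerStack tag x (l + 1)) = [true]) :
    Reach (writer join tag) g (14 * (l + 2 + tag.length + x.length) + 18)
      (cfg 12 o [] [] (writerStack tag x l) [])
      (cfg (68 + tag.length) o [] [] (writerStack tag x (l + 2)) []) := by
  refine ((writer_ask x o writer_ask12 h1).trans (Reach.head (step_pop2_cons rfl)
    ((writer_ask x o writer_ask29 h2).trans (Reach.head (step_pop2_cons rfl)
      (Reach.refl _ _ 0 _))))).mono (by omega)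

/-- A round in which the bit `b` is written. -/
theorem writer_emit (x o : Str) {l : ℕ} {b : Bool}
    (h1 : g (askPrefix join ++ true :: writerStack tag x l) = [true])
    (h2 : g (askPrefix join ++ true :: writerStack tag x (l + 1)) = [b]) :
    Reach (writer join tag) g (14 * (l + 2 + tag.length + x.length) + 18)
      (cfg 12 o [] [] (writerStack tag x l) [])
      (cfg 12 (b :: o) [] [] (writerStack tag x (l + 2)) []) := by
  refine ((writer_ask x o writer_ask12 h1).trans (Reach.head (step_pop2_cons rfl)
    ((writer_ask x o writer_ask46 h2).trans (Reach.head (n := 2) (step_pop2_cons rfl) ?_)))).mono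
      (by omega)
  cases b
  · exact ((Reach.refl _ g 0 _).head (step_jmp rfl)).head (step_push0 rfl)
  · exact ((Reach.refl _ g 0 _).head (step_jmp rfl)).head (step_push0 rfl)

/-- A bound for the running time of `writer`: `m` bounds the number of rounds. -/
def writerTime (m tagLen n : ℕ) : ℕ := (m + 1) * (14 * (2 * m + 2 + tagLen + n) + 18) +
  (6 * n + tagLen + 5)

theorem writer_haltsWith {x y : Str} {N : ℕ}
    (hg : ∀ l, g (askPrefix join ++ true :: writerStack tag x l) = [dictate y N l]) :
    HaltsWith (writer join tag) g x (writerTime (N + y.length) tag.length x.length) y := by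
  set T := 14 * (2 * (N + y.length) + 2 + tag.length + x.length) + 18 with hT
  have idle : ∀ r ≤ N, Reach (writer join tag) g (r * T)
      (cfg 12 [] [] [] (writerStack tag x 0) []) (cfg 12 [] [] [] (writerStack tag x (2 * r)) []) := by
    intro r hr
    induction r with
    | zero => exact Reach.refl _ _ _ _
    | succ r ih =>
      rw [add_mul]
      refine (ih (by omega)).trans ((writer_idle x [] ?_ ?_).mono (by omega))
      · rw [hg]; simp only [dictate]; rw [if_pos (by omega)]
      · rw [hg]; simp only [dictate]; rw [if_pos (by omega)]
  have emit : ∀ r ≤ y.length, Reach (writer join tag) g (r * T)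
      (cfg 12 [] [] [] (writerStack tag x (2 * N)) [])
      (cfg 12 (y.reverse.take r).reverse [] [] (writerStack tag x (2 * (N + r))) []) := by
    intro r hr
    induction r with
    | zero => exact Reach.refl _ _ _ _
    | succ r ih =>
      rw [add_mul, List.take_succ_eq_append_getElem (by simpa using hr)]
      simp only [List.reverse_append, List.reverse_singleton, List.singleton_append]
      refine (ih (by omega)).trans ((writer_emit x _ ?_ ?_).mono (by omega))
      · rw [hg]
        simp only [dictate]
        rw [if_neg (by omega), if_pos (by omega)]
        simp; omega
      · rw [hg]
        simp only [dictate]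
        rw [if_neg (by omega), if_neg (by omega),
          show (2 * (N + r) + 1) / 2 - N = r by omega,
          List.getElem?_eq_getElem (by simpa using hr)]
        rfl
  have halt := writer_stop (g := g) (join := join) (tag := tag) x y (l := 2 * (N + y.length))
    (by
      rw [hg]; simp only [dictate]
      rw [if_neg (by omega), if_pos (by omega)]
      simp)
    (by
      rw [hg]; simp only [dictate]
      rw [if_neg (by omega), if_neg (by omega), List.getElem?_eq_none (by simp; omega)]
      rfl)
  have he := emit y.length le_rfl
  rw [← List.length_reverse, List.take_length, List.reverse_reverse, List.length_reverse] at he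
  refine Reach.haltsWith (((writer_prelude x).trans ((idle N le_rfl).trans
    (he.trans halt))).mono ?_) (by rw [length_writer]; rfl) rfl
  unfold writerTime
  rw [← hT]
  nlinarith

end Writer

theorem eval_mono_nat (p : Polynomial ℕ) {a b : ℕ} (h : a ≤ b) : p.eval a ≤ p.eval b := by
  rw [Polynomial.eval_eq_sum, Polynomial.eval_eq_sum]
  exact Finset.sum_le_sum fun i _ => Nat.mul_le_mul_left _ (Nat.pow_le_pow_left h i)

/-- A polynomial bound for `writerTime`, when the number of rounds is bounded by `r`. -/
noncomputable def writerPoly (r : Polynomial ℕ) (tagLen : ℕ) : Polynomial ℕ :=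
  (r + 1) * (14 * (2 * r + 2 + (tagLen : Polynomial ℕ) + Polynomial.X) + 18) +
    (6 * Polynomial.X + (tagLen : Polynomial ℕ) + 5)

theorem eval_writerPoly (r : Polynomial ℕ) (tagLen n : ℕ) :
    (writerPoly r tagLen).eval n = writerTime (r.eval n) tagLen n := by
  simp [writerPoly, writerTime]

theorem writerTime_mono {m m' : ℕ} (h : m ≤ m') (tagLen n : ℕ) :
    writerTime m tagLen n ≤ writerTime m' tagLen n := by
  unfold writerTime
  gcongr

/-- A polynomially bounded function whose bits are dictated by `g` is computed by `writer` in
polynomial time. -/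
theorem writer_computes {join : Bool} {tag : Str} {g f : Str → Str} {N len : Polynomial ℕ}
    (hlen : ∀ x, (f x).length ≤ len.eval x.length)
    (hg : ∀ x l, g (askPrefix join ++ true :: writerStack tag x l) =
      [dictate (f x) (N.eval x.length) l]) (x : Str) :
    HaltsWith (writer join tag) g x ((writerPoly (N + len) tag.length).eval x.length) (f x) := by
  refine (writer_haltsWith (hg x)).mono ?_
  rw [eval_writerPoly, Polynomial.eval_add]
  exact writerTime_mono (Nat.add_le_add_left (hlen x) _) _ _

/-! ### Values decided by few oracle answers -/

/-- The value of `F` at `O` is decided by the membership in `O` of strings of total length at most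
`n`. -/
def DecidedBy {α : Type*} (F : Oracle → α) (O : Oracle) (n : ℕ) : Prop :=
  ∃ D : List Str, (D.map List.length).sum ≤ n ∧
    ∀ O' : Oracle, (∀ w ∈ D, w ∈ O' ↔ w ∈ O) → F O' = F O

namespace DecidedBy

variable {α β : Type*} {O : Oracle} {n m : ℕ}

theorem mono {F : Oracle → α} (h : DecidedBy F O n) (hnm : n ≤ m) : DecidedBy F O m := by
  obtain ⟨D, hD, h⟩ := h
  exact ⟨D, hD.trans hnm, h⟩

theorem const (a : α) : DecidedBy (fun _ => a) O n := ⟨[], by simp, fun _ _ => rfl⟩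

theorem memBit (w : Str) : DecidedBy (fun O => memBit O w) O w.length :=
  ⟨[w], by simp, fun O' h => by simp [RelWorlds.memBit, h w (by simp)]⟩

/-- The value of `F` may be used to choose what is computed next. -/
theorem bind {F : Oracle → α} {K : α → Oracle → β} (h : DecidedBy F O n)
    (h' : DecidedBy (K (F O)) O m) : DecidedBy (fun O => K (F O) O) O (n + m) := by
  obtain ⟨D, hD, h⟩ := h
  obtain ⟨D', hD', h'⟩ := h'
  refine ⟨D ++ D', by simp; omega, fun O' hO => ?_⟩
  have h1 := h O' fun w hw => hO w (by simp [hw])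
  have h2 := h' O' fun w hw => hO w (by simp [hw])
  simp only [h1, h2]

theorem map {F : Oracle → α} (h : DecidedBy F O n) (k : α → β) :
    DecidedBy (fun O => k (F O)) O n :=
  (h.bind (K := fun a _ => k a) (m := 0) (const _)).mono (by omega)

/-- Strings longer than the bound do not matter. -/
theorem eq_of_agree {F : Oracle → α} (h : DecidedBy F O n) {O' : Oracle}
    (hO : ∀ w : Str, w.length ≤ n → (w ∈ O' ↔ w ∈ O)) : F O' = F O := by
  obtain ⟨D, hD, h⟩ := h
  refine h O' fun w hw => hO w (le_trans ?_ hD)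
  exact List.single_le_sum (by simp) _ (List.mem_map_of_mem hw)

end DecidedBy

/-! ### Locality of computations -/

/-- The string asked in the next step, if there is one. -/
def asked (P : Prog) (c : Config) : List Str :=
  match P[c.pc]? with
  | some Instr.query => [c.stk 1]
  | _ => []

/-- The strings asked in the next `n` steps. -/
def queriesFrom (P : Prog) (g : Str → Str) : ℕ → Config → List Str
  | 0, _ => []
  | n + 1, c => asked P c ++ queriesFrom P g n (step P g c)

theorem step_congr {P : Prog} {g g' : Str → Str} {c : Config}
    (h : ∀ w ∈ asked P c, g' w = g w) : step P g' c = step P g c := by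
  unfold step
  unfold asked at h
  cases hc : P[c.pc]? with
  | none => rfl
  | some i =>
    cases i with
    | query => simp only [hc, List.mem_singleton, forall_eq] at h ⊢; rw [h]
    | push => rfl
    | pop => rfl

theorem iterate_step_congr {P : Prog} {g g' : Str → Str} {n : ℕ} {c : Config}
    (h : ∀ w ∈ queriesFrom P g n c, g' w = g w) :
    (step P g')^[n] c = (step P g)^[n] c := by
  induction n generalizing c with
  | zero => rfl
  | succ n ih =>
    simp only [queriesFrom, List.mem_append] at h
    rw [Function.iterate_succ_apply, Function.iterate_succ_apply,
      step_congr fun w hw => h w (Or.inl hw)]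
    exact ih fun w hw => h w (Or.inr hw)

theorem asked_length (P : Prog) (g : Str → Str) (c : Config) :
    ((asked P c).map List.length).sum + ((step P g c).stk 1).length ≤ (c.stk 1).length + 1 := by
  unfold asked step
  cases hc : P[c.pc]? with
  | none => simp
  | some i =>
    cases i with
    | query => simp
    | push s b =>
      by_cases hs : s = 1
      · subst hs; simp
      · simp [Function.update_of_ne (Ne.symm hs)]
    | pop s e f t =>
      by_cases hs : s = 1
      · subst hs
        cases h1 : c.stk 1 with
        | nil => simp [h1]
        | cons b r => simp [h1]; omega
      · cases h1 : c.stk s with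
        | nil => simp [h1]
        | cons b r => simp [h1, Function.update_of_ne (Ne.symm hs)]

theorem queriesFrom_length (P : Prog) (g : Str → Str) (n : ℕ) (c : Config) :
    ((queriesFrom P g n c).map List.length).sum ≤ (c.stk 1).length + n := by
  induction n generalizing c with
  | zero => simp [queriesFrom]
  | succ n ih =>
    have := asked_length P g c
    have := ih (step P g c)
    simp only [queriesFrom, List.map_append, List.sum_append]
    omega

/-- The strings asked in the first `n` steps on input `x`. -/
def queries (P : Prog) (g : Str → Str) (x : Str) (n : ℕ) : List Str :=
  queriesFrom P g n (initConfig x)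

theorem queries_length (P : Prog) (g : Str → Str) (x : Str) (n : ℕ) :
    ((queries P g x n).map List.length).sum ≤ n := by
  simpa [initConfig, queries] using queriesFrom_length P g n (initConfig x)

theorem length_le_of_mem_queries {P : Prog} {g : Str → Str} {x w : Str} {n : ℕ}
    (h : w ∈ queries P g x n) : w.length ≤ n :=
  (List.single_le_sum (by simp) _ (List.mem_map_of_mem h)).trans (queries_length P g x n)

/-- The content of the output stack after `n` steps on input `x`. -/
def runOut (P : Prog) (g : Str → Str) (x : Str) (n : ℕ) : Str :=
  ((step P g)^[n] (initConfig x)).stk 0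

theorem HaltsWith.runOut_eq {P : Prog} {g : Str → Str} {x y : Str} {n : ℕ}
    (h : HaltsWith P g x n y) : runOut P g x n = y := h.2

theorem runOut_congr {P : Prog} {g g' : Str → Str} {x : Str} {n : ℕ}
    (h : ∀ w ∈ queries P g x n, g' w = g w) : runOut P g' x n = runOut P g x n := by
  unfold runOut
  rw [iterate_step_congr h]

theorem length_step_stk (P : Prog) (g : Str → Str) (c : Config) :
    ((step P g c).stk 0).length ≤ (c.stk 0).length + 1 := by
  unfold step
  cases hc : P[c.pc]? with
  | none => simp
  | some i =>
    cases i with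
    | query => simp [Function.update]
    | push s b =>
      by_cases hs : s = 0
      · subst hs; simp
      · simp [Function.update_of_ne (Ne.symm hs)]
    | pop s e f t =>
      by_cases hs : s = 0
      · subst hs
        cases h1 : c.stk 0 with
        | nil => simp [h1]
        | cons b r => simp [h1]; omega
      · cases h1 : c.stk s with
        | nil => simp [h1]
        | cons b r => simp [h1, Function.update_of_ne (Ne.symm hs)]

theorem length_runOut (P : Prog) (g : Str → Str) (x : Str) (n : ℕ) :
    (runOut P g x n).length ≤ x.length + n := by
  unfold runOut
  suffices h : ∀ c : Config, (((step P g)^[n] c).stk 0).length ≤ (c.stk 0).length + n by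
    simpa [initConfig] using h (initConfig x)
  induction n with
  | zero => simp
  | succ n ih =>
    intro c
    have h1 := ih (step P g c)
    have h2 := length_step_stk P g c
    rw [Function.iterate_succ_apply]
    omega

theorem answer_congr {O O' : Oracle} {w : Str} (h : w ∈ O' ↔ w ∈ O) :
    answer O' w = answer O w := by
  simp [answer, memBit, h]

theorem decidedBy_runOut (P : Prog) (x : Str) (n : ℕ) (O : Oracle) :
    DecidedBy (fun O => runOut P (answer O) x n) O n :=
  ⟨queries P (answer O) x n, queries_length _ _ _ _, fun _ h =>
    runOut_congr fun w hw => answer_congr (h w hw)⟩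

/-! ### Codes of pairs and formulas -/

theorem star_append_inj {x y a b : Str} (h : star x ++ a = star y ++ b) : x = y ∧ a = b := by
  induction x generalizing y with
  | nil =>
    cases y with
    | nil => simpa [star] using h
    | cons c y => cases c <;> simp [star] at h
  | cons c x ih =>
    cases y with
    | nil => cases c <;> simp [star] at h
    | cons d y =>
      simp only [star, List.cons_append, List.cons.injEq] at h
      obtain ⟨rfl, rfl⟩ := ih h.2.2
      simp [h.1]

theorem length_star (x : Str) : (star x).length = 2 * x.length + 2 := by
  induction x with
  | nil => rfl
  | cons b x ih => simp [star, ih]; omega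

theorem pair_inj {x y x' y' : Str} : pair x y = pair x' y' ↔ x = x' ∧ y = y' :=
  ⟨star_append_inj, by rintro ⟨rfl, rfl⟩; rfl⟩

theorem length_pair (x y : Str) : (pair x y).length = 2 * x.length + 2 + y.length := by
  simp [pair, length_star]

theorem natBits_injective : Function.Injective Nat.bits := by
  intro m n h
  have key : ∀ k : ℕ, k = Nat.ofDigits 2 (k.bits.map fun b => cond b 1 0) := by
    intro k
    rw [← Nat.digits_two_eq_bits, Nat.ofDigits_digits]
  rw [key m, key n, h]

mutual

theorem Form.code_append_inj (φ ψ : Form) (a b : Str) (h : φ.code ++ a = ψ.code ++ b) :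
    φ = ψ ∧ a = b := by
  match φ, ψ with
  | Form.tru, ψ => cases ψ <;> simp_all [Form.code]
  | Form.fls, ψ => cases ψ <;> simp_all [Form.code]
  | Form.var i, ψ =>
    cases ψ <;> simp [Form.code] at h
    obtain ⟨h1, h2⟩ := star_append_inj h
    exact ⟨by rw [natBits_injective h1], h2⟩
  | Form.neg φ, ψ =>
    cases ψ <;> simp [Form.code] at h
    obtain ⟨h1, h2⟩ := Form.code_append_inj _ _ _ _ h
    exact ⟨by rw [h1], h2⟩
  | Form.and φ₁ φ₂, ψ =>
    cases ψ <;> simp [Form.code] at h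
    obtain ⟨h1, h2⟩ := Form.code_append_inj _ _ _ _ h
    obtain ⟨h3, h4⟩ := Form.code_append_inj _ _ _ _ h2
    exact ⟨by rw [h1, h3], h4⟩
  | Form.or φ₁ φ₂, ψ =>
    cases ψ <;> simp [Form.code] at h
    obtain ⟨h1, h2⟩ := Form.code_append_inj _ _ _ _ h
    obtain ⟨h3, h4⟩ := Form.code_append_inj _ _ _ _ h2
    exact ⟨by rw [h1, h3], h4⟩
  | Form.gate φs, ψ =>
    cases ψ <;> simp [Form.code] at h
    obtain ⟨h1, h2⟩ := Form.codeList_append_inj _ _ _ _ h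
    exact ⟨by rw [h1], h2⟩

theorem Form.codeList_append_inj (φs ψs : List Form) (a b : Str)
    (h : Form.codeList φs ++ a = Form.codeList ψs ++ b) : φs = ψs ∧ a = b := by
  match φs, ψs with
  | [], [] => simpa [Form.codeList] using h
  | [], ψ :: ψs => cases ψ <;> simp [Form.codeList, Form.code] at h
  | φ :: φs, [] => cases φ <;> simp [Form.codeList, Form.code] at h
  | φ :: φs, ψ :: ψs =>
    simp only [Form.codeList, List.append_assoc] at h
    obtain ⟨h1, h2⟩ := Form.code_append_inj _ _ _ _ h
    obtain ⟨h3, h4⟩ := Form.codeList_append_inj _ _ _ _ h2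
    exact ⟨by rw [h1, h3], h4⟩

end

theorem Form.code_injective : Function.Injective Form.code := fun φ ψ h =>
  (Form.code_append_inj φ ψ [] [] (by simpa using h)).1

theorem code_mem_TAUT {O : Oracle} {φ : Form} :
    φ.code ∈ TAUT O ↔ ∀ v : ℕ → Bool, φ.eval O v = true :=
  ⟨fun ⟨_, h, h'⟩ => Form.code_injective h ▸ h', fun h => ⟨φ, rfl, h⟩⟩

theorem code_mem_SAT {O : Oracle} {φ : Form} :
    φ.code ∈ SAT O ↔ ∃ v : ℕ → Bool, φ.eval O v = true :=
  ⟨fun ⟨_, h, h'⟩ => Form.code_injective h ▸ h', fun h => ⟨φ, rfl, h⟩⟩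

/-! ### Locality of the evaluation of formulas -/

theorem Form.length_evalList (O : Oracle) (v : ℕ → Bool) (φs : List Form) :
    (Form.evalList O v φs).length = φs.length := by
  induction φs with
  | nil => simp [Form.evalList]
  | cons φ φs ih => simp [Form.evalList, ih]

mutual

theorem Form.decidedBy_eval_pred (φ : Form) (O : Oracle) (v : ℕ → Bool) :
    3 ≤ φ.code.length ∧ DecidedBy (fun O => φ.eval O v) O (φ.code.length - 1) := by
  match φ with
  | Form.tru => exact ⟨by simp [Form.code], by simpa only [Form.eval] using DecidedBy.const _⟩
  | Form.fls => exact ⟨by simp [Form.code], by simpa only [Form.eval] using DecidedBy.const _⟩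
  | Form.var i => exact ⟨by simp [Form.code], by simpa only [Form.eval] using DecidedBy.const _⟩
  | Form.neg φ =>
    obtain ⟨h1, h2⟩ := Form.decidedBy_eval_pred φ O v
    refine ⟨by simp [Form.code], ?_⟩
    simp only [Form.eval]
    exact (h2.map (fun b => !b)).mono (by simp [Form.code]; omega)
  | Form.and φ ψ =>
    obtain ⟨h1, h2⟩ := Form.decidedBy_eval_pred φ O v
    obtain ⟨h3, h4⟩ := Form.decidedBy_eval_pred ψ O v
    refine ⟨by simp [Form.code], ?_⟩
    simp only [Form.eval]
    exact (h2.bind (K := fun b O => b && ψ.eval O v) (h4.map _)).mono (by simp [Form.code]; omega)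
  | Form.or φ ψ =>
    obtain ⟨h1, h2⟩ := Form.decidedBy_eval_pred φ O v
    obtain ⟨h3, h4⟩ := Form.decidedBy_eval_pred ψ O v
    refine ⟨by simp [Form.code], ?_⟩
    simp only [Form.eval]
    exact (h2.bind (K := fun b O => b || ψ.eval O v) (h4.map _)).mono (by simp [Form.code]; omega)
  | Form.gate φs =>
    obtain ⟨h1, h2⟩ := Form.decidedBy_evalList φs O v
    refine ⟨by simp [Form.code], ?_⟩
    simp only [Form.eval]
    refine (h2.bind (K := fun w O => memBit O w) (DecidedBy.memBit _)).mono ?_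
    rw [Form.length_evalList]
    simp [Form.code]; omega

/-- The gap between the two lengths pays for the string of the values of `φs`. -/
theorem Form.decidedBy_evalList (φs : List Form) (O : Oracle) (v : ℕ → Bool) :
    φs.length ≤ (Form.codeList φs).length ∧
      DecidedBy (fun O => Form.evalList O v φs) O ((Form.codeList φs).length - φs.length) := by
  match φs with
  | [] => exact ⟨by simp, by simpa only [Form.evalList] using DecidedBy.const _⟩
  | φ :: φs =>
    obtain ⟨h1, h2⟩ := Form.decidedBy_eval_pred φ O v
    obtain ⟨h3, h4⟩ := Form.decidedBy_evalList φs O v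
    refine ⟨by simp [Form.codeList]; omega, ?_⟩
    simp only [Form.evalList]
    exact (h2.bind (K := fun b O => b :: Form.evalList O v φs) (h4.map _)).mono
      (by simp [Form.codeList]; omega)

end

theorem Form.decidedBy_eval (φ : Form) (O : Oracle) (v : ℕ → Bool) :
    DecidedBy (fun O => φ.eval O v) O φ.code.length :=
  (φ.decidedBy_eval_pred O v).2.mono (Nat.sub_le _ _)

theorem decidedBy_mem_TAUT {O : Oracle} {w : Str} (h : w ∉ TAUT O) :
    DecidedBy (fun O => w ∈ TAUT O) O w.length := by
  by_cases hw : ∃ φ : Form, φ.code = w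
  · obtain ⟨φ, rfl⟩ := hw
    rw [code_mem_TAUT] at h
    push Not at h
    obtain ⟨v, hv⟩ := h
    obtain ⟨D, hD, hd⟩ := φ.decidedBy_eval O v
    refine ⟨D, hD, fun O' hO => ?_⟩
    have h1 := hd O' hO
    simp only [eq_iff_iff, code_mem_TAUT]
    constructor
    · intro h2; exact absurd (h1.symm.trans (h2 v)) hv
    · intro h2; exact absurd (h2 v) hv
  · refine ⟨[], by simp, fun O' _ => ?_⟩
    have : ∀ O, w ∉ TAUT O := fun O ⟨φ, h, _⟩ => hw ⟨φ, h⟩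
    simp [this]

theorem Form.eval_congr {O O' : Oracle} (φ : Form) (v : ℕ → Bool)
    (h : ∀ w : Str, w.length ≤ φ.code.length → (w ∈ O' ↔ w ∈ O)) : φ.eval O' v = φ.eval O v :=
  (φ.decidedBy_eval O v).eq_of_agree h

theorem mem_TAUT_congr {O O' : Oracle} {w : Str}
    (h : ∀ u : Str, u.length ≤ w.length → (u ∈ O' ↔ u ∈ O)) : w ∈ TAUT O' ↔ w ∈ TAUT O := by
  constructor <;> rintro ⟨φ, rfl, hv⟩ <;> refine ⟨φ, rfl, fun v => ?_⟩
  · rw [← Form.eval_congr φ v h, hv v]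
  · rw [Form.eval_congr φ v h, hv v]

theorem mem_SAT_congr {O O' : Oracle} {w : Str}
    (h : ∀ u : Str, u.length ≤ w.length → (u ∈ O' ↔ u ∈ O)) : w ∈ SAT O' ↔ w ∈ SAT O := by
  constructor <;> rintro ⟨φ, rfl, v, hv⟩ <;> refine ⟨φ, rfl, v, ?_⟩
  · rw [← Form.eval_congr φ v h, hv]
  · rw [Form.eval_congr φ v h, hv]

/-! ### Formulas with a single gate -/

/-- The constant formula with value `b`. -/
def constForm (b : Bool) : Form := if b then Form.tru else Form.fls

/-- The formula saying that `pre` followed by the values of the first `n` variables belongs to the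
oracle. -/
def gateForm (pre : Str) (n : ℕ) : Form :=
  Form.gate (pre.map constForm ++ (List.range n).map Form.var)

theorem evalList_append (O : Oracle) (v : ℕ → Bool) (φs ψs : List Form) :
    Form.evalList O v (φs ++ ψs) = Form.evalList O v φs ++ Form.evalList O v ψs := by
  induction φs with
  | nil => simp [Form.evalList]
  | cons φ φs ih => simp [Form.evalList, ih]

theorem eval_gateForm (O : Oracle) (v : ℕ → Bool) (pre : Str) (n : ℕ) :
    (gateForm pre n).eval O v = true ↔ pre ++ (List.range n).map v ∈ O := by
  have h1 : Form.evalList O v (pre.map constForm) = pre := by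
    induction pre with
    | nil => simp [Form.evalList]
    | cons b pre ih => cases b <;> simp [Form.evalList, ih, constForm, Form.eval]
  have h2 : ∀ l : List ℕ, Form.evalList O v (l.map Form.var) = l.map v := by
    intro l
    induction l with
    | nil => simp [Form.evalList]
    | cons b pre ih => simp [Form.evalList, ih, Form.eval]
  simp [gateForm, Form.eval, evalList_append, h1, h2, memBit]

theorem exists_eval_gateForm {O : Oracle} {pre : Str} {n : ℕ} :
    (∃ v, (gateForm pre n).eval O v = true) ↔ ∃ y : Str, y.length = n ∧ pre ++ y ∈ O := by
  simp only [eval_gateForm]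
  constructor
  · rintro ⟨v, hv⟩
    exact ⟨_, by simp, hv⟩
  · rintro ⟨y, rfl, hy⟩
    refine ⟨fun i => y.getD i false, ?_⟩
    convert hy
    apply List.ext_getElem <;> simp +contextual

theorem length_codeList_append (φs ψs : List Form) :
    (Form.codeList (φs ++ ψs)).length + 3 =
      (Form.codeList φs).length + (Form.codeList ψs).length := by
  induction φs with
  | nil => simp [Form.codeList]; omega
  | cons φ φs ih => simp [Form.codeList]; omega

theorem length_natBits (i : ℕ) : i.bits.length ≤ i := by
  rw [Nat.size_eq_bits_len]
  exact Nat.size_le.2 i.lt_two_pow_self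

theorem length_code_gateForm (pre : Str) (n : ℕ) :
    (gateForm pre n).code.length ≤ 6 + 3 * pre.length + n * (2 * n + 5) := by
  have h1 : (Form.codeList (pre.map constForm)).length = 3 * pre.length + 3 := by
    induction pre with
    | nil => simp [Form.codeList]
    | cons b pre ih => cases b <;> simp [Form.codeList, ih, constForm, Form.code] <;> ring
  have h2 : ∀ l : List ℕ, (∀ i ∈ l, i ≤ n) →
      (Form.codeList (l.map Form.var)).length ≤ 3 + l.length * (2 * n + 5) := by
    intro l hl
    induction l with
    | nil => simp [Form.codeList]
    | cons i l ih =>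
      have := ih fun j hj => hl j (by simp [hj])
      have := length_natBits i
      have := hl i (by simp)
      simp only [List.map_cons, Form.codeList, Form.code, List.length_append, length_star,
        List.length_cons, List.length_nil, add_mul]
      omega
  have h3 := h2 (List.range n) (by intro i hi; simp at hi; omega)
  have h4 := length_codeList_append (pre.map constForm) ((List.range n).map Form.var)
  simp only [gateForm, Form.code, List.length_append, List.length_range, List.length_cons,
    List.length_nil] at *
  omega

/-! ### Oracles that contain polynomial time functions -/

/-- A function of an oracle and a string whose values are polynomially bounded and are decided by
oracle answers to strings of polynomial total length. The polynomials `bud` and `len` bound this total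
length and the length of the values. -/
structure Task where
  fn : Oracle → Str → Str
  bud : Polynomial ℕ
  len : Polynomial ℕ
  length_le : ∀ O x, (fn O x).length ≤ len.eval x.length
  decided : ∀ O x, DecidedBy (fun O => fn O x) O (bud.eval x.length)

/-- `G` and `G'` contain the same strings of length at most `n`. -/
def Agree (n : ℕ) (G G' : Set Str) : Prop := ∀ u : Str, u.length ≤ n → (u ∈ G ↔ u ∈ G')

namespace Agree

variable {n m : ℕ} {G G' G'' : Set Str}

theorem refl (n : ℕ) (G : Set Str) : Agree n G G := fun _ _ => Iff.rfl

theorem symm (h : Agree n G G') : Agree n G' G := fun u hu => (h u hu).symm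

theorem trans (h : Agree n G G') (h' : Agree n G' G'') : Agree n G G'' :=
  fun u hu => (h u hu).trans (h' u hu)

theorem mono (h : Agree n G G') (hm : m ≤ n) : Agree m G G' := fun u hu => h u (hu.trans hm)

end Agree

/-- The data from which an oracle is built over a generic set `G` of strings: a countable family of
tasks, and a countable family of special predicates. The special predicate `sp k F G l x` may use
the oracles `F H` built over arbitrary sets `H`, but only up to length `l`. -/
structure Scheme where
  ι : Type
  κ : Type
  encι : Encodable ι
  encκ : Encodable κ
  task : ι → Task
  sp : κ → (Set Str → Oracle) → Set Str → ℕ → Str → Prop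
  sp_congr : ∀ k F F' G G' l x, (∀ H H', Agree l H H' → Agree l (F H) (F' H')) →
    Agree l G G' → (sp k F G l x ↔ sp k F' G' l x)

/-- The prefix of a question about the task (`kind = false`) or the special predicate
(`kind = true`) with number `i`. -/
def tagOf (kind : Bool) (i : ℕ) : Str := kind :: (List.replicate i true ++ [false])

/-- The question number `l` about the task or special predicate number `i` at the string `x`. -/
def taskWord (kind : Bool) (i l : ℕ) (x : Str) : Str := true :: writerStack (tagOf kind i) x l

theorem unary_append_inj {i j : ℕ} {x y : Str}
    (h : List.replicate i true ++ false :: x = List.replicate j true ++ false :: y) :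
    i = j ∧ x = y := by
  induction i generalizing j with
  | zero => cases j <;> simp_all [List.replicate_succ]
  | succ i ih =>
    cases j with
    | zero => simp [List.replicate_succ] at h
    | succ j =>
      simp only [List.replicate_succ, List.cons_append, List.cons.injEq, true_and] at h
      obtain ⟨rfl, rfl⟩ := ih h
      simp

theorem taskWord_inj {kind kind' : Bool} {i i' l l' : ℕ} {x x' : Str} :
    taskWord kind i l x = taskWord kind' i' l' x' ↔ kind = kind' ∧ i = i' ∧ l = l' ∧ x = x' := by
  constructor
  · intro h
    simp only [taskWord, writerStack, tagOf, List.cons.injEq, true_and] at h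
    obtain ⟨rfl, h1⟩ := unary_append_inj h
    simp only [List.cons_append, List.append_assoc, List.nil_append, List.cons.injEq] at h1
    obtain ⟨rfl, rfl⟩ := unary_append_inj h1.2
    simp [h1.1]
  · rintro ⟨rfl, rfl, rfl, rfl⟩
    rfl

theorem length_taskWord (kind : Bool) (i l : ℕ) (x : Str) :
    (taskWord kind i l x).length = l + i + x.length + 4 := by
  simp [taskWord, length_writerStack, tagOf]; omega

namespace Scheme

variable (S : Scheme)

/-- The number of a task. -/
def ti (i : S.ι) : ℕ := S.encι.encode i

/-- The number of a special predicate. -/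
def si (k : S.κ) : ℕ := S.encκ.encode k

theorem ti_inj {i j : S.ι} : S.ti i = S.ti j ↔ i = j := (@Encodable.encode_injective _ S.encι).eq_iff

theorem si_inj {i j : S.κ} : S.si i = S.si j ↔ i = j := (@Encodable.encode_injective _ S.encκ).eq_iff

/-- Whether `w` belongs to the oracle over `G`, in terms of the oracles `F H` built so far. -/
def Rule (F : Set Str → Oracle) (G : Set Str) (w : Str) : Prop :=
  (∃ u, w = false :: u ∧ u ∈ G) ∨
  (∃ (i : S.ι) (l : ℕ) (x : Str), w = taskWord false (S.ti i) l x ∧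
    dictate ((S.task i).fn (F G) x) ((S.task i).bud.eval x.length) l = true) ∨
  (∃ (k : S.κ) (l : ℕ) (x : Str), w = taskWord true (S.si k) l x ∧ S.sp k F G l x)

/-- The part of the oracle over `G` that consists of the strings of length less than `n`. -/
def level : ℕ → Set Str → Oracle
  | 0, _ => ∅
  | n + 1, G => level n G ∪ {w | w.length = n ∧ S.Rule (level n) G w}

/-- The oracle over the generic set `G`. -/
def build (G : Set Str) : Oracle := {w | w ∈ S.level (w.length + 1) G}

theorem mem_level_iff_rule {n : ℕ} {G : Set Str} {w : Str} :
    w ∈ S.level n G ↔ w.length < n ∧ S.Rule (S.level w.length) G w := by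
  induction n with
  | zero => simp [level]
  | succ n ih =>
    simp only [level, Set.mem_union, ih, Set.mem_ofPred_eq]
    constructor
    · rintro (⟨h1, h2⟩ | ⟨rfl, h⟩)
      · exact ⟨by omega, h2⟩
      · exact ⟨by omega, h⟩
    · rintro ⟨h1, h2⟩
      rcases Nat.lt_succ_iff_lt_or_eq.1 h1 with h | rfl
      · exact Or.inl ⟨h, h2⟩
      · exact Or.inr ⟨rfl, h2⟩

theorem mem_build {G : Set Str} {w : Str} : w ∈ S.build G ↔ S.Rule (S.level w.length) G w := by
  rw [build, Set.mem_ofPred_eq, mem_level_iff_rule]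
  simp

theorem mem_level {n : ℕ} {G : Set Str} {w : Str} :
    w ∈ S.level n G ↔ w.length < n ∧ w ∈ S.build G := by
  rw [mem_level_iff_rule, mem_build]

theorem agree_level {n l : ℕ} (h : l < n) (G : Set Str) : Agree l (S.level n G) (S.build G) := by
  intro w hw
  rw [mem_level]
  exact ⟨fun h => h.2, fun h' => ⟨by omega, h'⟩⟩

/-- The oracle up to length `n` depends only on the generic set up to length `n`. -/
theorem build_congr {n : ℕ} {G G' : Set Str} (h : Agree n G G') :
    Agree n (S.build G) (S.build G') := by
  intro w hw
  induction hm : w.length using Nat.strong_induction_on generalizing n w G G' with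
  | _ m ih =>
    have hlev : ∀ {l H H'}, l < m → Agree l H H' → Agree l (S.level m H) (S.level m H') := by
      intro l H H' hl hH u hu
      rw [mem_level, mem_level, ih u.length (by omega) hH u hu rfl]
    have hF : S.level m G = S.level m G' := by
      ext u
      rw [mem_level, mem_level]
      exact and_congr_right fun hu => ih u.length hu h u (by omega) rfl
    rw [mem_build, mem_build, hm]
    unfold Rule
    rw [hF]
    refine or_congr ?_ (or_congr Iff.rfl ?_)
    · refine exists_congr fun u => and_congr_right fun hu => h u ?_
      rw [hu] at hw
      simp at hw
      omega
    · refine exists_congr fun k => exists_congr fun l => exists_congr fun x =>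
        and_congr_right fun hx => ?_
      have hl : l < m := by rw [← hm, hx, length_taskWord]; omega
      exact S.sp_congr k _ _ G G' l x (fun H H' hH => hlev hl hH) (h.mono (by omega))

theorem mem_build_gen {G : Set Str} {u : Str} : false :: u ∈ S.build G ↔ u ∈ G := by
  rw [mem_build]
  simp [Rule, taskWord]

theorem dictate_congr {y y' : Str} {N l : ℕ} (h : N ≤ l → y = y') :
    dictate y N l = dictate y' N l := by
  unfold dictate
  by_cases hl : l / 2 < N
  · simp [hl]
  · rw [h (by omega)]

theorem mem_build_task {G : Set Str} {i : S.ι} {l : ℕ} {x : Str} :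
    taskWord false (S.ti i) l x ∈ S.build G ↔
      dictate ((S.task i).fn (S.build G) x) ((S.task i).bud.eval x.length) l = true := by
  have h : dictate ((S.task i).fn (S.level (taskWord false (S.ti i) l x).length G) x)
        ((S.task i).bud.eval x.length) l =
      dictate ((S.task i).fn (S.build G) x) ((S.task i).bud.eval x.length) l := by
    refine dictate_congr fun hl => ?_
    refine ((S.task i).decided _ x).eq_of_agree fun w hw => S.agree_level ?_ G w hw
    rw [length_taskWord]
    omega
  rw [mem_build, ← h]
  constructor
  · rintro (⟨u, h1, -⟩ | ⟨j, l', x', h1, h2⟩ | ⟨k, l', x', h1, -⟩)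
    · simp [taskWord] at h1
    · rw [taskWord_inj, S.ti_inj] at h1
      obtain ⟨-, rfl, rfl, rfl⟩ := h1
      exact h2
    · simp [taskWord_inj] at h1
  · intro h2
    exact Or.inr (Or.inl ⟨i, l, x, rfl, h2⟩)

theorem mem_build_special {G : Set Str} {k : S.κ} {l : ℕ} {x : Str} :
    taskWord true (S.si k) l x ∈ S.build G ↔ S.sp k S.build G l x := by
  have h : S.sp k (S.level (taskWord true (S.si k) l x).length) G l x ↔
      S.sp k S.build G l x := by
    refine S.sp_congr k _ _ G G l x (fun H H' hH => ?_) (Agree.refl _ _)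
    refine (S.agree_level ?_ H).trans (S.build_congr hH)
    rw [length_taskWord]
    omega
  rw [mem_build, ← h]
  constructor
  · rintro (⟨u, h1, -⟩ | ⟨j, l', x', h1, h2⟩ | ⟨j, l', x', h1, h2⟩)
    · simp [taskWord] at h1
    · simp [taskWord_inj] at h1
    · rw [taskWord_inj, S.si_inj] at h1
      obtain ⟨-, rfl, rfl, rfl⟩ := h1
      exact h2
  · intro h2
    exact Or.inr (Or.inr ⟨k, l, x, rfl, h2⟩)

/-! ### Functions computed by asking the oracle -/

/-- The membership of `w` in the oracle over `G` is decided, among the sets in `C`, by at most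
`w.length` bits of `G`. -/
def Local (C : Set (Set Str)) (G : Set Str) (w : Str) : Prop :=
  ∃ E : Finset Str, E.card ≤ w.length ∧
    ∀ G' ∈ C, (∀ u ∈ E, u ∈ G' ↔ u ∈ G) → (w ∈ S.build G' ↔ w ∈ S.build G)

theorem Local.list {C : Set (Set Str)} {G : Set Str} {D : List Str}
    (h : ∀ w ∈ D, S.Local C G w) : ∃ E : Finset Str, E.card ≤ (D.map List.length).sum ∧
      ∀ G' ∈ C, (∀ u ∈ E, u ∈ G' ↔ u ∈ G) → ∀ w ∈ D, w ∈ S.build G' ↔ w ∈ S.build G := by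
  classical
  induction D with
  | nil => exact ⟨∅, by simp, by simp⟩
  | cons w D ih =>
    obtain ⟨E, hE, h1⟩ := ih fun u hu => h u (by simp [hu])
    obtain ⟨E', hE', h2⟩ := h w (by simp)
    refine ⟨E' ∪ E, ?_, fun G' hG hu v hv => ?_⟩
    · refine (Finset.card_union_le _ _).trans ?_
      simp only [List.map_cons, List.sum_cons]
      omega
    · rcases List.mem_cons.1 hv with rfl | hv
      · exact h2 G' hG fun u h => hu u (by simp [h])
      · exact h1 G' hG (fun u h => hu u (by simp [h])) v hv

/-- A value decided by oracle answers of total length `n` is decided by `n` bits of the generic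
set. -/
theorem Local.decided {α : Type*} {F : Oracle → α} {C : Set (Set Str)} {G : Set Str} {n : ℕ}
    (hF : DecidedBy F (S.build G) n) (h : ∀ w : Str, w.length ≤ n → S.Local C G w) :
    ∃ E : Finset Str, E.card ≤ n ∧
      ∀ G' ∈ C, (∀ u ∈ E, u ∈ G' ↔ u ∈ G) → F (S.build G') = F (S.build G) := by
  obtain ⟨D, hD, hF⟩ := hF
  obtain ⟨E, hE, h⟩ := Local.list S (C := C) (G := G) (D := D) fun w hw =>
    h w ((List.single_le_sum (by simp) _ (List.mem_map_of_mem hw)).trans hD)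
  exact ⟨E, hE.trans hD, fun G' hG hu => hF _ (h G' hG hu)⟩

/-- All strings up to length `M` are local once the special ones are. The bits needed for a task
are counted by the total length of the strings asked, which is less than the length of the
question. -/
theorem local_of_special {C : Set (Set Str)} {G : Set Str} {M : ℕ}
    (h : ∀ k l x, (taskWord true (S.si k) l x).length ≤ M →
      (∀ w : Str, w.length ≤ l → S.Local C G w) → S.Local C G (taskWord true (S.si k) l x))
    (w : Str) (hw : w.length ≤ M) : S.Local C G w := by
  induction hm : w.length using Nat.strong_induction_on generalizing w with
  | _ m ih =>
    by_cases h1 : ∃ u, w = false :: u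
    · obtain ⟨u, rfl⟩ := h1
      exact ⟨{u}, by simp, fun G' _ hu => by simpa [mem_build_gen] using hu⟩
    by_cases h2 : ∃ (i : S.ι) (l : ℕ) (x : Str), w = taskWord false (S.ti i) l x
    · obtain ⟨i, l, x, rfl⟩ := h2
      have hl : l < m := by rw [← hm, length_taskWord]; omega
      rcases le_or_gt ((S.task i).bud.eval x.length) l with hb | hb
      · obtain ⟨E, hE, h3⟩ := Local.decided S ((S.task i).decided (S.build G) x)
          (C := C) fun w' hw' => ih w'.length (by omega) w' (by omega) rfl
        refine ⟨E, by omega, fun G' hG hu => ?_⟩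
        rw [mem_build_task, mem_build_task, h3 G' hG hu]
      · refine ⟨∅, by simp, fun G' _ _ => ?_⟩
        rw [mem_build_task, mem_build_task, dictate_congr fun h => absurd h (by omega)]
    by_cases h3 : ∃ (k : S.κ) (l : ℕ) (x : Str), w = taskWord true (S.si k) l x
    · obtain ⟨k, l, x, rfl⟩ := h3
      refine h k l x hw fun w' hw' => ih w'.length ?_ w' ?_ rfl
      all_goals rw [length_taskWord] at *; omega
    · refine ⟨∅, by simp, fun G' _ _ => ?_⟩
      rw [mem_build, mem_build]
      unfold Rule
      simp only [not_exists] at h1 h2 h3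
      simp [h1, h2, h3]

end Scheme

theorem answer_eq {O : Oracle} {w : Str} {b : Bool} (h : w ∈ O ↔ b = true) :
    answer O w = [b] := by
  simp [answer, memBit, h]

theorem polyTimeFun_of_dictate {O : Oracle} {f : Str → Str} {N len : Polynomial ℕ} {kind : Bool}
    {i : ℕ} (hlen : ∀ x, (f x).length ≤ len.eval x.length)
    (h : ∀ x l, taskWord kind i l x ∈ O ↔ dictate (f x) (N.eval x.length) l = true) :
    PolyTimeFun O f := by
  refine ⟨writer false (tagOf kind i), _, writer_computes (N := N) hlen fun x l => ?_⟩
  exact answer_eq (h x l)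

theorem joinHalts_of_dictate {O : Oracle} {f : Str → Str} {N len : Polynomial ℕ} {kind : Bool}
    {i : ℕ} (hlen : ∀ x, (f x).length ≤ len.eval x.length)
    (h : ∀ x l, taskWord kind i l x ∈ O ↔ dictate (f x) (N.eval x.length) l = true) :
    ∃ (P : Prog) (p : Polynomial ℕ), ∀ (g : Str → Str) (x : Str),
      HaltsWith P (joinAnswer O g) x (p.eval x.length) (f x) := by
  refine ⟨writer true (tagOf kind i), _, fun g => writer_computes (N := N) hlen fun x l => ?_⟩
  exact answer_eq (h x l)

theorem Scheme.polyTimeFun_task (S : Scheme) (i : S.ι) (G : Set Str) :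
    PolyTimeFun (S.build G) ((S.task i).fn (S.build G)) :=
  polyTimeFun_of_dictate ((S.task i).length_le _) fun _ _ => S.mem_build_task

theorem Scheme.polyTimeRel_task (S : Scheme) (i : S.ι) (G : Set Str) {R : Str → Str → Prop}
    (h : ∀ x y, R x y ↔ (S.task i).fn (S.build G) (pair x y) = [true]) :
    PolyTimeRel (S.build G) R :=
  ⟨_, S.polyTimeFun_task i G, h⟩

/-! ### Generic sets -/

/-- A set `X` of sets of strings that contains every `G` that agrees up to every length with some
element of `X`. -/
def ClosedFamily (X : Set (Set Str)) : Prop :=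
  ∀ G, (∀ m, ∃ G' ∈ X, Agree m G G') → G ∈ X

/-- A property that, if it holds, is guaranteed by the strings up to some length. -/
def OpenProp (E : Set Str → Prop) : Prop :=
  ∀ G, E G → ∃ m, ∀ G', Agree m G G' → E G'

namespace OpenProp

theorem exists_ {α : Sort*} {E : α → Set Str → Prop} (h : ∀ a, OpenProp (E a)) :
    OpenProp fun G => ∃ a, E a G := by
  rintro G ⟨a, ha⟩
  obtain ⟨m, hm⟩ := h a G ha
  exact ⟨m, fun G' hG => ⟨a, hm G' hG⟩⟩

theorem and {E F : Set Str → Prop} (hE : OpenProp E) (hF : OpenProp F) :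
    OpenProp fun G => E G ∧ F G := by
  rintro G ⟨h1, h2⟩
  obtain ⟨m, hm⟩ := hE G h1
  obtain ⟨n, hn⟩ := hF G h2
  exact ⟨max m n, fun G' hG => ⟨hm G' (hG.mono (le_max_left _ _)),
    hn G' (hG.mono (le_max_right _ _))⟩⟩

theorem or {E F : Set Str → Prop} (hE : OpenProp E) (hF : OpenProp F) :
    OpenProp fun G => E G ∨ F G := by
  rintro G (h | h)
  · obtain ⟨m, hm⟩ := hE G h
    exact ⟨m, fun G' hG => Or.inl (hm G' hG)⟩
  · obtain ⟨m, hm⟩ := hF G h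
    exact ⟨m, fun G' hG => Or.inr (hm G' hG)⟩

theorem of_agree {E : Set Str → Prop} (m : ℕ) (h : ∀ G G', Agree m G G' → E G → E G') :
    OpenProp E := fun G hG => ⟨m, fun G' hG' => h G G' hG' hG⟩

theorem of_decidedBy {α : Type*} {F : Oracle → α} {n : ℕ} (h : ∀ O, DecidedBy F O n)
    (Q : α → Prop) : OpenProp fun O => Q (F O) :=
  of_agree n fun O _ hO hQ => ((h O).eq_of_agree fun w hw => (hO w hw).symm).symm ▸ hQ

theorem build {E : Oracle → Prop} (h : OpenProp E) (S : Scheme) :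
    OpenProp fun G => E (S.build G) := by
  intro G hG
  obtain ⟨m, hm⟩ := h _ hG
  exact ⟨m, fun G' hG' => hm _ (S.build_congr hG')⟩

end OpenProp

/-- A finite condition on the generic set: the promises in `I` are kept, and the strings up to
length `m` are those of `G`. The set `G` shows that the condition can be met. -/
structure Stage (B : Set (Set Str)) (C : ℕ → Set (Set Str)) where
  I : Finset ℕ
  m : ℕ
  G : Set Str
  base : G ∈ B
  keeps : ∀ i ∈ I, G ∈ C i

/-- One step of the construction: the property `E` is forced if this is possible, and then a fresh
promise is made. -/
theorem Stage.exists_next {B : Set (Set Str)} {C : ℕ → Set (Set Str)}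
    (hfresh : ∀ (I : Finset ℕ) (m : ℕ), ∀ G ∈ B, (∀ i ∈ I, G ∈ C i) → ∃ k, k ∉ I ∧ m < k ∧
      ∃ G' ∈ B, (∀ i ∈ I, G' ∈ C i) ∧ G' ∈ C k ∧ Agree m G G')
    {E : Set Str → Prop} (hE : OpenProp E) (s : Stage B C) :
    ∃ (s' : Stage B C) (k : ℕ), s'.I = insert k s.I ∧ k ∉ s.I ∧ s.m < s'.m ∧ s.m < k ∧
      Agree s.m s.G s'.G ∧ ((∀ H, Agree s'.m s'.G H → E H) ∨
        ∀ H ∈ B, (∀ i ∈ s.I, H ∈ C i) → Agree s.m s.G H → ¬ E H) := by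
  classical
  by_cases h : ∃ H ∈ B, (∀ i ∈ s.I, H ∈ C i) ∧ Agree s.m s.G H ∧ E H
  · obtain ⟨H, hB, hI, hag, hEH⟩ := h
    obtain ⟨n, hn⟩ := hE H hEH
    obtain ⟨k, hk, hmk, G', hB', hI', hC, hag'⟩ := hfresh s.I (max n (s.m + 1)) H hB hI
    refine ⟨⟨insert k s.I, max n (s.m + 1), G', hB', ?_⟩, k, rfl, hk, ?_, ?_, ?_, Or.inl ?_⟩
    · intro i hi
      rcases Finset.mem_insert.1 hi with rfl | hi
      exacts [hC, hI' i hi]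
    · show s.m < max n (s.m + 1)
      omega
    · omega
    · exact hag.trans (hag'.mono (by omega))
    · exact fun J hJ => hn J ((hag'.trans hJ).mono (by omega))
  · obtain ⟨k, hk, hmk, G', hB', hI', hC, hag'⟩ := hfresh s.I (s.m + 1) s.G s.base s.keeps
    refine ⟨⟨insert k s.I, s.m + 1, G', hB', ?_⟩, k, rfl, hk, ?_, ?_, ?_, Or.inr ?_⟩
    · intro i hi
      rcases Finset.mem_insert.1 hi with rfl | hi
      exacts [hC, hI' i hi]
    · show s.m < s.m + 1
      omega
    · omega
    · exact hag'.mono (by omega)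
    · exact fun H hB hI hag hEH => h ⟨H, hB, hI, hag, hEH⟩

/-- There is a generic set: every property of a countable family of open properties either holds of
it, or fails for all sets that satisfy one of the finite conditions met in the construction. With
each property goes a fresh promise `C k`, which is not part of that finite condition. -/
theorem exists_generic {B : Set (Set Str)} {C : ℕ → Set (Set Str)} {ε : Type*} [Countable ε]
    [Nonempty ε] (hne : B.Nonempty) (hB : ClosedFamily B) (hC : ∀ i, ClosedFamily (C i))
    (hfresh : ∀ (I : Finset ℕ) (m : ℕ), ∀ G ∈ B, (∀ i ∈ I, G ∈ C i) → ∃ k, k ∉ I ∧ m < k ∧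
      ∃ G' ∈ B, (∀ i ∈ I, G' ∈ C i) ∧ G' ∈ C k ∧ Agree m G G')
    (E : ε → Set Str → Prop) (hE : ∀ e, OpenProp (E e)) :
    ∃ G ∈ B, ∀ e, ∃ (I : Finset ℕ) (m k : ℕ), k ∉ I ∧ m < k ∧ (∀ i ∈ I, G ∈ C i) ∧ G ∈ C k ∧
      (E e G ∨ ∀ H ∈ B, (∀ i ∈ I, H ∈ C i) → Agree m G H → ¬ E e H) := by
  obtain ⟨f, hf⟩ := exists_surjective_nat ε
  choose next key hI hk hm hmk hag hforce using fun n : ℕ =>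
    Stage.exists_next hfresh (hE (f n))
  obtain ⟨G₀, hG₀⟩ := hne
  let s : ℕ → Stage B C := fun n =>
    Nat.rec ⟨∅, 0, G₀, hG₀, by simp⟩ (fun n s => next n s) n
  have hs : ∀ n, s (n + 1) = next n (s n) := fun n => rfl
  have hmn : ∀ n, n ≤ (s n).m := by
    intro n
    induction n with
    | zero => exact Nat.zero_le _
    | succ n ih => rw [hs]; exact lt_of_le_of_lt ih (hm n (s n))
  have hmono : ∀ n d, (s n).m ≤ (s (n + d)).m ∧ (s n).I ⊆ (s (n + d)).I ∧
      Agree (s n).m (s n).G (s (n + d)).G := by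
    intro n d
    induction d with
    | zero => exact ⟨le_rfl, Finset.Subset.refl _, Agree.refl _ _⟩
    | succ d ih =>
      rw [← Nat.add_assoc, hs]
      refine ⟨ih.1.trans (hm _ _).le, ih.2.1.trans ?_, ih.2.2.trans ((hag _ _).mono ih.1)⟩
      rw [hI]
      exact Finset.subset_insert _ _
  let G : Set Str := {u | u ∈ (s u.length).G}
  have hG : ∀ n, Agree (s n).m (s n).G G := by
    intro n u hu
    show u ∈ (s n).G ↔ u ∈ (s u.length).G
    rcases le_total n u.length with h | h
    · obtain ⟨d, hd⟩ := Nat.exists_eq_add_of_le h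
      rw [hd]
      exact (hmono n d).2.2 u hu
    · obtain ⟨d, hd⟩ := Nat.exists_eq_add_of_le h
      have := (hmono u.length d).2.2 u (hmn _)
      rw [← hd] at this
      exact this.symm
  have hGI : ∀ n, ∀ i ∈ (s n).I, G ∈ C i := by
    intro n i hi
    refine hC i G fun m => ⟨(s (n + m)).G, (s (n + m)).keeps i ((hmono n m).2.1 hi), ?_⟩
    exact ((hG (n + m)).mono (by have := hmn (n + m); omega)).symm
  refine ⟨G, hB G fun m => ⟨(s m).G, (s m).base, ((hG m).mono (hmn m)).symm⟩, fun e => ?_⟩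
  obtain ⟨n, rfl⟩ := hf e
  refine ⟨(s n).I, (s n).m, key n (s n), hk _ _, hmk _ _, hGI n, hGI (n + 1) _ ?_, ?_⟩
  · rw [hs, hI]
    exact Finset.mem_insert_self _ _
  · rcases hforce n (s n) with h | h
    · exact Or.inl (h G (hG (n + 1)))
    · exact Or.inr fun H hHB hHI hHG => h H hHB hHI ((hG n).trans hHG)

/-! ### Clocked machines -/

instance : Countable Instr := by
  let f : Instr → (ℕ × Bool) ⊕ (ℕ × ℕ × ℕ × ℕ) ⊕ Unit := fun i => match i with
    | Instr.push s b => Sum.inl (s, b)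
    | Instr.pop s e f t => Sum.inr (Sum.inl (s, e, f, t))
    | Instr.query => Sum.inr (Sum.inr ())
  refine Function.Injective.countable (f := f) fun i j h => ?_
  cases i <;> cases j <;> simp_all [f]

instance : Countable (Polynomial ℕ) :=
  Cardinal.mk_le_aleph0_iff.1 (Polynomial.cardinalMk_le_max.trans (by simp))

/-- A machine together with a polynomial that bounds its running time. -/
abbrev Machine := Prog × Polynomial ℕ

/-- The output of a clocked machine. -/
noncomputable def Machine.run (M : Machine) (O : Oracle) (z : Str) : Str :=
  runOut M.1 (answer O) z (M.2.eval z.length)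

theorem Machine.decided (M : Machine) (O : Oracle) (z : Str) :
    DecidedBy (fun O => M.run O z) O (M.2.eval z.length) :=
  decidedBy_runOut M.1 z _ O

theorem Machine.length_run (M : Machine) (O : Oracle) (z : Str) :
    (M.run O z).length ≤ z.length + M.2.eval z.length :=
  length_runOut _ _ _ _

theorem PolyTimeFun.exists_machine {O : Oracle} {f : Str → Str} (h : PolyTimeFun O f) :
    ∃ M : Machine, ∀ z, M.run O z = f z := by
  obtain ⟨P, p, h⟩ := h
  exact ⟨(P, p), fun z => (h z).runOut_eq⟩

theorem PolyTimeFun.exists_length_le {O : Oracle} {f : Str → Str} (h : PolyTimeFun O f) :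
    ∃ p : Polynomial ℕ, ∀ x, (f x).length ≤ p.eval x.length := by
  obtain ⟨M, hM⟩ := h.exists_machine
  refine ⟨Polynomial.X + M.2, fun x => ?_⟩
  rw [← hM]
  simpa using M.length_run O x

/-- A clocked machine that checks solutions, together with a polynomial bound for the length of
the solutions. -/
abbrev Verifier := Machine × Polynomial ℕ

/-- `y` is a solution of the instance `x`. -/
def Verifier.Sol (V : Verifier) (O : Oracle) (x y : Str) : Prop :=
  y.length ≤ V.2.eval x.length ∧ V.1.run O (pair x y) = [true]

/-- A polynomial bound for the time needed to check a solution. -/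
noncomputable def Verifier.time (V : Verifier) : Polynomial ℕ :=
  V.1.2.comp (2 * Polynomial.X + 2 + V.2)

theorem Verifier.time_le (V : Verifier) {x y : Str} (h : y.length ≤ V.2.eval x.length) :
    V.1.2.eval (pair x y).length ≤ V.time.eval x.length := by
  simp only [Verifier.time, Polynomial.eval_comp, Polynomial.eval_add, Polynomial.eval_mul,
    Polynomial.eval_X, Polynomial.eval_ofNat]
  exact eval_mono_nat _ (by rw [length_pair]; omega)

theorem Verifier.decided (V : Verifier) (O : Oracle) (x y : Str) :
    DecidedBy (fun O => V.Sol O x y) O (V.time.eval x.length) := by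
  by_cases h : y.length ≤ V.2.eval x.length
  · simp only [Verifier.Sol, h, true_and]
    exact ((V.1.decided O (pair x y)).map (fun z => z = [true])).mono (V.time_le h)
  · simp only [Verifier.Sol, h, false_and]
    exact DecidedBy.const _

/-- Every instance has a solution. -/
def Verifier.Total (V : Verifier) (O : Oracle) : Prop := ∀ x, ∃ y, V.Sol O x y

theorem Verifier.sol_congr (V : Verifier) {O O' : Oracle} {x : Str}
    (h : Agree (V.time.eval x.length) O O') (y : Str) : V.Sol O x y ↔ V.Sol O' x y :=
  eq_iff_iff.1 ((V.decided O' x y).eq_of_agree fun w hw => h w hw)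

theorem Verifier.openProp_noSol (V : Verifier) (x : Str) :
    OpenProp fun O => ¬ ∃ y, V.Sol O x y :=
  OpenProp.of_agree (V.time.eval x.length) fun _ _ h h1 ⟨y, hy⟩ => h1 ⟨y, (V.sol_congr h y).2 hy⟩

theorem Verifier.openProp_not_total (V : Verifier) : OpenProp fun O => ¬ V.Total O := by
  simp only [Verifier.Total, not_forall]
  exact OpenProp.exists_ V.openProp_noSol

theorem PolyTimeRel.exists_verifier {O : Oracle} {R : Str → Str → Prop} (h : PolyTimeRel O R)
    (p : Polynomial ℕ) :
    ∃ V : Verifier, ∀ x y, V.Sol O x y ↔ (y.length ≤ p.eval x.length ∧ R x y) := by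
  obtain ⟨f, hf, hR⟩ := h
  obtain ⟨M, hM⟩ := hf.exists_machine
  exact ⟨(M, p), fun x y => by simp [Verifier.Sol, hM, hR]⟩

theorem TFNPProblem.exists_verifier {O : Oracle} (T : TFNPProblem O) :
    ∃ V : Verifier, (∀ x y, V.Sol O x y ↔ T.Sol x y) ∧ V.Total O := by
  obtain ⟨V, hV⟩ := T.polyTime.exists_verifier T.bound
  exact ⟨V, hV, fun x => (T.total x).imp fun y => (hV x y).2⟩

theorem InNP.exists_verifier {O : Oracle} {L : Set Str} (h : InNP O L) :
    ∃ V : Verifier, ∀ x, x ∈ L ↔ ∃ y, V.Sol O x y := by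
  obtain ⟨p, R, hR, hL⟩ := h
  obtain ⟨V, hV⟩ := hR.exists_verifier p
  exact ⟨V, fun x => by simp only [hL, hV]⟩

theorem HasPOptimal.nonuniform {O : Oracle} {C : Set Str} (h : HasPOptimal O C) :
    HasNonuniformPOptimal O C := by
  obtain ⟨P, hP, hopt⟩ := h
  refine ⟨P, hP, fun Q hQ => ?_⟩
  obtain ⟨f, hf, hfQ⟩ := hopt Q hQ
  obtain ⟨p, hp⟩ := hf.exists_length_le
  exact ⟨p, fun π => ⟨f π, hp π, hfQ π⟩⟩

/-! ### Proof systems and relations as tasks -/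

open Classical in
/-- The task that decides the relation `R` on codes of pairs. -/
noncomputable def relTask (R : Oracle → Str → Str → Prop) (bud : Polynomial ℕ)
    (h : ∀ O x y, DecidedBy (fun O => R O x y) O (bud.eval (pair x y).length)) : Task where
  fn O z := if ∃ x y, z = pair x y ∧ R O x y then [true] else []
  bud := bud
  len := 1
  length_le O z := by split_ifs <;> simp
  decided O z := by
    by_cases hz : ∃ x y, z = pair x y
    · obtain ⟨x, y, rfl⟩ := hz
      have : ∀ O, (∃ x' y', pair x y = pair x' y' ∧ R O x' y') ↔ R O x y := fun O =>
        ⟨fun ⟨x', y', he, hr⟩ => by obtain ⟨rfl, rfl⟩ := pair_inj.1 he; exact hr,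
          fun hr => ⟨x, y, rfl, hr⟩⟩
      simp only [this]
      exact (h O x y).map fun p => if p then [true] else []
    · have : ∀ O, ¬ ∃ x' y', z = pair x' y' ∧ R O x' y' :=
        fun O ⟨x', y', he, _⟩ => hz ⟨x', y', he⟩
      simp only [this, if_false]
      exact DecidedBy.const _

theorem relTask_iff {R : Oracle → Str → Str → Prop} {bud : Polynomial ℕ}
    {h : ∀ O x y, DecidedBy (fun O => R O x y) O (bud.eval (pair x y).length)} (O : Oracle)
    (x y : Str) : R O x y ↔ (relTask R bud h).fn O (pair x y) = [true] := by
  classical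
  have : (∃ x' y', pair x y = pair x' y' ∧ R O x' y') ↔ R O x y :=
    ⟨fun ⟨x', y', he, hr⟩ => by obtain ⟨rfl, rfl⟩ := pair_inj.1 he; exact hr,
      fun hr => ⟨x, y, rfl, hr⟩⟩
  simp only [relTask, this]
  split_ifs with hr <;> simp [hr]

/-- The constant function with value `s`. -/
noncomputable def constTask (s : Str) : Task where
  fn _ _ := s
  bud := 0
  len := (s.length : Polynomial ℕ)
  length_le _ _ := by simp
  decided _ _ := DecidedBy.const _

mutual

/-- The indices of the variables of a formula, in the order of their occurrence. -/
def Form.vars : Form → List ℕ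
  | Form.tru => []
  | Form.fls => []
  | Form.var i => [i]
  | Form.neg φ => Form.vars φ
  | Form.and φ ψ => Form.vars φ ++ Form.vars ψ
  | Form.or φ ψ => Form.vars φ ++ Form.vars ψ
  | Form.gate φs => Form.varsList φs

/-- The indices of the variables of a list of formulas. -/
def Form.varsList : List Form → List ℕ
  | [] => []
  | φ :: φs => Form.vars φ ++ Form.varsList φs

end

mutual

theorem Form.length_vars (φ : Form) : φ.vars.length ≤ φ.code.length := by
  match φ with
  | Form.tru => simp [Form.vars]
  | Form.fls => simp [Form.vars]
  | Form.var i => simp [Form.vars, Form.code]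
  | Form.neg φ =>
    have := Form.length_vars φ
    simp [Form.vars, Form.code]; omega
  | Form.and φ ψ =>
    have := Form.length_vars φ
    have := Form.length_vars ψ
    simp [Form.vars, Form.code]; omega
  | Form.or φ ψ =>
    have := Form.length_vars φ
    have := Form.length_vars ψ
    simp [Form.vars, Form.code]; omega
  | Form.gate φs =>
    have := Form.length_varsList φs
    simp [Form.vars, Form.code]; omega

theorem Form.length_varsList (φs : List Form) :
    (Form.varsList φs).length ≤ (Form.codeList φs).length := by
  match φs with
  | [] => simp [Form.varsList]
  | φ :: φs =>
    have := Form.length_vars φ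
    have := Form.length_varsList φs
    simp [Form.varsList, Form.codeList]; omega

end

mutual

theorem Form.eval_congr_vars (φ : Form) (O : Oracle) (v v' : ℕ → Bool)
    (h : ∀ i ∈ φ.vars, v i = v' i) : φ.eval O v = φ.eval O v' := by
  match φ with
  | Form.tru => simp [Form.eval]
  | Form.fls => simp [Form.eval]
  | Form.var i => simpa [Form.eval, Form.vars] using h
  | Form.neg φ =>
    simp only [Form.eval, Form.vars] at h ⊢
    rw [Form.eval_congr_vars φ O v v' h]
  | Form.and φ ψ =>
    simp only [Form.eval, Form.vars, List.mem_append] at h ⊢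
    rw [Form.eval_congr_vars φ O v v' fun i hi => h i (Or.inl hi),
      Form.eval_congr_vars ψ O v v' fun i hi => h i (Or.inr hi)]
  | Form.or φ ψ =>
    simp only [Form.eval, Form.vars, List.mem_append] at h ⊢
    rw [Form.eval_congr_vars φ O v v' fun i hi => h i (Or.inl hi),
      Form.eval_congr_vars ψ O v v' fun i hi => h i (Or.inr hi)]
  | Form.gate φs =>
    simp only [Form.eval, Form.vars] at h ⊢
    rw [Form.evalList_congr_vars φs O v v' h]

theorem Form.evalList_congr_vars (φs : List Form) (O : Oracle) (v v' : ℕ → Bool)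
    (h : ∀ i ∈ Form.varsList φs, v i = v' i) : Form.evalList O v φs = Form.evalList O v' φs := by
  match φs with
  | [] => simp [Form.evalList]
  | φ :: φs =>
    simp only [Form.evalList, Form.varsList, List.mem_append] at h ⊢
    rw [Form.eval_congr_vars φ O v v' fun i hi => h i (Or.inl hi),
      Form.evalList_congr_vars φs O v v' fun i hi => h i (Or.inr hi)]

end

/-- The assignment to the variables of `φ` given by the list `ρ` of their values. -/
def Form.assign (φ : Form) (ρ : Str) (i : ℕ) : Bool := ρ.getD (φ.vars.idxOf i) false

theorem Form.eval_assign (φ : Form) (O : Oracle) (v : ℕ → Bool) :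
    φ.eval O (φ.assign (φ.vars.map v)) = φ.eval O v := by
  refine φ.eval_congr_vars O _ _ fun i hi => ?_
  have hlt : φ.vars.idxOf i < φ.vars.length := List.idxOf_lt_length_of_mem hi
  simp [Form.assign, List.getD, hlt]

open Classical in
/-- The standard proof system for `SAT`: a proof of a formula is the pair of a satisfying assignment
and the formula. Other strings are proofs of the constant formula `tru`. -/
noncomputable def satProof (O : Oracle) (z : Str) : Str :=
  if h : ∃ p : Str × Form, z = pair p.1 p.2.code ∧ p.2.eval O (p.2.assign p.1) = true then
    h.choose.2.code
  else Form.tru.code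

theorem satProof_pair (O : Oracle) (ρ : Str) (φ : Form) : satProof O (pair ρ φ.code) =
    if φ.eval O (φ.assign ρ) = true then φ.code else Form.tru.code := by
  unfold satProof
  split_ifs with h h' h'
  · rw [← (pair_inj.1 h.choose_spec.1).2]
  · obtain ⟨⟨ρ', φ'⟩, h1, h2⟩ := h
    obtain ⟨rfl, h3⟩ := pair_inj.1 h1
    obtain rfl := Form.code_injective h3
    exact absurd h2 h'
  · exact absurd ⟨(ρ, φ), rfl, h'⟩ h
  · rfl

theorem satProof_of_not_pair {O : Oracle} {z : Str} (h : ¬ ∃ (ρ : Str) (φ : Form),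
    z = pair ρ φ.code) : satProof O z = Form.tru.code :=
  dif_neg fun ⟨p, hp, _⟩ => h ⟨p.1, p.2, hp⟩

theorem length_satProof (O : Oracle) (z : Str) : (satProof O z).length ≤ z.length + 3 := by
  by_cases hz : ∃ (ρ : Str) (φ : Form), z = pair ρ φ.code
  · obtain ⟨ρ, φ, rfl⟩ := hz
    rw [satProof_pair, length_pair]
    split_ifs
    · omega
    · simp [Form.code]
  · rw [satProof_of_not_pair hz]
    simp [Form.code]

theorem decidedBy_satProof (O : Oracle) (z : Str) :
    DecidedBy (fun O => satProof O z) O z.length := by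
  by_cases hz : ∃ (ρ : Str) (φ : Form), z = pair ρ φ.code
  · obtain ⟨ρ, φ, rfl⟩ := hz
    simp only [satProof_pair]
    refine ((φ.decidedBy_eval O (φ.assign ρ)).map
      (fun b => if b = true then φ.code else Form.tru.code)).mono ?_
    rw [length_pair]
    omega
  · simp only [satProof_of_not_pair hz]
    exact DecidedBy.const _

theorem tru_mem_SAT (O : Oracle) : Form.tru.code ∈ SAT O :=
  code_mem_SAT.2 ⟨fun _ => false, by simp [Form.eval]⟩

theorem tru_mem_TAUT (O : Oracle) : Form.tru.code ∈ TAUT O :=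
  code_mem_TAUT.2 fun _ => by simp [Form.eval]

theorem satProof_mem_SAT (O : Oracle) (z : Str) : satProof O z ∈ SAT O := by
  by_cases hz : ∃ (ρ : Str) (φ : Form), z = pair ρ φ.code
  · obtain ⟨ρ, φ, rfl⟩ := hz
    rw [satProof_pair]
    split_ifs with h
    · exact code_mem_SAT.2 ⟨_, h⟩
    · exact tru_mem_SAT O
  · rw [satProof_of_not_pair hz]
    exact tru_mem_SAT O

theorem exists_satProof {O : Oracle} {w : Str} (hw : w ∈ SAT O) :
    ∃ z : Str, z.length ≤ 3 * w.length + 2 ∧ satProof O z = w := by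
  obtain ⟨φ, rfl, v, hv⟩ := hw
  refine ⟨pair (φ.vars.map v) φ.code, ?_, ?_⟩
  · have := φ.length_vars
    rw [length_pair, List.length_map]
    omega
  · rw [satProof_pair, φ.eval_assign, if_pos hv]

/-- The standard proof system for `SAT`, as a task. -/
noncomputable def satTask : Task where
  fn := satProof
  bud := Polynomial.X
  len := Polynomial.X + 3
  length_le O z := by simpa using length_satProof O z
  decided O z := by simpa using decidedBy_satProof O z

/-- The task that decides whether `y` is a standard proof of the formula put out by `M` on `x`. -/
noncomputable def sameTask (M : Machine) : Task :=
  relTask (fun O x y => satProof O y = M.run O x) (Polynomial.X + M.2) fun O x y => by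
    refine ((decidedBy_satProof O y).bind (K := fun a O => a = M.run O x)
      ((M.decided O x).map _)).mono ?_
    have := eval_mono_nat M.2 (a := x.length) (b := (pair x y).length)
      (by rw [length_pair]; omega)
    have := length_pair x y
    simp only [Polynomial.eval_add, Polynomial.eval_X]
    omega

/-- `y` is a solution of `x` for the verifier selected by the first bit of `y`. -/
def SelectSol (V W : Verifier) (O : Oracle) (x : Str) : Str → Prop
  | [] => False
  | false :: y => W.Sol O x y
  | true :: y => V.Sol O x y

/-- The task that decides `SelectSol`. -/
noncomputable def selectTask (V W : Verifier) : Task :=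
  relTask (SelectSol V W) (V.time + W.time) fun O x y => by
    have h1 := eval_mono_nat V.time (a := x.length) (b := (pair x y).length)
      (by rw [length_pair]; omega)
    have h2 := eval_mono_nat W.time (a := x.length) (b := (pair x y).length)
      (by rw [length_pair]; omega)
    simp only [Polynomial.eval_add]
    match y with
    | [] => exact DecidedBy.const _
    | false :: y => exact (W.decided O x y).mono (by omega)
    | true :: y => exact (V.decided O x y).mono (by omega)

/-- The task that decides, on the code of a pair, whether the first component does not begin with
`b`. -/
noncomputable def headTask (b : Bool) : Task :=
  relTask (fun _ x _ => x.head? ≠ some b) 0 fun _ _ _ => DecidedBy.const _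

theorem inCoNP_head {S : Scheme} {G : Set Str} {i : S.ι} {b : Bool} (h : S.task i = headTask b) :
    InCoNP (S.build G) {x | x.head? = some b} := by
  refine ⟨0, fun x _ => x.head? ≠ some b, S.polyTimeRel_task i G fun x y => ?_, fun x => ?_⟩
  · rw [h]
    exact relTask_iff (R := fun _ x _ => x.head? ≠ some b) (S.build G) x y
  · constructor
    · exact fun hx => ⟨[], by simp, hx⟩
    · rintro ⟨y, -, hy⟩
      exact hy

/-- The strings that begin with the number `k` in unary. -/
def unary (k : ℕ) (y : Str) : Str := List.replicate k true ++ false :: y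

theorem unary_inj {k k' : ℕ} {y y' : Str} : unary k y = unary k' y' ↔ k = k' ∧ y = y' :=
  ⟨unary_append_inj, by rintro ⟨rfl, rfl⟩; rfl⟩

theorem length_unary (k : ℕ) (y : Str) : (unary k y).length = k + 1 + y.length := by
  simp [unary]; omega

theorem unary_append (k : ℕ) (x y : Str) : unary k x ++ y = unary k (x ++ y) := by
  simp [unary]

/-! ### The world where total search problems are easy -/

/-- The strings of `O` of length at most `n`. -/
def trunc (n : ℕ) (O : Oracle) : Oracle := {w | w ∈ O ∧ w.length ≤ n}

theorem agree_trunc (n : ℕ) (O : Oracle) : Agree n (trunc n O) O := fun _ hw =>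
  ⟨fun h => h.1, fun h => ⟨h, hw⟩⟩

theorem trunc_congr {n : ℕ} {O O' : Oracle} (h : Agree n O O') : trunc n O = trunc n O' := by
  ext w
  exact and_congr_left fun hw => h w hw

/-- The strings of `G` of length at most `log₂ L`. -/
def lowPart (L : ℕ) (G : Set Str) : Set Str := {u | u ∈ G ∧ 2 ^ u.length ≤ L}

/-- The lengths of any two elements of `G` are exponentially far apart. In particular there are no
two elements of the same length. -/
def Sparse (G : Set Str) : Prop :=
  ∀ u ∈ G, ∀ v ∈ G, u ≠ v → 2 ^ u.length ≤ v.length ∨ 2 ^ v.length ≤ u.length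

theorem Sparse.mono {G G' : Set Str} (h : Sparse G) (hG : G' ⊆ G) : Sparse G' :=
  fun u hu v hv => h u (hG hu) v (hG hv)

/-- A list of strings whose membership in `A` guarantees that `y` is a solution of `x`, or that it
is not. -/
noncomputable def Verifier.evidence (V : Verifier) (A : Oracle) (x y : Str) : List Str :=
  (V.decided A x y).choose

open Classical in
/-- A solution of `x` relative to `B`, with the help of an oracle `A` that is known and differs
little from `B`: if there is a solution relative to `A`, and `B` does not differ from `A` on the
evidence for it, then this is a solution relative to `B`. Otherwise any solution is taken. -/
noncomputable def Verifier.solve (V : Verifier) (A B : Oracle) (x : Str) : Str :=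
  if h : ∃ y, V.Sol A x y then
    if ∀ w ∈ V.evidence A x h.choose, w ∈ B ↔ w ∈ A then h.choose
    else if h' : ∃ y, V.Sol B x y then h'.choose else []
  else []

theorem Verifier.length_solve (V : Verifier) (A B : Oracle) (x : Str) :
    (V.solve A B x).length ≤ V.2.eval x.length := by
  unfold Verifier.solve
  split_ifs with h h1 h2
  · exact h.choose_spec.1
  · exact h2.choose_spec.1
  · simp
  · simp

theorem Verifier.sol_solve (V : Verifier) {A B : Oracle} {x : Str} (hA : ∃ y, V.Sol A x y)
    (hB : ∃ y, V.Sol B x y) : V.Sol B x (V.solve A B x) := by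
  unfold Verifier.solve
  rw [dif_pos hA]
  split_ifs with h1
  · have := (V.decided A x hA.choose).choose_spec.2 B h1
    exact (eq_iff_iff.1 this).2 hA.choose_spec
  · exact hB.choose_spec

/-- The budget of the special predicate for `V` with the additional polynomial `p`. -/
noncomputable def solveBudget (k : Verifier × Polynomial ℕ) (x : Str) : ℕ :=
  (k.1.time + k.2).eval x.length

/-- The solution that is written down in the oracle. -/
noncomputable def solveSpecial (k : Verifier × Polynomial ℕ) (F : Set Str → Oracle) (G : Set Str)
    (x : Str) : Str :=
  k.1.solve (trunc (solveBudget k x) (F (lowPart (solveBudget k x) G)))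
    (trunc (solveBudget k x) (F G)) x

theorem Agree.lowPart {l : ℕ} {G G' : Set Str} (h : Agree l G G') (L : ℕ) :
    Agree l (lowPart L G) (lowPart L G') := fun u hu => and_congr_left fun _ => h u hu

/-- The proof system that has for every `n` the short proof `false :: x`, where `n = x.length`, of
the formula which says that the oracle has no element `false :: unary k y` with `y.length = n`. All
other tautologies have the proofs that they have in the proof system computed by `M`. -/
noncomputable def emptyProof (M : Machine) (k : ℕ) (O : Oracle) : Str → Str
  | [] => Form.tru.code
  | false :: x => (Form.neg (gateForm (false :: unary k []) x.length)).code
  | true :: z => M.run O z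

/-- `emptyProof`, as a task. -/
noncomputable def emptyTask (M : Machine) (k : ℕ) : Task where
  fn := emptyProof M k
  bud := M.2
  len := (15 + 3 * (k : Polynomial ℕ) + Polynomial.X * (2 * Polynomial.X + 5)) +
    (Polynomial.X + M.2)
  length_le O z := by
    simp only [Polynomial.eval_add, Polynomial.eval_mul, Polynomial.eval_X, Polynomial.eval_ofNat,
      Polynomial.eval_natCast, Nat.cast_id]
    match z with
    | [] => simp [emptyProof, Form.code]; omega
    | false :: x =>
      have := length_code_gateForm (false :: unary k []) x.length
      have h2 : x.length * (2 * x.length + 5) ≤ (x.length + 1) * (2 * (x.length + 1) + 5) := by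
        gcongr <;> omega
      simp only [List.length_cons, length_unary, List.length_nil] at this
      simp only [emptyProof, Form.code, List.length_append, List.length_cons, List.length_nil]
      omega
    | true :: z =>
      have := M.length_run O z
      have := eval_mono_nat M.2 (a := z.length) (b := z.length + 1) (by omega)
      simp only [emptyProof, List.length_cons]
      omega
  decided O z := by
    match z with
    | [] => exact DecidedBy.const _
    | false :: x => exact DecidedBy.const _
    | true :: z =>
      exact (M.decided O z).mono (eval_mono_nat _ (by simp))

/-- The tasks of the first world. -/
def easyTasks : Set Task :=
  {constTask [true], satTask, headTask false, headTask true} ∪ (Set.range sameTask ∪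
    (Set.range (fun p : Verifier × Verifier => selectTask p.1 p.2) ∪
      Set.range fun p : Machine × ℕ => emptyTask p.1 p.2))

theorem countable_easyTasks : easyTasks.Countable :=
  (Set.toFinite _).countable.union ((Set.countable_range _).union
    ((Set.countable_range _).union (Set.countable_range _)))

/-- The oracles of the first world. -/
noncomputable def easyScheme : Scheme where
  ι := easyTasks
  κ := Verifier × Polynomial ℕ
  encι := countable_easyTasks.toEncodable
  encκ := Encodable.ofCountable _
  task := Subtype.val
  sp k F G l x := dictate (solveSpecial k F G x) (solveBudget k x) l = true
  sp_congr k F F' G G' l x hF hG := by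
    rw [Scheme.dictate_congr fun hl => ?_]
    unfold solveSpecial
    rw [trunc_congr ((hF _ _ (hG.lowPart _)).mono hl), trunc_congr ((hF _ _ hG).mono hl)]

/-- The promise that no element of the generic set begins with the number `k`. -/
def NoRow (k : ℕ) : Set (Set Str) := {G | ∀ y, unary k y ∉ G}

theorem easy_mem_special {k : Verifier × Polynomial ℕ} {G : Set Str} {l : ℕ} {x : Str} :
    taskWord true (easyScheme.si k) l x ∈ easyScheme.build G ↔
      dictate (solveSpecial k easyScheme.build G x) (solveBudget k x) l = true :=
  easyScheme.mem_build_special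

theorem easy_local {M : ℕ} {G : Set Str} (hG : Sparse G) (w : Str) (hw : w.length ≤ M) :
    easyScheme.Local {G' | Sparse G' ∧ ∀ u : Str, 2 ^ u.length ≤ M → (u ∈ G' ↔ u ∈ G)} G w := by
  refine easyScheme.local_of_special (fun (k : Verifier × Polynomial ℕ) l x hM ih => ?_) w hw
  have hlen := length_taskWord true (easyScheme.si k) l x
  set L := solveBudget k x with hL
  by_cases hLl : L ≤ l
  swap
  · refine ⟨∅, by simp, fun G' _ _ => ?_⟩
    rw [easy_mem_special, easy_mem_special, Scheme.dictate_congr fun h => absurd h hLl]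
  -- It suffices that the solution written down is the same.
  suffices h : ∃ E : Finset Str, E.card ≤ l + 1 ∧ ∀ G', Sparse G' →
      (∀ u : Str, 2 ^ u.length ≤ M → (u ∈ G' ↔ u ∈ G)) → (∀ u ∈ E, u ∈ G' ↔ u ∈ G) →
      solveSpecial k easyScheme.build G' x = solveSpecial k easyScheme.build G x by
    obtain ⟨E, hE, h⟩ := h
    refine ⟨E, by omega, fun G' hG' hu => ?_⟩
    rw [easy_mem_special, easy_mem_special, h G' hG'.1 hG'.2 hu]
  have hlow : ∀ G' : Set Str, (∀ u : Str, 2 ^ u.length ≤ M → (u ∈ G' ↔ u ∈ G)) →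
      lowPart L G' = lowPart L G := by
    intro G' hG'
    ext u
    exact and_congr_left fun hu => hG' u (by omega)
  set A := trunc L (easyScheme.build (lowPart L G)) with hA
  have htime : k.1.time.eval x.length ≤ L := by
    rw [hL, solveBudget, Polynomial.eval_add]
    omega
  by_cases hsol : ∃ y, k.1.Sol A x y
  swap
  · refine ⟨∅, by simp, fun G' _ hG' _ => ?_⟩
    unfold solveSpecial
    rw [← hL, hlow G' hG', ← hA]
    unfold Verifier.solve
    rw [dif_neg hsol, dif_neg hsol]
  set D := k.1.evidence A x hsol.choose with hD
  have hDlen : (D.map List.length).sum ≤ L :=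
    (k.1.decided A x hsol.choose).choose_spec.1.trans htime
  have hDl : ∀ w ∈ D, w.length ≤ L := fun w hw =>
    (List.single_le_sum (by simp) _ (List.mem_map_of_mem hw)).trans hDlen
  by_cases hag : ∀ w ∈ D, w ∈ trunc L (easyScheme.build G) ↔ w ∈ A
  · -- The evidence is right; it is decided by few bits.
    obtain ⟨E, hE, h⟩ := Scheme.Local.list easyScheme
      (C := {G' | Sparse G' ∧ ∀ u : Str, 2 ^ u.length ≤ M → (u ∈ G' ↔ u ∈ G)}) (G := G) (D := D)
      fun w hw => ih w ((hDl w hw).trans hLl)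
    refine ⟨E, by omega, fun G' hGs hG' hu => ?_⟩
    have hag' : ∀ w ∈ D, w ∈ trunc L (easyScheme.build G') ↔ w ∈ A := fun w hw =>
      (and_congr_left fun _ => h G' ⟨hGs, hG'⟩ hu w hw).trans (hag w hw)
    unfold solveSpecial
    rw [← hL, hlow G' hG', ← hA]
    unfold Verifier.solve
    rw [dif_pos hsol, dif_pos hsol, ← hD, if_pos hag', if_pos hag]
  · -- The evidence is wrong; hence there is an element of `G` above the low part, and this element
    -- determines `G` up to length `L`.
    obtain ⟨z, hzG, hzL, hz⟩ : ∃ z ∈ G, z.length ≤ L ∧ L < 2 ^ z.length := by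
      by_contra hno
      push Not at hno
      refine hag fun w hw => ?_
      have : Agree L G (lowPart L G) := fun u hu =>
        ⟨fun h => ⟨h, hno u h hu⟩, fun h => h.1⟩
      rw [hA, trunc_congr (easyScheme.build_congr this)]
    refine ⟨{z}, by simp, fun G' hGs hG' hu => ?_⟩
    have hzG' : z ∈ G' := (hu z (by simp)).2 hzG
    have hone : ∀ H : Set Str, Sparse H → z ∈ H → ∀ v ∈ H, v.length ≤ L → L < 2 ^ v.length →
        v = z := by
      intro H hH hzH v hv hvL hvL'
      by_contra hne
      rcases hH v hv z hzH hne with h | h <;> omega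
    have hagree : Agree L G' G := by
      intro v hv
      by_cases hvL : 2 ^ v.length ≤ L
      · exact hG' v (by omega)
      · constructor
        · intro hvG
          rw [hone G' hGs hzG' v hvG hv (by omega)]
          exact hzG
        · intro hvG
          rw [hone G hG hzG v hvG hv (by omega)]
          exact hzG'
    unfold solveSpecial
    rw [← hL, hlow G' hG', trunc_congr (easyScheme.build_congr hagree)]

theorem closed_sparse : ClosedFamily {G | Sparse G} := by
  intro G hG u hu v hv hne
  obtain ⟨G', hG', hag⟩ := hG (max u.length v.length)
  exact hG' u ((hag u (le_max_left _ _)).1 hu) v ((hag v (le_max_right _ _)).1 hv) hne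

theorem closed_noRow (k : ℕ) : ClosedFamily (NoRow k) := by
  intro G hG y hy
  obtain ⟨G', hG', hag⟩ := hG (unary k y).length
  exact hG' y ((hag _ le_rfl).1 hy)

/-- No element of `G` has a length between `a` and `2 ^ 2 ^ (a + 1)`. -/
def HasGap (a : ℕ) (G : Set Str) : Prop :=
  ∀ u ∈ G, u.length < a ∨ 2 ^ 2 ^ (a + 1) < u.length

/-- The machine `M` puts out some string that is not a tautology. -/
def UnsoundTAUT (M : Machine) (O : Oracle) : Prop := ∃ π, M.run O π ∉ TAUT O

theorem openProp_mem_of_run {C : Oracle → Set Str}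
    (hC : ∀ O O' w, Agree w.length O O' → (w ∈ C O ↔ w ∈ C O')) (M : Machine) :
    OpenProp fun O => ∃ π, M.run O π ∉ C O := by
  refine OpenProp.exists_ fun π => OpenProp.of_agree (π.length + M.2.eval π.length) ?_
  intro O O' h hO
  have h1 : M.run O π = M.run O' π :=
    (M.decided O' π).eq_of_agree fun w hw => h w (by omega)
  rw [← h1, ← hC O O' _ (h.mono (M.length_run O π))]
  exact hO

theorem openProp_unsoundTAUT (M : Machine) : OpenProp (UnsoundTAUT M) :=
  openProp_mem_of_run (fun _ _ _ h => mem_TAUT_congr h) M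

/-- The generic set of the first world. -/
theorem exists_easy_generic : ∃ G : Set Str, Sparse G ∧
    (∀ V : Verifier, V.Total (easyScheme.build G) → ∃ m, ∀ H ⊆ G, Agree m G H →
      V.Total (easyScheme.build H)) ∧
    (∀ M : Machine, (∀ π, M.run (easyScheme.build G) π ∈ TAUT (easyScheme.build G)) →
      ∃ k, G ∈ NoRow k ∧ ∀ y : Str, ∀ H, Sparse H → H = insert (unary k y) G →
        ∀ π, M.run (easyScheme.build H) π ∈ TAUT (easyScheme.build H)) ∧
    ∀ n, ∃ a, n ≤ a ∧ HasGap a G := by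
  let E : Verifier ⊕ Machine ⊕ ℕ → Set Str → Prop := fun e G => match e with
    | Sum.inl V => ¬ V.Total (easyScheme.build G)
    | Sum.inr (Sum.inl M) => UnsoundTAUT M (easyScheme.build G)
    | Sum.inr (Sum.inr n) => ∃ a, n ≤ a ∧ HasGap a G
  have hfresh : ∀ (I : Finset ℕ) (m : ℕ), ∀ G ∈ {G | Sparse G}, (∀ i ∈ I, G ∈ NoRow i) →
      ∃ k, k ∉ I ∧ m < k ∧ ∃ G' ∈ {G | Sparse G}, (∀ i ∈ I, G' ∈ NoRow i) ∧ G' ∈ NoRow k ∧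
        Agree m G G' := by
    intro I m G hG hI
    have hk : m + 1 + I.sup id ∉ I := fun hmem => by
      have := Finset.le_sup (f := id) hmem
      simp only [id] at this
      omega
    refine ⟨m + 1 + I.sup id, hk, by omega, {u | u ∈ G ∧ u.length ≤ m},
      Sparse.mono hG fun u hu => hu.1, fun i hi y hy => hI i hi y hy.1, fun y hy => ?_,
      fun u hu => ⟨fun h => ⟨h, hu⟩, fun h => h.1⟩⟩
    have := hy.2
    rw [length_unary] at this
    omega
  have hopen : ∀ e, OpenProp (E e) := by
    rintro (V | M | n)
    · exact V.openProp_not_total.build easyScheme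
    · exact (openProp_unsoundTAUT M).build easyScheme
    · refine OpenProp.exists_ fun a => OpenProp.of_agree (2 ^ 2 ^ (a + 1)) ?_
      rintro G G' hag ⟨hn, hG⟩
      refine ⟨hn, fun u hu => ?_⟩
      by_contra hno
      push Not at hno
      rcases hG u ((hag u hno.2).2 hu) with h | h <;> omega
  obtain ⟨G, hG, h⟩ := exists_generic (B := {G | Sparse G}) (C := NoRow) ⟨∅, by simp [Sparse]⟩
    closed_sparse closed_noRow hfresh E hopen
  refine ⟨G, hG, fun V hV => ?_, fun M hM => ?_, fun n => ?_⟩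
  · obtain ⟨I, m, k, -, -, hI, -, h | h⟩ := h (Sum.inl V)
    · exact absurd hV h
    · refine ⟨m, fun H hH hag => not_not.1 (h H (hG.mono hH) (fun i hi y hy => ?_) hag)⟩
      exact hI i hi y (hH hy)
  · obtain ⟨I, m, k, hk, hmk, hI, hGk, h | h⟩ := h (Sum.inr (Sum.inl M))
    · obtain ⟨π, hπ⟩ := h
      exact absurd (hM π) hπ
    · refine ⟨k, hGk, fun y H hH hHG π => ?_⟩
      by_contra hπ
      refine h H hH (fun i hi y' hy' => ?_) (fun u hu => ?_) ⟨π, hπ⟩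
      · rw [hHG, Set.mem_insert_iff, unary_inj] at hy'
        rcases hy' with ⟨rfl, -⟩ | hy'
        exacts [hk hi, hI i hi y' hy']
      · rw [hHG, Set.mem_insert_iff]
        refine ⟨Or.inr, fun h => h.resolve_left ?_⟩
        rintro rfl
        rw [length_unary] at hu
        omega
  · obtain ⟨I, m, k, -, -, hI, -, h | h⟩ := h (Sum.inr (Sum.inr n))
    · exact h
    · -- Cutting `G` off makes a gap.
      refine absurd ⟨max n (m + 1), le_max_left _ _, fun u hu => Or.inl ?_⟩
        (h {u | u ∈ G ∧ u.length ≤ m} (hG.mono fun u hu => hu.1) (fun i hi y hy => hI i hi y hy.1)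
          fun u hu => ⟨fun h => ⟨h, hu⟩, fun h => h.1⟩)
      have := hu.2
      omega

/-! ### Consequences in the first world -/

theorem eventually_eval_lt_two_pow (p : Polynomial ℕ) : ∃ N, ∀ n ≥ N, p.eval n < 2 ^ n := by
  have key : (fun n : ℕ => ((p.eval n : ℕ) : ℝ)) =o[Filter.atTop] fun n : ℕ => (2 : ℝ) ^ n := by
    induction p using Polynomial.induction_on' with
    | add p q hp hq =>
      simpa only [Polynomial.eval_add, Nat.cast_add] using hp.add hq
    | monomial d c =>
      simp only [Polynomial.eval_monomial, Nat.cast_mul, Nat.cast_pow]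
      exact (isLittleO_pow_const_const_pow_of_one_lt d one_lt_two).const_mul_left _
  obtain ⟨N, hN⟩ := Filter.eventually_atTop.1 (key.bound (by norm_num : (0 : ℝ) < 1 / 2))
  refine ⟨N, fun n hn => ?_⟩
  have h := hN n hn
  rw [Real.norm_of_nonneg (by positivity), Real.norm_of_nonneg (by positivity)] at h
  have h2 : (0 : ℝ) < 2 ^ n := by positivity
  have h3 : ((p.eval n : ℕ) : ℝ) < ((2 ^ n : ℕ) : ℝ) := by
    push_cast
    linarith
  exact_mod_cast h3

/-- Fewer than `2 ^ n` strings cannot exhaust the images of all strings of length `n`. -/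
theorem exists_notMem_of_card_lt {α : Type*} {E : Finset α} {n : ℕ} (hE : E.card < 2 ^ n)
    {f : Str → α} (hf : Function.Injective f) : ∃ y : Str, y.length = n ∧ f y ∉ E := by
  classical
  by_contra hno
  push Not at hno
  have hinj : Function.Injective fun v : Fin n → Bool => f (List.ofFn v) :=
    hf.comp List.ofFn_injective
  have : Finset.univ.image (fun v : Fin n → Bool => f (List.ofFn v)) ⊆ E := by
    intro z hz
    obtain ⟨v, -, rfl⟩ := Finset.mem_image.1 hz
    exact hno _ (by simp)
  have := Finset.card_le_card this
  rw [Finset.card_image_of_injective _ hinj] at this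
  simp at this
  omega

theorem inCoNP_exists_verifier {O : Oracle} {U : Set Str} (h : InCoNP O U) :
    ∃ V : Verifier, ∀ x, x ∉ U ↔ ∃ y, V.Sol O x y :=
  InNP.exists_verifier h

/-- Every total search problem is solved in polynomial time, even with any second oracle at
hand. -/
def EasySearch (O : Oracle) : Prop :=
  ∀ V : Verifier, V.Total O → ∃ f : Str → Str, (∀ x, V.Sol O x (f x)) ∧ PolyTimeFun O f ∧
    ∃ (P : Prog) (p : Polynomial ℕ), ∀ (g : Str → Str) (x : Str),
      HaltsWith P (joinAnswer O g) x (p.eval x.length) (f x)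

theorem easySearch_of_generic {G : Set Str}
    (hG : ∀ V : Verifier, V.Total (easyScheme.build G) → ∃ m, ∀ H ⊆ G, Agree m G H →
      V.Total (easyScheme.build H)) : EasySearch (easyScheme.build G) := by
  intro V hV
  obtain ⟨m, hm⟩ := hG V hV
  -- The budget is chosen so large that the low part of `G` agrees with `G` up to length `m`.
  let k : Verifier × Polynomial ℕ := (V, ((2 ^ m : ℕ) : Polynomial ℕ))
  have hlen : ∀ x, (solveSpecial k easyScheme.build G x).length ≤ V.2.eval x.length := fun x =>
    V.length_solve _ _ x
  have hspec : ∀ x l, taskWord true (easyScheme.si k) l x ∈ easyScheme.build G ↔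
      dictate (solveSpecial k easyScheme.build G x) ((k.1.time + k.2).eval x.length) l = true :=
    fun x l => easy_mem_special
  refine ⟨solveSpecial k easyScheme.build G, fun x => ?_, polyTimeFun_of_dictate hlen hspec,
    joinHalts_of_dictate hlen hspec⟩
  have hbud : solveBudget k x = V.time.eval x.length + 2 ^ m := by
    rw [solveBudget, Polynomial.eval_add, Polynomial.eval_natCast, Nat.cast_id]
  have htime : V.time.eval x.length ≤ solveBudget k x := by
    rw [hbud]
    exact Nat.le_add_right _ _
  have hlow : V.Total (easyScheme.build (lowPart (solveBudget k x) G)) := by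
    refine hm _ (fun u hu => hu.1) fun u hu => ⟨fun h => ⟨h, ?_⟩, fun h => h.1⟩
    refine (Nat.pow_le_pow_right two_pos hu).trans ?_
    rw [hbud]
    exact Nat.le_add_left _ _
  have htr : ∀ (O : Oracle) (y : Str), V.Sol (trunc (solveBudget k x) O) x y ↔ V.Sol O x y :=
    fun O y => V.sol_congr ((agree_trunc _ O).mono htime) y
  refine (htr _ _).1 (V.sol_solve ?_ ?_)
  · exact (hlow x).imp fun y => (htr _ y).2
  · exact (hV x).imp fun y => (htr _ y).2

theorem exists_easyTask {t : Task} (ht : t ∈ easyTasks) : ∃ i, easyScheme.task i = t :=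
  ⟨⟨t, ht⟩, rfl⟩

theorem hasPOptimal_SAT_of_easySearch {G : Set Str} (h : EasySearch (easyScheme.build G)) :
    HasPOptimal (easyScheme.build G) (SAT (easyScheme.build G)) := by
  obtain ⟨i, hi⟩ := exists_easyTask (t := satTask) (by simp [easyTasks])
  refine ⟨satProof (easyScheme.build G), ⟨?_, ?_⟩, fun Q hQ => ?_⟩
  · have := easyScheme.polyTimeFun_task i G
    rwa [hi] at this
  · ext w
    constructor
    · rintro ⟨z, rfl⟩
      exact satProof_mem_SAT _ z
    · intro hw
      obtain ⟨z, -, hz⟩ := exists_satProof hw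
      exact ⟨z, hz⟩
  · obtain ⟨M, hM⟩ := hQ.1.exists_machine
    obtain ⟨j, hj⟩ := exists_easyTask (t := sameTask M)
      (Or.inr (Or.inl ⟨M, rfl⟩))
    have hrel : PolyTimeRel (easyScheme.build G) fun π y =>
        satProof (easyScheme.build G) y = M.run (easyScheme.build G) π :=
      easyScheme.polyTimeRel_task j G fun π y => by
        rw [hj]
        exact relTask_iff (R := fun O x y => satProof O y = M.run O x) _ π y
    obtain ⟨V, hV⟩ := hrel.exists_verifier (3 * (Polynomial.X + M.2) + 2)
    obtain ⟨f, hf, hfp, -⟩ := h V fun π => by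
      have hmem : M.run (easyScheme.build G) π ∈ SAT (easyScheme.build G) := by
        rw [hM, ← hQ.2]
        exact ⟨π, rfl⟩
      obtain ⟨z, hz, hz'⟩ := exists_satProof hmem
      refine ⟨z, (hV π z).2 ⟨?_, hz'⟩⟩
      have := M.length_run (easyScheme.build G) π
      simp only [Polynomial.eval_add, Polynomial.eval_mul, Polynomial.eval_X,
        Polynomial.eval_ofNat]
      omega
    exact ⟨f, hfp, fun π => by rw [((hV π _).1 (hf π)).2, hM]⟩

theorem hasCompleteTFNP_of_easySearch {G : Set Str} (h : EasySearch (easyScheme.build G)) :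
    HasCompleteTFNP (easyScheme.build G) := by
  obtain ⟨i, hi⟩ := exists_easyTask (t := constTask [true]) (by simp [easyTasks])
  refine ⟨⟨0, fun _ _ => True, easyScheme.polyTimeRel_task i G fun x y => ?_,
    fun x => ⟨[], by simp⟩⟩, fun T => ?_⟩
  · rw [hi]
    simp [constTask]
  · obtain ⟨V, hV, htot⟩ := T.exists_verifier
    obtain ⟨f, hf, -, P, p, hP⟩ := h V htot
    exact ⟨P, p, fun g _ x => ⟨f x, (hV x _).1 (hf x), hP g x⟩⟩

theorem hasCompleteDisjCoNP_of_easySearch {G : Set Str} (h : EasySearch (easyScheme.build G)) :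
    HasCompleteDisjCoNP (easyScheme.build G) := by
  obtain ⟨i, hi⟩ := exists_easyTask (t := headTask false) (by simp [easyTasks])
  obtain ⟨j, hj⟩ := exists_easyTask (t := headTask true) (by simp [easyTasks])
  refine ⟨{x | x.head? = some false}, {x | x.head? = some true},
    ⟨inCoNP_head hi, inCoNP_head hj, ?_⟩, fun A B hAB => ?_⟩
  · ext x
    simp only [Set.mem_inter_iff, Set.mem_ofPred_eq, Set.mem_empty_iff_false, iff_false]
    rintro ⟨h1, h2⟩
    rw [h1] at h2
    simp at h2
  · obtain ⟨hA, hB, hdisj⟩ := hAB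
    obtain ⟨V, hV⟩ := inCoNP_exists_verifier hA
    obtain ⟨W, hW⟩ := inCoNP_exists_verifier hB
    obtain ⟨l, hl⟩ := exists_easyTask (t := selectTask V W)
      (Or.inr (Or.inr (Or.inl ⟨(V, W), rfl⟩)))
    have hrel : PolyTimeRel (easyScheme.build G) (SelectSol V W (easyScheme.build G)) :=
      easyScheme.polyTimeRel_task l G fun π y => by
        rw [hl]
        exact relTask_iff (R := SelectSol V W) _ π y
    obtain ⟨Z, hZ⟩ := hrel.exists_verifier (V.2 + W.2 + 1)
    obtain ⟨f, hf, hfp, -⟩ := h Z fun x => by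
      have hx : x ∉ A ∨ x ∉ B := by
        by_contra hno
        push Not at hno
        have : x ∈ A ∩ B := hno
        rw [hdisj] at this
        exact this
      simp only [Polynomial.eval_add, Polynomial.eval_one] at hZ
      rcases hx with hx | hx
      · obtain ⟨y, hy⟩ := (hV x).1 hx
        refine ⟨true :: y, (hZ x _).2 ⟨?_, hy⟩⟩
        have := hy.1
        simp only [List.length_cons]
        omega
      · obtain ⟨y, hy⟩ := (hW x).1 hx
        refine ⟨false :: y, (hZ x _).2 ⟨?_, hy⟩⟩
        have := hy.1
        simp only [List.length_cons]
        omega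
    refine ⟨f, hfp, fun x hx => ?_, fun x hx => ?_⟩
    · have hs := ((hZ x _).1 (hf x)).2
      show (f x).head? = some false
      match f x, hs with
      | false :: y, _ => rfl
      | true :: y, hs => exact absurd hx ((hV x).2 ⟨y, hs⟩)
    · have hs := ((hZ x _).1 (hf x)).2
      show (f x).head? = some true
      match f x, hs with
      | true :: y, _ => rfl
      | false :: y, hs => exact absurd hx ((hW x).2 ⟨y, hs⟩)

theorem emptyForm_mem_TAUT {S : Scheme} {G : Set Str} {k n : ℕ} :
    (Form.neg (gateForm (false :: unary k []) n)).code ∈ TAUT (S.build G) ↔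
      ∀ y : Str, y.length = n → unary k y ∉ G := by
  have h : (∃ v, (gateForm (false :: unary k []) n).eval (S.build G) v = true) ↔
      ∃ y : Str, y.length = n ∧ unary k y ∈ G := by
    rw [exists_eval_gateForm]
    simp only [List.cons_append, unary_append, List.nil_append, S.mem_build_gen]
  rw [code_mem_TAUT, ← not_iff_not]
  push Not
  rw [← h]
  simp [Form.eval]

theorem not_hasNonuniformPOptimal_of_generic {G : Set Str} (hG : Sparse G)
    (hsound : ∀ M : Machine, (∀ π, M.run (easyScheme.build G) π ∈ TAUT (easyScheme.build G)) →
      ∃ k, G ∈ NoRow k ∧ ∀ y : Str, ∀ H, Sparse H → H = insert (unary k y) G →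
        ∀ π, M.run (easyScheme.build H) π ∈ TAUT (easyScheme.build H))
    (hgap : ∀ n, ∃ a, n ≤ a ∧ HasGap a G) :
    ¬ HasNonuniformPOptimal (easyScheme.build G) (TAUT (easyScheme.build G)) := by
  rintro ⟨P, ⟨hP, hrange⟩, hopt⟩
  obtain ⟨M, hM⟩ := hP.exists_machine
  obtain ⟨k, hk, hsound⟩ := hsound M fun π => by rw [hM, ← hrange]; exact ⟨π, rfl⟩
  obtain ⟨i, hi⟩ := exists_easyTask (t := emptyTask M k)
    (Or.inr (Or.inr (Or.inr ⟨(M, k), rfl⟩)))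
  have hQ : IsProofSystem (easyScheme.build G) (TAUT (easyScheme.build G))
      (emptyProof M k (easyScheme.build G)) := by
    constructor
    · have := easyScheme.polyTimeFun_task i G
      rwa [hi] at this
    · ext w
      constructor
      · rintro ⟨z, rfl⟩
        match z with
        | [] => exact tru_mem_TAUT _
        | false :: x => exact emptyForm_mem_TAUT.2 fun y _ => hk y
        | true :: z =>
          show M.run _ z ∈ _
          rw [hM, ← hrange]
          exact ⟨z, rfl⟩
      · intro hw
        rw [← hrange] at hw
        obtain ⟨z, rfl⟩ := hw
        exact ⟨true :: z, hM z⟩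
  obtain ⟨h, hh⟩ := hopt _ hQ
  obtain ⟨N, hN⟩ := eventually_eval_lt_two_pow (M.2.comp (h.comp (Polynomial.X + 1)))
  obtain ⟨a, ha, hgap⟩ := hgap (max N (k + 1))
  have ha2 : a < 2 ^ a := Nat.lt_two_pow_self
  -- All other elements of `G` are far shorter or far longer than the strings `unary k y` with
  -- `y.length = 2 ^ a`.
  set n := 2 ^ a with hn
  obtain ⟨π, hπ, hPπ⟩ := hh (false :: List.replicate n true)
  have htime : M.2.eval π.length < 2 ^ n := by
    have h1 := hN n (by omega)
    simp only [Polynomial.eval_comp, Polynomial.eval_add, Polynomial.eval_X,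
      Polynomial.eval_one] at h1
    refine lt_of_le_of_lt (eval_mono_nat _ hπ) ?_
    simpa using h1
  obtain ⟨E, hE, hdec⟩ := Scheme.Local.decided easyScheme (M.decided (easyScheme.build G) π)
    fun w hw => easy_local hG w hw
  obtain ⟨y, hy, hyE⟩ := exists_notMem_of_card_lt (f := unary k) (lt_of_le_of_lt hE htime)
    fun y y' h => (unary_inj.1 h).2
  have hz : (unary k y).length = k + 1 + n := by rw [length_unary, hy]
  have hsparse : Sparse (insert (unary k y) G) := by
    have key : ∀ u ∈ G, 2 ^ u.length ≤ (unary k y).length ∨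
        2 ^ (unary k y).length ≤ u.length := by
      intro u hu
      rcases hgap u hu with h | h
      · left
        have := Nat.pow_le_pow_right two_pos h.le
        omega
      · right
        refine le_trans (Nat.pow_le_pow_right two_pos ?_) h.le
        rw [hz, pow_succ]
        omega
    rintro u (rfl | hu) v (rfl | hv) hne
    · exact absurd rfl hne
    · exact (key v hv).symm
    · exact key u hu
    · exact hG u hu v hv hne
  have hrun := hdec (insert (unary k y) G) ⟨hsparse, fun u hu => ?_⟩ fun u hu => ?_
  · have hmem := hsound y _ hsparse rfl π
    rw [hrun, hM, hPπ] at hmem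
    refine emptyForm_mem_TAUT.1 hmem y ?_ (Set.mem_insert _ _)
    simp [hy]
  · rw [Set.mem_insert_iff]
    refine ⟨fun h => h.resolve_left ?_, Or.inr⟩
    rintro rfl
    have : 2 ^ n ≤ 2 ^ (unary k y).length := Nat.pow_le_pow_right two_pos (by omega)
    omega
  · rw [Set.mem_insert_iff]
    refine ⟨fun h => h.resolve_left ?_, Or.inr⟩
    rintro rfl
    exact hyE hu

/-- There is an oracle relative to which total search problems are easy, but there is no optimal
proof system for `TAUT`. -/
theorem exists_easy_world : ∃ O : Oracle, ¬ HasNonuniformPOptimal O (TAUT O) ∧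
    HasPOptimal O (SAT O) ∧ HasCompleteTFNP O ∧ HasCompleteDisjCoNP O := by
  obtain ⟨G, hG, htotal, hsound, hgap⟩ := exists_easy_generic
  have h := easySearch_of_generic htotal
  exact ⟨easyScheme.build G, not_hasNonuniformPOptimal_of_generic hG hsound hgap,
    hasPOptimal_SAT_of_easySearch h, hasCompleteTFNP_of_easySearch h,
    hasCompleteDisjCoNP_of_easySearch h⟩

/-! ### The world with a p-optimal proof system for `TAUT` -/

/-- The number of a clocked machine. -/
noncomputable def Machine.num (M : Machine) : ℕ := (Encodable.ofCountable Machine).encode M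

theorem Machine.num_inj {M M' : Machine} : M.num = M'.num ↔ M = M' :=
  (@Encodable.encode_injective _ (Encodable.ofCountable Machine)).eq_iff

/-- The number `l` pays for running `M` on `π` and for the length of the output. -/
def Machine.Cheap (M : Machine) (l : ℕ) (π : Str) : Prop :=
  2 * (π.length + M.2.eval π.length) ≤ l

/-- The proof of `M.run O π` in the p-optimal proof system. -/
noncomputable def optCode (M : Machine) (l : ℕ) (π : Str) : Str := unary M.num (unary l π)

theorem optCode_inj {M M' : Machine} {l l' : ℕ} {π π' : Str} :
    optCode M l π = optCode M' l' π' ↔ M = M' ∧ l = l' ∧ π = π' := by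
  simp only [optCode, unary_inj, Machine.num_inj]

open Classical in
/-- The p-optimal proof system for `TAUT`: the output of `M` on `π` is taken if, according to the
oracle, `M` puts out only tautologies on all inputs which are cheap for the same number `l`. -/
noncomputable def optProof (O : Oracle) (z : Str) : Str :=
  if h : ∃ p : Machine × ℕ × Str, z = optCode p.1 p.2.1 p.2.2 ∧ p.1.Cheap p.2.1 p.2.2 then
    if memBit O (taskWord true h.choose.1.num h.choose.2.1 []) = true then Form.tru.code
    else h.choose.1.run O h.choose.2.2
  else Form.tru.code

theorem optProof_optCode {M : Machine} {l : ℕ} {π : Str} (hc : M.Cheap l π) (O : Oracle) :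
    optProof O (optCode M l π) =
      if memBit O (taskWord true M.num l []) = true then Form.tru.code else M.run O π := by
  have h : ∃ p : Machine × ℕ × Str, optCode M l π = optCode p.1 p.2.1 p.2.2 ∧
      p.1.Cheap p.2.1 p.2.2 := ⟨(M, l, π), rfl, hc⟩
  unfold optProof
  rw [dif_pos h]
  obtain ⟨h1, h2, h3⟩ := optCode_inj.1 h.choose_spec.1
  rw [← h1, ← h2, ← h3]

theorem optProof_of_not {z : Str} (h : ¬ ∃ p : Machine × ℕ × Str,
    z = optCode p.1 p.2.1 p.2.2 ∧ p.1.Cheap p.2.1 p.2.2) (O : Oracle) :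
    optProof O z = Form.tru.code := dif_neg h

theorem length_optCode (M : Machine) (l : ℕ) (π : Str) :
    (optCode M l π).length = M.num + 1 + (l + 1 + π.length) := by
  simp only [optCode, length_unary]

/-- The p-optimal proof system, as a task. -/
noncomputable def optTask : Task where
  fn := optProof
  bud := 2 * Polynomial.X + 4
  len := Polynomial.X + 3
  length_le O z := by
    simp only [Polynomial.eval_add, Polynomial.eval_X, Polynomial.eval_ofNat]
    by_cases h : ∃ p : Machine × ℕ × Str, z = optCode p.1 p.2.1 p.2.2 ∧ p.1.Cheap p.2.1 p.2.2
    · obtain ⟨⟨M, l, π⟩, rfl, hc⟩ := h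
      rw [optProof_optCode hc]
      have := M.length_run O π
      unfold Machine.Cheap at hc
      simp only [length_optCode] at *
      split_ifs
      · simp [Form.code]
      · omega
    · rw [optProof_of_not h]
      simp [Form.code]
  decided O z := by
    simp only [Polynomial.eval_add, Polynomial.eval_mul, Polynomial.eval_X, Polynomial.eval_ofNat]
    by_cases h : ∃ p : Machine × ℕ × Str, z = optCode p.1 p.2.1 p.2.2 ∧ p.1.Cheap p.2.1 p.2.2
    · obtain ⟨⟨M, l, π⟩, rfl, hc⟩ := h
      simp only [optProof_optCode hc]
      refine ((DecidedBy.memBit (taskWord true M.num l [])).bind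
        (K := fun b O => if b = true then Form.tru.code else M.run O π)
        (m := M.2.eval π.length) ?_).mono ?_
      · split_ifs
        · exact DecidedBy.const _
        · exact M.decided O π
      · unfold Machine.Cheap at hc
        simp only [length_optCode, length_taskWord, List.length_nil] at *
        omega
    · simp only [optProof_of_not h]
      exact DecidedBy.const _

/-- The function that translates the proofs of the proof system computed by `M` into proofs of the
p-optimal one. -/
noncomputable def optTranslate (M : Machine) (π : Str) : Str :=
  optCode M (2 * (π.length + M.2.eval π.length)) π

/-- `optTranslate`, as a task. -/
noncomputable def translateTask (M : Machine) : Task where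
  fn _ := optTranslate M
  bud := 0
  len := (M.num : Polynomial ℕ) + 1 + (2 * (Polynomial.X + M.2) + 1 + Polynomial.X)
  length_le _ π := by simp [optTranslate, length_optCode]
  decided _ _ := DecidedBy.const _

/-- `y` belongs to the row of `x` in the family number `k`. -/
def InRow (k : ℕ) (G : Set Str) (x y : Str) : Prop :=
  y.length = x.length + 1 ∧ unary k (x ++ y) ∈ G

/-- The promise that in the family number `k` no row is empty. -/
def HasRows (k : ℕ) : Set (Set Str) := {G | ∀ x, ∃ y, InRow k G x y}

theorem HasRows.mono {k : ℕ} {G G' : Set Str} (h : G ∈ HasRows k) (hG : G ⊆ G') :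
    G' ∈ HasRows k := fun x => (h x).imp fun _ hy => ⟨hy.1, hG hy.2⟩

/-- The relation that `y` belongs to the row of `x`, in terms of the oracle. -/
def rowRel (k : ℕ) (O : Oracle) (x y : Str) : Prop :=
  y.length = x.length + 1 ∧ false :: unary k (x ++ y) ∈ O

/-- The relation that `b :: y` belongs to the row of `x`, in terms of the oracle. -/
def halfRel (k : ℕ) (b : Bool) (O : Oracle) (x y : Str) : Prop := rowRel k O x (b :: y)

theorem decidedBy_rowRel (k : ℕ) (O : Oracle) (x y : Str) :
    DecidedBy (fun O => rowRel k O x y) O (2 * x.length + k + 3) := by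
  by_cases h : y.length = x.length + 1
  · have : ∀ O, rowRel k O x y ↔ memBit O (false :: unary k (x ++ y)) = true := fun O => by
      simp [rowRel, h, memBit]
    simp only [this]
    refine ((DecidedBy.memBit _).map (fun b => b = true)).mono ?_
    simp only [List.length_cons, length_unary, List.length_append]
    omega
  · simp only [rowRel, h, false_and]
    exact DecidedBy.const _

/-- The task that decides `rowRel k`. -/
noncomputable def rowTask (k : ℕ) : Task :=
  relTask (rowRel k) (Polynomial.X + (k : Polynomial ℕ) + 3) fun O x y =>
    (decidedBy_rowRel k O x y).mono (by simp [length_pair]; omega)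

/-- The task that decides `halfRel k b`. -/
noncomputable def halfTask (k : ℕ) (b : Bool) : Task :=
  relTask (halfRel k b) (Polynomial.X + (k : Polynomial ℕ) + 3) fun O x y =>
    (decidedBy_rowRel k O x (b :: y)).mono (by simp [length_pair]; omega)

/-- The formula that says that the row of `x` is not empty. -/
def rowForm (k : ℕ) (x : Str) : Form := gateForm (false :: unary k x) (x.length + 1)

/-- The proof system in which `false :: x` is a proof of `rowForm k x`; all other formulas have the
proofs that they have in the proof system computed by `M`. -/
noncomputable def rowProof (M : Machine) (k : ℕ) (O : Oracle) : Str → Str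
  | [] => Form.tru.code
  | false :: x => (rowForm k x).code
  | true :: z => M.run O z

/-- `rowProof`, as a task. -/
noncomputable def rowProofTask (M : Machine) (k : ℕ) : Task where
  fn := rowProof M k
  bud := M.2
  len := (12 + 3 * (k : Polynomial ℕ) + 3 * Polynomial.X +
    Polynomial.X * (2 * Polynomial.X + 5)) + (Polynomial.X + M.2)
  length_le O z := by
    simp only [Polynomial.eval_add, Polynomial.eval_mul, Polynomial.eval_X, Polynomial.eval_ofNat,
      Polynomial.eval_natCast, Nat.cast_id]
    match z with
    | [] => simp [rowProof, Form.code]; omega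
    | false :: x =>
      have := length_code_gateForm (false :: unary k x) (x.length + 1)
      simp only [List.length_cons, length_unary] at this
      simp only [rowProof, rowForm, List.length_cons]
      omega
    | true :: z =>
      have := M.length_run O z
      have := eval_mono_nat M.2 (a := z.length) (b := z.length + 1) (by omega)
      simp only [rowProof, List.length_cons]
      omega
  decided O z := by
    match z with
    | [] => exact DecidedBy.const _
    | false :: x => exact DecidedBy.const _
    | true :: z =>
      exact (M.decided O z).mono (eval_mono_nat _ (by simp))

/-- The tasks of the second world. -/
def hardTasks : Set Task :=
  {optTask} ∪ (Set.range constTask ∪ (Set.range translateTask ∪ (Set.range rowTask ∪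
    (Set.range (fun p : ℕ × Bool => halfTask p.1 p.2) ∪
      Set.range fun p : Machine × ℕ => rowProofTask p.1 p.2))))

theorem countable_hardTasks : hardTasks.Countable :=
  (Set.toFinite _).countable.union ((Set.countable_range _).union
    ((Set.countable_range _).union ((Set.countable_range _).union
      ((Set.countable_range _).union (Set.countable_range _)))))

/-- The oracles of the second world. The special predicate for `M` and `l` tells whether `M` puts
out a string that is not a tautology on an input that is cheap for `l`. -/
noncomputable def hardScheme : Scheme where
  ι := hardTasks
  κ := Machine
  encι := countable_hardTasks.toEncodable
  encκ := Encodable.ofCountable _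
  task := Subtype.val
  sp M F G l x := x = [] ∧ ∃ π, M.Cheap l π ∧ M.run (F G) π ∉ TAUT (F G)
  sp_congr M F F' G G' l x hF hG := by
    refine and_congr_right fun _ => exists_congr fun π => and_congr_right fun hc => not_congr ?_
    have hag := hF G G' hG
    unfold Machine.Cheap at hc
    have h1 : M.run (F G) π = M.run (F' G') π :=
      (M.decided (F' G') π).eq_of_agree fun w hw => hag w (by omega)
    rw [← h1]
    have := M.length_run (F G) π
    exact mem_TAUT_congr fun u hu => hag u (by omega)

theorem hard_mem_special {M : Machine} {G : Set Str} {l : ℕ} {x : Str} :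
    taskWord true M.num l x ∈ hardScheme.build G ↔
      x = [] ∧ ∃ π, M.Cheap l π ∧ M.run (hardScheme.build G) π ∉ TAUT (hardScheme.build G) :=
  hardScheme.mem_build_special (k := M)

/-- If the special strings are constant on `C` up to length `M`, then all strings up to this
length are local. -/
theorem hard_local {C : Set (Set Str)} {G : Set Str} {M : ℕ}
    (h : ∀ i l x, (taskWord true i l x).length ≤ M → ∀ G' ∈ C,
      (taskWord true i l x ∈ hardScheme.build G' ↔ taskWord true i l x ∈ hardScheme.build G))
    (w : Str) (hw : w.length ≤ M) : hardScheme.Local C G w :=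
  hardScheme.local_of_special (fun _ l x hM _ => ⟨∅, by simp, fun G' hG' _ => h _ l x hM G' hG'⟩)
    w hw

/-- A special string that belongs to the oracle is kept in it by few bits. -/
theorem exists_special_certificate {C : Set (Set Str)} {G : Set Str} {M : ℕ}
    (h : ∀ w : Str, w.length ≤ M → hardScheme.Local C G w) {i l : ℕ} {x : Str} (hl : l ≤ M)
    (hw : taskWord true i l x ∈ hardScheme.build G) :
    ∃ E : Finset Str, E.card ≤ M ∧ ∀ G' ∈ C, (∀ u ∈ E, u ∈ G' ↔ u ∈ G) →
      taskWord true i l x ∈ hardScheme.build G' := by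
  have hk : ∃ N : Machine, i = N.num := by
    rw [hardScheme.mem_build] at hw
    rcases hw with ⟨u, h1, -⟩ | ⟨j, l', x', h1, -⟩ | ⟨N, l', x', h1, -⟩
    · simp [taskWord] at h1
    · simp [taskWord_inj] at h1
    · exact ⟨N, (taskWord_inj.1 h1).2.1⟩
  obtain ⟨N, rfl⟩ := hk
  obtain ⟨rfl, π, hc, hπ⟩ := hard_mem_special.1 hw
  have hd : DecidedBy (fun O => N.run O π ∈ TAUT O) (hardScheme.build G) l := by
    refine ((N.decided _ π).bind (K := fun w O => w ∈ TAUT O) (decidedBy_mem_TAUT hπ)).mono ?_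
    have := N.length_run (hardScheme.build G) π
    unfold Machine.Cheap at hc
    omega
  obtain ⟨E, hE, h⟩ := Scheme.Local.decided hardScheme hd fun w hw => h w (hw.trans hl)
  refine ⟨E, hE.trans hl, fun G' hG hu => hard_mem_special.2 ⟨rfl, π, hc, ?_⟩⟩
  rw [← h G' hG hu] at hπ
  exact hπ

/-- In every nonempty class of generic sets there is a set such that few of its bits fix the special
strings up to length `M` within the class. The set is found by making as many special strings true
as possible, length by length. -/
theorem exists_special_fixed {C : Set (Set Str)} (hC : C.Nonempty) (M : ℕ) :
    ∃ G ∈ C, ∃ D : Finset Str, D.card ≤ M * (M + 1) ^ 3 ∧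
      ∀ G' ∈ C, (∀ u ∈ D, u ∈ G' ↔ u ∈ G) → ∀ i l x, (taskWord true i l x).length ≤ M →
        (taskWord true i l x ∈ hardScheme.build G' ↔ taskWord true i l x ∈ hardScheme.build G) := by
  classical
  induction M with
  | zero =>
    obtain ⟨G, hG⟩ := hC
    refine ⟨G, hG, ∅, by simp, fun G' _ _ i l x h => ?_⟩
    rw [length_taskWord] at h
    omega
  | succ M ih =>
    obtain ⟨G₀, hG₀, D, hD, h⟩ := ih
    set C' : Set (Set Str) := {G' | G' ∈ C ∧ ∀ u ∈ D, u ∈ G' ↔ u ∈ G₀} with hC'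
    let T : Finset (ℕ × ℕ) := Finset.range (M + 2) ×ˢ Finset.range (M + 2)
    let tr : Set Str → Finset (ℕ × ℕ) := fun G => T.filter fun p =>
      (taskWord true p.1 p.2 []).length = M + 1 ∧ taskWord true p.1 p.2 [] ∈ hardScheme.build G
    obtain ⟨G₁, hG₁, hmax⟩ : ∃ G₁ ∈ C', ∀ G ∈ C', (tr G).card ≤ (tr G₁).card := by
      have hb : BddAbove ((fun G => (tr G).card) '' C') := by
        refine ⟨T.card, ?_⟩
        rintro _ ⟨G, -, rfl⟩
        exact Finset.card_le_card (Finset.filter_subset _ _)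
      have hne : ((fun G => (tr G).card) '' C').Nonempty :=
        ⟨_, G₀, ⟨hG₀, fun _ _ => Iff.rfl⟩, rfl⟩
      obtain ⟨G₁, h1, h2⟩ := Nat.sSup_mem hne hb
      refine ⟨G₁, h1, fun G hG => ?_⟩
      have := le_csSup hb ⟨G, hG, rfl⟩
      rwa [← h2] at this
    have hloc : ∀ w : Str, w.length ≤ M → hardScheme.Local C' G₁ w :=
      hard_local fun i l x hM G' hG' =>
        (h G' hG'.1 hG'.2 i l x hM).trans (h G₁ hG₁.1 hG₁.2 i l x hM).symm
    have hcert : ∀ p : ℕ × ℕ, ∃ E : Finset Str, E.card ≤ M ∧ (p ∈ tr G₁ →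
        ∀ G' ∈ C', (∀ u ∈ E, u ∈ G' ↔ u ∈ G₁) →
          taskWord true p.1 p.2 [] ∈ hardScheme.build G') := by
      intro p
      by_cases hp : p ∈ tr G₁
      · have hp' := (Finset.mem_filter.1 hp).2
        rw [length_taskWord] at hp'
        obtain ⟨E, hE, h⟩ := exists_special_certificate hloc (by omega) hp'.2
        exact ⟨E, hE, fun _ => h⟩
      · exact ⟨∅, by simp, fun h => absurd h hp⟩
    choose E hE hcert using hcert
    refine ⟨G₁, hG₁.1, D ∪ (tr G₁).biUnion E, ?_, fun G' hG' hu => ?_⟩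
    · have h1 : ((tr G₁).biUnion E).card ≤ (tr G₁).card * M :=
        Finset.card_biUnion_le_card_mul _ _ _ fun p _ => hE p
      have h2 : (tr G₁).card ≤ (M + 2) * (M + 2) := by
        refine (Finset.card_le_card (Finset.filter_subset _ _)).trans ?_
        simp [T]
      have h3 := Finset.card_union_le D ((tr G₁).biUnion E)
      have h4 : (tr G₁).card * M ≤ (M + 2) * (M + 2) * M := Nat.mul_le_mul_right _ h2
      have h5 : M * (M + 1) ^ 3 + (M + 2) * (M + 2) * M ≤ (M + 1) * (M + 1 + 1) ^ 3 := by
        nlinarith [Nat.zero_le M, Nat.zero_le (M ^ 2), Nat.zero_le (M ^ 3)]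
      omega
    · have hG'C : G' ∈ C' := ⟨hG', fun u hD' =>
        (hu u (Finset.mem_union_left _ hD')).trans (hG₁.2 u hD')⟩
      have hsub : tr G₁ ⊆ tr G' := by
        intro p hp
        refine Finset.mem_filter.2 ⟨(Finset.mem_filter.1 hp).1, (Finset.mem_filter.1 hp).2.1, ?_⟩
        exact hcert p hp G' hG'C fun u hu' => hu u
          (Finset.mem_union_right _ (Finset.mem_biUnion.2 ⟨p, hp, hu'⟩))
      have heq := Finset.eq_of_subset_of_card_le hsub (hmax G' hG'C)
      intro i l x hlen
      rcases Nat.lt_or_ge M (taskWord true i l x).length with hM | hM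
      · by_cases hx : x = []
        · subst hx
          rw [length_taskWord] at hM hlen
          have hp : (i, l) ∈ T := by
            simp only [T, Finset.mem_product, Finset.mem_range]
            simp only [List.length_nil] at hlen
            omega
          have hiff : ∀ G, (i, l) ∈ tr G ↔ taskWord true i l [] ∈ hardScheme.build G := by
            intro G
            rw [Finset.mem_filter]
            refine ⟨fun h => h.2.2, fun h => ⟨hp, ?_, h⟩⟩
            rw [length_taskWord]
            omega
          rw [← hiff, ← hiff, heq]
        · have hno : ∀ G, taskWord true i l x ∉ hardScheme.build G := by
            intro G hG
            rw [hardScheme.mem_build] at hG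
            rcases hG with ⟨u, h1, -⟩ | ⟨j, l', x', h1, -⟩ | ⟨N, l', x', h1, h2⟩
            · simp [taskWord] at h1
            · simp [taskWord_inj] at h1
            · obtain ⟨-, -, -, rfl⟩ := taskWord_inj.1 h1
              exact hx h2.1
          exact iff_of_false (hno _) (hno _)
      · exact (h G' hG'C.1 hG'C.2 i l x hM).trans (h G₁ hG₁.1 hG₁.2 i l x hM).symm

/-! ### Emptying a row -/

/-- There are a string `x` and a set `H₀` in which the row of
`x` is empty, such that every property of the oracle over `H₀` that is decided by few answers is
shared by the oracle over a set `H₁` in which no row is empty, and in which the row of `x` avoids a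
given string and consists of strings with a given first bit. All this is possible within any finite
condition that makes no promise about the family number `k`. -/
theorem exists_row_switch {G : Set Str} {I : Finset ℕ} {k : ℕ} (hk : k ∉ I)
    (hI : ∀ i ∈ I, G ∈ HasRows i) (hGk : G ∈ HasRows k) (m : ℕ) (p : Polynomial ℕ) :
    ∃ (x : Str) (H₀ : Set Str), (∀ i ∈ I, H₀ ∈ HasRows i) ∧ Agree m G H₀ ∧
      (∀ y, ¬ InRow k H₀ x y) ∧
      ∀ (b : Bool) (y₀ : Str) (F : Oracle → Prop), F (hardScheme.build H₀) →
        DecidedBy F (hardScheme.build H₀) (p.eval x.length) →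
        ∃ H₁ : Set Str, (∀ i ∈ I, H₁ ∈ HasRows i) ∧ H₁ ∈ HasRows k ∧ Agree m G H₁ ∧
          F (hardScheme.build H₁) ∧ ∀ y, InRow k H₁ x y → y.head? = some b ∧ y ≠ y₀ := by
  classical
  obtain ⟨N, hN⟩ := eventually_eval_lt_two_pow (p * (p + 1) ^ 3 + p + 1)
  set n := max N m with hn
  have hbig := hN n (le_max_left _ _)
  simp only [Polynomial.eval_add, Polynomial.eval_mul, Polynomial.eval_pow,
    Polynomial.eval_one] at hbig
  set M := p.eval n with hM
  -- The rows of the strings shorter than `n` are kept, all other rows may be changed.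
  let C : Set (Set Str) := {H | (∀ i ∈ I, H ∈ HasRows i) ∧ Agree (k + 2 * n + 1) G H}
  obtain ⟨G₀, hG₀, D, hD, hfix⟩ := exists_special_fixed (C := C) ⟨G, hI, Agree.refl _ _⟩ M
  obtain ⟨x, hx, hxD⟩ : ∃ x : Str, x.length = n ∧ x ∉ D.image fun u => (u.drop (k + 1)).take n :=
    exists_notMem_of_card_lt (f := id) (lt_of_le_of_lt Finset.card_image_le (by omega))
      Function.injective_id
  have hrowD : ∀ y, unary k (x ++ y) ∉ D := by
    intro y hy
    refine hxD (Finset.mem_image.2 ⟨_, hy, ?_⟩)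
    have : unary k (x ++ y) = unary k [] ++ (x ++ y) := by rw [unary_append, List.nil_append]
    rw [this, List.drop_left' (by simp [length_unary]), List.take_left' hx]
  set H₀ : Set Str := {u | u ∈ G₀ ∧ ¬ ∃ y, y.length = n + 1 ∧ u = unary k (x ++ y)} with hH₀
  have hH₀C : H₀ ∈ C := by
    refine ⟨fun i hi z => ?_, fun u hu => (hG₀.2 u hu).trans ⟨fun h => ⟨h, ?_⟩, fun h => h.1⟩⟩
    · obtain ⟨y, hy, hyG⟩ := hG₀.1 i hi z
      refine ⟨y, hy, hyG, ?_⟩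
      rintro ⟨y', -, h⟩
      rw [(unary_inj.1 h).1] at hi
      exact hk hi
    · rintro ⟨y, hy, rfl⟩
      rw [length_unary, List.length_append] at hu
      omega
  have hH₀D : ∀ u ∈ D, u ∈ H₀ ↔ u ∈ G₀ := fun u hu =>
    ⟨fun h => h.1, fun h => ⟨h, fun ⟨y, _, hy⟩ => hrowD y (hy ▸ hu)⟩⟩
  refine ⟨x, H₀, hH₀C.1, hH₀C.2.mono (by omega), ?_, ?_⟩
  · rintro y ⟨hy, h⟩
    exact h.2 ⟨y, by omega, rfl⟩
  · intro b y₀ F hF hdec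
    rw [hx, ← hM] at hdec
    obtain ⟨E, hE, hFE⟩ := Scheme.Local.decided hardScheme
      (C := {H | H ∈ C ∧ ∀ u ∈ D, u ∈ H ↔ u ∈ G₀}) hdec fun w hw =>
        hard_local (fun i l z hz H hH => (hfix H hH.1 hH.2 i l z hz).trans
          (hfix H₀ hH₀C hH₀D i l z hz).symm) w hw
    have hDE := Finset.card_union_le D E
    let new : Set Str := {u | ∃ z y, u = unary k (z ++ y) ∧ y.length = z.length + 1 ∧
      n ≤ z.length ∧ u ∉ D ∪ E ∧ (z = x → y.head? = some b ∧ y ≠ y₀)}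
    have hnew : ∀ u ∈ D ∪ E, u ∈ H₀ ∪ new ↔ u ∈ H₀ := by
      intro u hu
      refine ⟨fun h => h.resolve_right ?_, Or.inl⟩
      rintro ⟨z, y, -, -, -, h, -⟩
      exact h hu
    have hag : Agree (k + 2 * n + 1) G (H₀ ∪ new) := by
      intro u hu
      refine (hH₀C.2 u hu).trans ⟨Or.inl, fun h => h.resolve_right ?_⟩
      rintro ⟨z, y, rfl, h1, h2, -⟩
      rw [length_unary, List.length_append] at hu
      omega
    have hrows : ∀ i ∈ I, H₀ ∪ new ∈ HasRows i := fun i hi =>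
      HasRows.mono (hH₀C.1 i hi) Set.subset_union_left
    refine ⟨H₀ ∪ new, hrows, fun z => ?_, hag.mono (by omega), ?_, ?_⟩
    · rcases Nat.lt_or_ge z.length n with hz | hz
      · obtain ⟨y, hy, hyG⟩ := hGk z
        refine ⟨y, hy, (hag _ ?_).1 hyG⟩
        rw [length_unary, List.length_append]
        omega
      · by_cases hzx : z = x
        · subst hzx
          have hcard : (insert (unary k (z ++ y₀)) (D ∪ E)).card < 2 ^ n :=
            lt_of_le_of_lt (Finset.card_insert_le _ _) (by omega)
          obtain ⟨y, hy, hyE⟩ := exists_notMem_of_card_lt hcard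
            (f := fun y => unary k (z ++ b :: y)) fun y y' h => by
              simpa using (unary_inj.1 h).2
          rw [Finset.mem_insert, not_or] at hyE
          refine ⟨b :: y, by simp [hy, hx], Or.inr ⟨z, b :: y, rfl, by simp [hy, hx], hz, hyE.2,
            fun _ => ⟨rfl, fun h => hyE.1 ?_⟩⟩⟩
          rw [← h]
        · have hcard : (D ∪ E).card < 2 ^ (z.length + 1) := by
            have := Nat.pow_le_pow_right two_pos (show n ≤ z.length + 1 by omega)
            omega
          obtain ⟨y, hy, hyE⟩ := exists_notMem_of_card_lt hcard
            (f := fun y => unary k (z ++ y)) fun y y' h => by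
              simpa using (unary_inj.1 h).2
          exact ⟨y, hy, Or.inr ⟨z, y, rfl, hy, hz, hyE, fun h => absurd h hzx⟩⟩
    · rw [hFE (H₀ ∪ new) ⟨⟨hrows, hag⟩, fun u hu =>
        (hnew u (Finset.mem_union_left _ hu)).trans (hH₀D u hu)⟩
        fun u hu => hnew u (Finset.mem_union_right _ hu)]
      exact hF
    · rintro y ⟨hy, h | ⟨z, y', h1, h2, h3, h4, h5⟩⟩
      · exact absurd ⟨y, by omega, rfl⟩ h.2
      · have h6 := (unary_inj.1 h1).2
        have h7 := congrArg List.length h6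
        rw [List.length_append, List.length_append] at h7
        obtain ⟨rfl, rfl⟩ := List.append_inj h6 (by omega)
        exact h5 rfl

/-! ### The generic set of the second world -/

theorem queriesFrom_congr {P : Prog} {g g' : Str → Str} {n : ℕ} {c : Config}
    (h : ∀ w ∈ queriesFrom P g n c, g' w = g w) : queriesFrom P g' n c = queriesFrom P g n c := by
  induction n generalizing c with
  | zero => rfl
  | succ n ih =>
    simp only [queriesFrom, List.mem_append] at h ⊢
    rw [step_congr fun w hw => h w (Or.inl hw), ih fun w hw => h w (Or.inr hw)]

/-- What a machine with access to `O` and `g` does is decided by few answers of `O`. -/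
theorem decidedBy_joinRun (P : Prog) (g : Str → Str) (x : Str) (n : ℕ) (O : Oracle) :
    DecidedBy (fun O => (queries P (joinAnswer O g) x n, runOut P (joinAnswer O g) x n)) O n := by
  refine ⟨(queries P (joinAnswer O g) x n).map List.tail, ?_, fun O' hO => ?_⟩
  · refine le_trans ?_ (queries_length P (joinAnswer O g) x n)
    rw [List.map_map]
    exact List.sum_le_sum fun w _ => by simp
  · have h : ∀ w ∈ queries P (joinAnswer O g) x n, joinAnswer O' g w = joinAnswer O g w := by
      intro w hw
      match w with
      | [] => rfl
      | true :: w => rfl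
      | false :: w => exact answer_congr (hO w (List.mem_map.2 ⟨_, hw, rfl⟩))
    dsimp only
    rw [runOut_congr h, queries, queriesFrom_congr h]
    rfl

theorem DecidedBy.forall_mem {α : Type*} {F : α → Oracle → Prop} {O : Oracle} {n : ℕ} {W : List α}
    (h : ∀ w ∈ W, DecidedBy (F w) O n) :
    DecidedBy (fun O => ∀ w ∈ W, F w O) O (W.length * n) := by
  induction W with
  | nil => simpa using DecidedBy.const (O := O) (n := 0) True
  | cons w W ih =>
    simp only [List.mem_cons, forall_eq_or_imp, List.length_cons] at h ⊢
    have h2 := ih h.2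
    exact (h.1.bind (K := fun a O => a ∧ ∀ w ∈ W, F w O) (h2.map _)).mono (by
      rw [add_mul]; omega)

/-- The instances of the search problem among the questions `q` to a joined oracle. -/
def instancesAsked (q : List Str) : List Str := (q.filter fun w => w.head? = some true).map List.tail

theorem mem_instancesAsked {q : List Str} {w : Str} : w ∈ instancesAsked q ↔ true :: w ∈ q := by
  simp only [instancesAsked, List.mem_map, List.mem_filter, decide_eq_true_eq]
  constructor
  · rintro ⟨u, ⟨hu, h⟩, rfl⟩
    cases u with
    | nil => simp at h
    | cons b u =>
      simp only [List.head?_cons, Option.some.injEq] at h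
      subst h
      exact hu
  · exact fun h => ⟨_, ⟨h, rfl⟩, rfl⟩

theorem length_instancesAsked (q : List Str) :
    (instancesAsked q).length ≤ (q.map List.length).sum := by
  simp only [instancesAsked, List.length_map]
  induction q with
  | nil => simp
  | cons w q ih =>
    cases w with
    | nil => simpa using ih
    | cons b w => cases b <;> simp <;> omega

/-- The machine `M` fails to solve the row problem of the family number `k` with the help of
solutions for `V`: for some input `x` and some function `g` that answers the instances asked
correctly the output is not in the row of `x`. -/
def FailsTFNP (k : ℕ) (V : Verifier) (M : Machine) (O : Oracle) : Prop :=
  ∃ x g, (∀ w, true :: w ∈ queries M.1 (joinAnswer O g) x (M.2.eval x.length) →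
    V.Sol O w (g w)) ∧ ¬ rowRel k O x (runOut M.1 (joinAnswer O g) x (M.2.eval x.length))

/-- The property of `FailsTFNP`, for fixed `x` and `g`, that the instances asked are answered
correctly and that the output is `y`. -/
def SolvesWith (V : Verifier) (M : Machine) (x : Str) (g : Str → Str) (y : Str) (O : Oracle) :
    Prop :=
  (∀ w, true :: w ∈ queries M.1 (joinAnswer O g) x (M.2.eval x.length) → V.Sol O w (g w)) ∧
    runOut M.1 (joinAnswer O g) x (M.2.eval x.length) = y

theorem decidedBy_solvesWith (V : Verifier) (M : Machine) (x : Str) (g : Str → Str) (y : Str)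
    (O : Oracle) : DecidedBy (SolvesWith V M x g y) O
      ((M.2 + M.2 * V.time.comp M.2).eval x.length) := by
  set t := M.2.eval x.length with ht
  set q := queries M.1 (joinAnswer O g) x t with hq
  have h1 := decidedBy_joinRun M.1 g x t O
  have h2 : DecidedBy (fun O => ∀ w ∈ instancesAsked q, V.Sol O w (g w)) O
      ((instancesAsked q).length * V.time.eval t) := by
    refine DecidedBy.forall_mem fun w hw => (V.decided O w (g w)).mono (eval_mono_nat _ ?_)
    have := length_le_of_mem_queries (mem_instancesAsked.1 hw)
    simp only [List.length_cons] at this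
    omega
  have h3 : (instancesAsked q).length ≤ t :=
    (length_instancesAsked q).trans (queries_length _ _ _ _)
  have h4 := h1.bind (K := fun r O => (∀ w ∈ instancesAsked r.1, V.Sol O w (g w)) ∧ r.2 = y)
    (h2.map fun a => a ∧ runOut M.1 (joinAnswer O g) x t = y)
  refine DecidedBy.mono (n := t + (instancesAsked q).length * V.time.eval t) ?_ ?_
  · simp only [mem_instancesAsked] at h4
    exact h4
  · simp only [Polynomial.eval_add, Polynomial.eval_mul, Polynomial.eval_comp]
    rw [← ht]
    exact Nat.add_le_add_left (Nat.mul_le_mul_right _ h3) _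

theorem failsTFNP_iff {k : ℕ} {V : Verifier} {M : Machine} {O : Oracle} :
    FailsTFNP k V M O ↔ ∃ x g y, SolvesWith V M x g y O ∧ ¬ rowRel k O x y :=
  ⟨fun ⟨x, g, h1, h2⟩ => ⟨x, g, _, ⟨h1, rfl⟩, h2⟩,
    fun ⟨x, g, _, ⟨h1, h2⟩, h3⟩ => ⟨x, g, h1, by rwa [h2]⟩⟩

theorem openProp_failsTFNP (k : ℕ) (V : Verifier) (M : Machine) :
    OpenProp (FailsTFNP k V M) := by
  have : FailsTFNP k V M = fun O => ∃ x g y, SolvesWith V M x g y O ∧ ¬ rowRel k O x y := by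
    funext O
    exact propext failsTFNP_iff
  rw [this]
  refine OpenProp.exists_ fun x => OpenProp.exists_ fun g => OpenProp.exists_ fun y =>
    OpenProp.and ?_ ?_
  · exact OpenProp.of_decidedBy (decidedBy_solvesWith V M x g y) id
  · exact OpenProp.of_decidedBy (fun O => decidedBy_rowRel k O x y) Not

/-- The machine `M'` fails to translate the proofs of the formulas `rowForm k x` into proofs for the
proof system computed by `M`. -/
def FailsSAT (k : ℕ) (M M' : Machine) (O : Oracle) : Prop :=
  ∃ x, M.run O (M'.run O (false :: x)) ≠ (rowForm k x).code

/-- A polynomial bound for the time needed to run `M` after `M'`. -/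
noncomputable def compTime (M' : Machine) (t : Polynomial ℕ) : Polynomial ℕ :=
  M'.2 + t.comp (Polynomial.X + M'.2)

theorem decidedBy_after {α : Type*} (M' : Machine) {t : Polynomial ℕ} {F : Str → Oracle → α}
    (hF : ∀ O z, DecidedBy (F z) O (t.eval z.length)) (O : Oracle) (x : Str) :
    DecidedBy (fun O => F (M'.run O x) O) O ((compTime M' t).eval x.length) := by
  refine ((M'.decided O x).bind (K := F) (hF O _)).mono ?_
  simp only [compTime, Polynomial.eval_add, Polynomial.eval_comp, Polynomial.eval_X]
  exact Nat.add_le_add_left (eval_mono_nat _ (M'.length_run O x)) _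

theorem decidedBy_run_run (M M' : Machine) (O : Oracle) (x : Str) :
    DecidedBy (fun O => M.run O (M'.run O x)) O ((compTime M' M.2).eval x.length) :=
  decidedBy_after M' (F := fun z O => M.run O z) (fun O z => M.decided O z) O x

theorem openProp_failsSAT (k : ℕ) (M M' : Machine) : OpenProp (FailsSAT k M M') :=
  OpenProp.exists_ fun x => OpenProp.of_decidedBy
    (fun O => decidedBy_run_run M M' O (false :: x)) (· ≠ (rowForm k x).code)

/-- The strings whose row in the family number `k` has no element with first bit `b`. -/
def halfSet (k : ℕ) (b : Bool) (O : Oracle) : Set Str := {x | ¬ ∃ y, halfRel k b O x y}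

/-- The machine `M` fails to reduce the pair of the sets `halfSet k false` and `halfSet k true` to
the pair of the complements of the sets given by `V` and `W`. -/
def FailsPair (k : ℕ) (V W : Verifier) (M : Machine) (O : Oracle) : Prop :=
  (∃ x, x ∈ halfSet k false O ∧ ∃ y, V.Sol O (M.run O x) y) ∨
    ∃ x, x ∈ halfSet k true O ∧ ∃ y, W.Sol O (M.run O x) y

theorem openProp_mem_halfSet (k : ℕ) (b : Bool) (x : Str) :
    OpenProp fun O => x ∈ halfSet k b O := by
  refine OpenProp.of_agree (2 * x.length + k + 3) fun O O' h hx ⟨y, hy⟩ => hx ⟨y, ?_⟩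
  have := (decidedBy_rowRel k O' x (b :: y)).eq_of_agree (O' := O) h
  exact (eq_iff_iff.1 this).2 hy

theorem decidedBy_sol_run (V : Verifier) (M : Machine) (O : Oracle) (x y : Str) :
    DecidedBy (fun O => V.Sol O (M.run O x) y) O ((compTime M V.time).eval x.length) :=
  decidedBy_after M (F := fun z O => V.Sol O z y) (fun O z => V.decided O z y) O x

theorem openProp_failsPair (k : ℕ) (V W : Verifier) (M : Machine) :
    OpenProp (FailsPair k V W M) := by
  refine OpenProp.or ?_ ?_ <;>
  refine OpenProp.exists_ fun x => OpenProp.and (openProp_mem_halfSet _ _ _)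
    (OpenProp.exists_ fun y => ?_)
  · exact OpenProp.of_decidedBy (fun O => decidedBy_sol_run V M O x y) id
  · exact OpenProp.of_decidedBy (fun O => decidedBy_sol_run W M O x y) id

/-- The machine `M` puts out some string that is not a satisfiable formula. -/
def UnsoundSAT (M : Machine) (O : Oracle) : Prop := ∃ π, M.run O π ∉ SAT O

/-- Some string has neither a solution for `V` nor for `W`. -/
def NotDisjoint (V W : Verifier) (O : Oracle) : Prop :=
  ∃ x, (¬ ∃ y, V.Sol O x y) ∧ ¬ ∃ y, W.Sol O x y

/-- The property `E` of oracles is decided for the generic set `G`, and with it goes a fresh family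
whose rows are not empty. -/
def Settled (G : Set Str) (E : Oracle → Prop) : Prop :=
  ∃ (I : Finset ℕ) (m k : ℕ), k ∉ I ∧ (∀ i ∈ I, G ∈ HasRows i) ∧ G ∈ HasRows k ∧
    (E (hardScheme.build G) ∨
      ∀ H, (∀ i ∈ I, H ∈ HasRows i) → Agree m G H → ¬ E (hardScheme.build H))

/-- The generic set of the second world. -/
theorem exists_hard_generic : ∃ G : Set Str, (∀ V : Verifier, Settled G fun O => ¬ V.Total O) ∧
    (∀ M, Settled G (UnsoundSAT M)) ∧ (∀ V W, Settled G (NotDisjoint V W)) ∧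
    (∀ k V M, Settled G (FailsTFNP k V M)) ∧ (∀ k M M', Settled G (FailsSAT k M M')) ∧
    ∀ k V W M, Settled G (FailsPair k V W M) := by
  let ε := Verifier ⊕ Machine ⊕ (Verifier × Verifier) ⊕ (ℕ × Verifier × Machine) ⊕
    (ℕ × Machine × Machine) ⊕ (ℕ × Verifier × Verifier × Machine)
  let E : ε → Oracle → Prop := fun e => match e with
    | Sum.inl V => fun O => ¬ V.Total O
    | Sum.inr (Sum.inl M) => UnsoundSAT M
    | Sum.inr (Sum.inr (Sum.inl (V, W))) => NotDisjoint V W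
    | Sum.inr (Sum.inr (Sum.inr (Sum.inl (k, V, M)))) => FailsTFNP k V M
    | Sum.inr (Sum.inr (Sum.inr (Sum.inr (Sum.inl (k, M, M'))))) => FailsSAT k M M'
    | Sum.inr (Sum.inr (Sum.inr (Sum.inr (Sum.inr (k, V, W, M))))) => FailsPair k V W M
  have hopen : ∀ e, OpenProp fun G => E e (hardScheme.build G) := by
    refine fun e => OpenProp.build ?_ hardScheme
    rcases e with V | M | ⟨V, W⟩ | ⟨k, V, M⟩ | ⟨k, M, M'⟩ | ⟨k, V, W, M⟩
    · exact V.openProp_not_total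
    · exact openProp_mem_of_run (fun _ _ _ h => mem_SAT_congr h) M
    · exact OpenProp.exists_ fun x => (V.openProp_noSol x).and (W.openProp_noSol x)
    · exact openProp_failsTFNP k V M
    · exact openProp_failsSAT k M M'
    · exact openProp_failsPair k V W M
  have hclosed : ∀ k, ClosedFamily (HasRows k) := by
    intro k G hG x
    obtain ⟨G', hG', hag⟩ := hG (k + 2 * x.length + 2)
    obtain ⟨y, hy, hyG⟩ := hG' x
    refine ⟨y, hy, (hag _ ?_).2 hyG⟩
    rw [length_unary, List.length_append]
    omega
  have hfresh : ∀ (I : Finset ℕ) (m : ℕ), ∀ G ∈ (Set.univ : Set (Set Str)),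
      (∀ i ∈ I, G ∈ HasRows i) → ∃ k, k ∉ I ∧ m < k ∧ ∃ G' ∈ (Set.univ : Set (Set Str)),
        (∀ i ∈ I, G' ∈ HasRows i) ∧ G' ∈ HasRows k ∧ Agree m G G' := by
    intro I m G _ hI
    have hk : m + 1 + I.sup id ∉ I := fun hmem => by
      have := Finset.le_sup (f := id) hmem
      simp only [id] at this
      omega
    refine ⟨m + 1 + I.sup id, hk, by omega, G ∪ Set.range (unary (m + 1 + I.sup id)), trivial,
      fun i hi => HasRows.mono (hI i hi) Set.subset_union_left, fun x => ?_, fun u hu => ?_⟩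
    · exact ⟨List.replicate (x.length + 1) true, by simp, Or.inr ⟨_, rfl⟩⟩
    · refine ⟨Or.inl, fun h => h.resolve_right ?_⟩
      rintro ⟨y, rfl⟩
      rw [length_unary] at hu
      omega
  have : Nonempty ε := ⟨Sum.inr (Sum.inl ([], 0))⟩
  obtain ⟨G, -, h⟩ := exists_generic (B := Set.univ) (C := HasRows) ⟨∅, trivial⟩
    (fun _ _ => trivial) hclosed hfresh (fun e G => E e (hardScheme.build G)) hopen
  have hs : ∀ e, Settled G (E e) := by
    intro e
    obtain ⟨I, m, k, hk, -, hI, hGk, hE⟩ := h e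
    exact ⟨I, m, k, hk, hI, hGk, hE.imp_right fun h H => h H trivial⟩
  exact ⟨G, fun V => hs (Sum.inl V), fun M => hs (Sum.inr (Sum.inl M)),
    fun V W => hs (Sum.inr (Sum.inr (Sum.inl (V, W)))),
    fun k V M => hs (Sum.inr (Sum.inr (Sum.inr (Sum.inl (k, V, M))))),
    fun k M M' => hs (Sum.inr (Sum.inr (Sum.inr (Sum.inr (Sum.inl (k, M, M')))))),
    fun k V W M => hs (Sum.inr (Sum.inr (Sum.inr (Sum.inr (Sum.inr (k, V, W, M))))))⟩

/-! ### Consequences in the second world -/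

theorem exists_hardTask {t : Task} (ht : t ∈ hardTasks) : ∃ i, hardScheme.task i = t :=
  ⟨⟨t, ht⟩, rfl⟩

theorem polyTimeFun_hardTask {t : Task} (ht : t ∈ hardTasks) (G : Set Str) :
    PolyTimeFun (hardScheme.build G) (t.fn (hardScheme.build G)) := by
  obtain ⟨i, rfl⟩ := exists_hardTask ht
  exact hardScheme.polyTimeFun_task i G

theorem optProof_mem_TAUT (G : Set Str) (z : Str) :
    optProof (hardScheme.build G) z ∈ TAUT (hardScheme.build G) := by
  by_cases h : ∃ p : Machine × ℕ × Str, z = optCode p.1 p.2.1 p.2.2 ∧ p.1.Cheap p.2.1 p.2.2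
  · obtain ⟨⟨M, l, π⟩, rfl, hc⟩ := h
    rw [optProof_optCode hc]
    split_ifs with hw
    · exact tru_mem_TAUT _
    · by_contra hπ
      refine hw ?_
      simp only [memBit, decide_eq_true_eq]
      exact hard_mem_special.2 ⟨rfl, π, hc, hπ⟩
  · rw [optProof_of_not h]
    exact tru_mem_TAUT _

/-- The proofs of a sound machine are translated into proofs for `optProof`. -/
theorem optProof_optTranslate {G : Set Str} {M : Machine}
    (hM : ∀ π, M.run (hardScheme.build G) π ∈ TAUT (hardScheme.build G)) (π : Str) :
    optProof (hardScheme.build G) (optTranslate M π) = M.run (hardScheme.build G) π := by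
  rw [optTranslate, optProof_optCode (le_refl _), if_neg]
  simp only [memBit, decide_eq_true_eq]
  intro h
  obtain ⟨-, π', -, h⟩ := hard_mem_special.1 h
  exact h (hM π')

theorem hasPOptimal_TAUT (G : Set Str) :
    HasPOptimal (hardScheme.build G) (TAUT (hardScheme.build G)) := by
  refine ⟨optProof (hardScheme.build G), ⟨polyTimeFun_hardTask (Or.inl rfl) G, ?_⟩,
    fun Q hQ => ?_⟩
  · ext w
    constructor
    · rintro ⟨z, rfl⟩
      exact optProof_mem_TAUT G z
    · -- A single tautology has a proof, since the constant function is computed by a machine.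
      intro hw
      obtain ⟨M, hM⟩ := (polyTimeFun_hardTask (Or.inr (Or.inl ⟨w, rfl⟩)) G).exists_machine
      refine ⟨optTranslate M [], ?_⟩
      rw [optProof_optTranslate (fun π => by rw [hM]; exact hw), hM]
      rfl
  · obtain ⟨M, hM⟩ := hQ.1.exists_machine
    refine ⟨optTranslate M, polyTimeFun_hardTask (Or.inr (Or.inr (Or.inl ⟨M, rfl⟩))) G,
      fun π => ?_⟩
    rw [optProof_optTranslate fun π => ?_, hM]
    rw [hM, ← hQ.2]
    exact ⟨π, rfl⟩

theorem rowRel_build {k : ℕ} {G : Set Str} {x y : Str} :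
    rowRel k (hardScheme.build G) x y ↔ InRow k G x y := by
  rw [rowRel, hardScheme.mem_build_gen, InRow]

/-- The sets `H₀` and `H₁` of `exists_row_switch`, chosen so that `H₀` satisfies the finite condition
that goes with the family number `k`, and the property `E`, which is settled but does not hold of
`G`, does not hold of `H₁`. -/
theorem Settled.exists_switch {G : Set Str} {E : Oracle → Prop} (hE : Settled G E)
    (hnot : ¬ E (hardScheme.build G)) {I : Finset ℕ} {m k : ℕ} (hk : k ∉ I)
    (hI : ∀ i ∈ I, G ∈ HasRows i) (hGk : G ∈ HasRows k) (p : Polynomial ℕ) :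
    ∃ (x : Str) (H₀ : Set Str), (∀ i ∈ I, H₀ ∈ HasRows i) ∧ Agree m G H₀ ∧
      (∀ y, ¬ InRow k H₀ x y) ∧
      ∀ (b : Bool) (y₀ : Str) (F : Oracle → Prop), F (hardScheme.build H₀) →
        DecidedBy F (hardScheme.build H₀) (p.eval x.length) →
        ∃ H₁ : Set Str, F (hardScheme.build H₁) ∧ ¬ E (hardScheme.build H₁) ∧
          ∀ y, InRow k H₁ x y → y.head? = some b ∧ y ≠ y₀ := by
  classical
  obtain ⟨I', m', -, -, hI', -, h | h⟩ := hE
  · exact absurd h hnot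
  obtain ⟨x, H₀, h1, h2, h3, h4⟩ := exists_row_switch (I := I ∪ I'.erase k) (k := k)
    (by simp [hk]) (fun i hi => by
      rcases Finset.mem_union.1 hi with hi | hi
      exacts [hI i hi, hI' i (Finset.mem_of_mem_erase hi)]) hGk (max m m') p
  refine ⟨x, H₀, fun i hi => h1 i (Finset.mem_union_left _ hi), h2.mono (le_max_left _ _), h3,
    fun b y₀ F hF hd => ?_⟩
  obtain ⟨H₁, h5, h6, h7, h8, h9⟩ := h4 b y₀ F hF hd
  refine ⟨H₁, h8, h H₁ (fun i hi => ?_) (h7.mono (le_max_right _ _)), h9⟩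
  by_cases hik : i = k
  · rw [hik]
    exact h6
  · exact h5 i (Finset.mem_union_right _ (Finset.mem_erase.2 ⟨hik, hi⟩))

theorem not_hasCompleteTFNP_of_generic {G : Set Str}
    (hV : ∀ V : Verifier, Settled G fun O => ¬ V.Total O)
    (hF : ∀ k V M, Settled G (FailsTFNP k V M)) :
    ¬ HasCompleteTFNP (hardScheme.build G) := by
  rintro ⟨T, hT⟩
  obtain ⟨V, hVT, htot⟩ := T.exists_verifier
  obtain ⟨I, m, k, hk, hI, hGk, h | htotal⟩ := hV V
  · exact h htot
  obtain ⟨i, hi⟩ := exists_hardTask (t := rowTask k)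
    (Or.inr (Or.inr (Or.inr (Or.inl ⟨k, rfl⟩))))
  let S : TFNPProblem (hardScheme.build G) :=
    { bound := Polynomial.X + 1
      rel := rowRel k (hardScheme.build G)
      polyTime := hardScheme.polyTimeRel_task i G fun x y => by
        rw [hi]
        exact relTask_iff (R := rowRel k) _ x y
      total := fun x => by
        obtain ⟨y, hy⟩ := hGk x
        exact ⟨y, by simp [hy.1], rowRel_build.2 hy⟩ }
  obtain ⟨P, p, hP⟩ := hT S
  have hnot : ¬ FailsTFNP k V (P, p) (hardScheme.build G) := by
    rintro ⟨x, g, hg, hfail⟩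
    choose s hs using htot
    -- The function `g` is completed to one that answers all instances correctly.
    obtain ⟨g', hg', hgg'⟩ : ∃ g' : Str → Str, (∀ w, V.Sol (hardScheme.build G) w (g' w)) ∧
        ∀ w, V.Sol (hardScheme.build G) w (g w) → g' w = g w := by
      classical
      refine ⟨fun w => if V.Sol (hardScheme.build G) w (g w) then g w else s w, fun w => ?_,
        fun w hw => if_pos hw⟩
      by_cases h : V.Sol (hardScheme.build G) w (g w)
      · simpa only [if_pos h] using h
      · simpa only [if_neg h] using hs w
    obtain ⟨y, hy, hhalt⟩ := hP g' (fun w => (hVT w _).1 (hg' w)) x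
    refine hfail ?_
    rw [← runOut_congr (g' := joinAnswer (hardScheme.build G) g') fun w hw => ?_]
    · have := hhalt.runOut_eq
      dsimp only at this ⊢
      rw [this]
      exact hy.2
    · match w, hw with
      | [], _ => rfl
      | false :: w, _ => rfl
      | true :: w, hw => exact hgg' w (hg w hw)
  obtain ⟨x, H₀, h1, h2, h3, h4⟩ := (hF k V (P, p)).exists_switch hnot (m := m) hk hI hGk
    (p + p * V.time.comp p)
  have htot₀ : V.Total (hardScheme.build H₀) := not_not.1 (htotal H₀ h1 h2)
  choose g hg using htot₀
  set y := runOut P (joinAnswer (hardScheme.build H₀) g) x (p.eval x.length) with hy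
  obtain ⟨H₁, h5, h6, h7⟩ := h4 true y (SolvesWith V (P, p) x g y) ⟨fun w _ => hg w, hy.symm⟩
    (decidedBy_solvesWith V (P, p) x g y _)
  refine h6 (failsTFNP_iff.2 ⟨x, g, y, h5, fun hrow => ?_⟩)
  exact (h7 y (rowRel_build.1 hrow)).2 rfl

theorem rowForm_mem_SAT {k : ℕ} {G : Set Str} {x : Str} :
    (rowForm k x).code ∈ SAT (hardScheme.build G) ↔ ∃ y, InRow k G x y := by
  rw [code_mem_SAT, rowForm, exists_eval_gateForm]
  simp only [List.cons_append, unary_append, hardScheme.mem_build_gen, InRow]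

theorem not_hasPOptimal_SAT_of_generic {G : Set Str} (hM : ∀ M, Settled G (UnsoundSAT M))
    (hF : ∀ k M M', Settled G (FailsSAT k M M')) :
    ¬ HasPOptimal (hardScheme.build G) (SAT (hardScheme.build G)) := by
  rintro ⟨P, ⟨hP, hrange⟩, hopt⟩
  obtain ⟨M, hMP⟩ := hP.exists_machine
  obtain ⟨I, m, k, hk, hI, hGk, h | hsound⟩ := hM M
  · obtain ⟨π, hπ⟩ := h
    rw [hMP, ← hrange] at hπ
    exact hπ ⟨π, rfl⟩
  have hQ : IsProofSystem (hardScheme.build G) (SAT (hardScheme.build G))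
      (rowProof M k (hardScheme.build G)) := by
    refine ⟨polyTimeFun_hardTask (t := rowProofTask M k)
      (Or.inr (Or.inr (Or.inr (Or.inr (Or.inr ⟨(M, k), rfl⟩))))) G, ?_⟩
    ext w
    constructor
    · rintro ⟨z, rfl⟩
      match z with
      | [] => exact tru_mem_SAT _
      | false :: x => exact rowForm_mem_SAT.2 (hGk x)
      | true :: z =>
        show M.run _ z ∈ _
        rw [hMP, ← hrange]
        exact ⟨z, rfl⟩
    · intro hw
      rw [← hrange] at hw
      obtain ⟨z, rfl⟩ := hw
      exact ⟨true :: z, hMP z⟩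
  obtain ⟨f, hf, hfQ⟩ := hopt _ hQ
  obtain ⟨M', hM'⟩ := hf.exists_machine
  have hnot : ¬ FailsSAT k M M' (hardScheme.build G) := by
    rintro ⟨x, hx⟩
    refine hx ?_
    rw [hMP, hM', hfQ]
    rfl
  obtain ⟨x, H₀, h1, h2, h3, h4⟩ := (hF k M M').exists_switch hnot (m := m) hk hI hGk
    ((compTime M' M.2).comp (Polynomial.X + 1))
  have hne : M.run (hardScheme.build H₀) (M'.run (hardScheme.build H₀) (false :: x)) ≠
      (rowForm k x).code := by
    intro heq
    have hmem : (rowForm k x).code ∈ SAT (hardScheme.build H₀) := by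
      rw [← heq]
      by_contra hno
      exact hsound H₀ h1 h2 ⟨_, hno⟩
    obtain ⟨y, hy⟩ := rowForm_mem_SAT.1 hmem
    exact h3 y hy
  obtain ⟨H₁, h5, h6, -⟩ := h4 true [] _ hne
    (((decidedBy_run_run M M' _ (false :: x)).map (· ≠ (rowForm k x).code)).mono (by simp))
  exact h6 ⟨x, h5⟩

theorem inCoNP_halfSet (k : ℕ) (b : Bool) (G : Set Str) :
    InCoNP (hardScheme.build G) (halfSet k b (hardScheme.build G)) := by
  obtain ⟨i, hi⟩ := exists_hardTask (t := halfTask k b)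
    (Or.inr (Or.inr (Or.inr (Or.inr (Or.inl ⟨(k, b), rfl⟩)))))
  refine ⟨Polynomial.X, halfRel k b (hardScheme.build G),
    hardScheme.polyTimeRel_task i G fun x y => ?_, fun x => ?_⟩
  · rw [hi]
    exact relTask_iff (R := halfRel k b) _ x y
  · simp only [halfSet, Set.mem_compl_iff, Set.mem_ofPred_eq, not_not]
    refine exists_congr fun y => ⟨fun h => ⟨?_, h⟩, fun h => h.2⟩
    have := h.1
    simp only [List.length_cons] at this
    simp only [Polynomial.eval_X]
    omega

theorem mem_halfSet_of_head {k : ℕ} {b : Bool} {H : Set Str} {x : Str}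
    (h : ∀ y, InRow k H x y → y.head? = some (!b)) : x ∈ halfSet k b (hardScheme.build H) := by
  rintro ⟨y, hy⟩
  have := h _ (rowRel_build.1 hy)
  simp at this

theorem not_hasCompleteDisjCoNP_of_generic {G : Set Str}
    (hVW : ∀ V W, Settled G (NotDisjoint V W))
    (hF : ∀ k V W M, Settled G (FailsPair k V W M)) :
    ¬ HasCompleteDisjCoNP (hardScheme.build G) := by
  rintro ⟨A, B, ⟨hA, hB, hdisj⟩, hcomp⟩
  obtain ⟨V, hVA⟩ := inCoNP_exists_verifier hA
  obtain ⟨W, hWB⟩ := inCoNP_exists_verifier hB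
  obtain ⟨I, m, k, hk, hI, hGk, h | hdis⟩ := hVW V W
  · obtain ⟨x, hx1, hx2⟩ := h
    rw [← hVA, not_not] at hx1
    rw [← hWB, not_not] at hx2
    have : x ∈ A ∩ B := ⟨hx1, hx2⟩
    rw [hdisj] at this
    exact this
  have hpair : IsDisjCoNPPair (hardScheme.build G) (halfSet k false (hardScheme.build G))
      (halfSet k true (hardScheme.build G)) := by
    refine ⟨inCoNP_halfSet k false G, inCoNP_halfSet k true G, ?_⟩
    ext x
    simp only [Set.mem_inter_iff, Set.mem_empty_iff_false, iff_false]
    rintro ⟨h1, h2⟩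
    obtain ⟨y, hy⟩ := hGk x
    match y, hy with
    | false :: y, hy => exact h1 ⟨y, rowRel_build.2 hy⟩
    | true :: y, hy => exact h2 ⟨y, rowRel_build.2 hy⟩
  obtain ⟨f, hf, hfA, hfB⟩ := hcomp _ _ hpair
  obtain ⟨M, hM⟩ := hf.exists_machine
  have hnot : ¬ FailsPair k V W M (hardScheme.build G) := by
    rintro (⟨x, hx, hy⟩ | ⟨x, hx, hy⟩)
    · rw [hM] at hy
      exact (hVA _).2 hy (hfA x hx)
    · rw [hM] at hy
      exact (hWB _).2 hy (hfB x hx)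
  obtain ⟨x, H₀, h1, h2, h3, h4⟩ := (hF k V W M).exists_switch hnot (m := m) hk hI hGk
    (compTime M V.time + compTime M W.time)
  have hcov : (∃ y, V.Sol (hardScheme.build H₀) (M.run (hardScheme.build H₀) x) y) ∨
      ∃ y, W.Sol (hardScheme.build H₀) (M.run (hardScheme.build H₀) x) y := by
    by_contra hno
    exact hdis H₀ h1 h2 ⟨_, not_or.1 hno⟩
  -- The row of `x` is filled with strings whose first bit makes the reduction wrong.
  rcases hcov with ⟨y, hy⟩ | ⟨y, hy⟩
  · obtain ⟨H₁, h5, h6, h7⟩ := h4 true [] _ hy ((decidedBy_sol_run V M _ x y).mono (by simp))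
    exact h6 (Or.inl ⟨x, mem_halfSet_of_head fun z hz => (h7 z hz).1, y, h5⟩)
  · obtain ⟨H₁, h5, h6, h7⟩ := h4 false [] _ hy ((decidedBy_sol_run W M _ x y).mono (by simp))
    exact h6 (Or.inr ⟨x, mem_halfSet_of_head fun z hz => (h7 z hz).1, y, h5⟩)

/-- There is an oracle relative to which there is a p-optimal proof system for `TAUT`, but none for
`SAT`, and there is neither a complete total search problem nor a complete disjoint `coNP` pair. -/
theorem exists_hard_world : ∃ O : Oracle, HasPOptimal O (TAUT O) ∧ ¬ HasPOptimal O (SAT O) ∧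
    ¬ HasCompleteTFNP O ∧ ¬ HasCompleteDisjCoNP O := by
  obtain ⟨G, h1, h2, h3, h4, h5, h6⟩ := exists_hard_generic
  exact ⟨hardScheme.build G, hasPOptimal_TAUT G, not_hasPOptimal_SAT_of_generic h2 h5,
    not_hasCompleteTFNP_of_generic h1 h4, not_hasCompleteDisjCoNP_of_generic h3 h6⟩

end RelWorlds

theorem mainTheorem3 :
    (∀ Q ∈ ({RelWorlds.CON, RelWorlds.CONN} : Set RelWorlds.Conjecture),
      ∀ Q' ∈ ({RelWorlds.SATc, RelWorlds.TFNPc, RelWorlds.DisjCoNPc} : Set RelWorlds.Conjecture),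
        ¬ RelWorlds.ImpliesRel Q Q' ∧ ¬ RelWorlds.ImpliesRel Q' Q) ∧
    (∃ O : RelWorlds.Oracle,
      RelWorlds.HasPOptimal O (RelWorlds.TAUT O) ∧ ¬ RelWorlds.HasCompleteTFNP O) ∧
    (∃ O : RelWorlds.Oracle,
      ¬ RelWorlds.HasPOptimal O (RelWorlds.TAUT O) ∧ RelWorlds.HasCompleteTFNP O) := by
  obtain ⟨A, hA, hAsat, hAtfnp, hAdisj⟩ := RelWorlds.exists_easy_world
  obtain ⟨B, hB, hBsat, hBtfnp, hBdisj⟩ := RelWorlds.exists_hard_world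
  have hA' : ¬ RelWorlds.HasPOptimal A (RelWorlds.TAUT A) := fun h => hA h.nonuniform
  refine ⟨fun Q hQ Q' hQ' => ?_, ⟨B, hB, hBtfnp⟩, ⟨A, hA', hAtfnp⟩⟩
  have hQA : Q A := by
    rcases hQ with rfl | rfl
    exacts [hA', hA]
  have hQB : ¬ Q B := by
    rcases hQ with rfl | rfl
    exacts [not_not_intro hB, not_not_intro hB.nonuniform]
  have hQ'A : ¬ Q' A := by
    rcases hQ' with rfl | rfl | rfl
    exacts [not_not_intro hAsat, not_not_intro hAtfnp, not_not_intro hAdisj]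
  have hQ'B : Q' B := by
    rcases hQ' with rfl | rfl | rfl
    exacts [hBsat, hBtfnp, hBdisj]
  exact ⟨fun h => hQ'A (h A hQA), fun h => hQB (h B hQ'B)⟩
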